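/- **Setting.** Let $R$ be a real closed field that is an o-minimal, power-bounded structure in a language $\mathcal L$ expanding the ring language (power-bounded: every definable $f\colon R\to R$ satisfies $|f(x)|\le g(x)$ for all large $x$, for some definable endomorphism $g$ of $R^\times$). "Definable" means definable with parameters, "$\mathcal L$-definable" means definable without parameters. $\|\cdot\|$ is the Euclidean norm on $R^n$, resp. the operator norm of matrices, and $\operatorname{dist}(a,X)=\inf_{x\in X}\|a-x\|$, with $\operatorname{dist}(a,\emptyset)=\infty$. A *definable stratification* of a $d$-dimensional definable set $X\subseteq R^n$ is a tuple $\mathcal X=(X^0\subseteq\dots\subseteq X^d=X)$ of definable sets, closed in $X$, with $\dim X^i\le i$, such that (with $X^{-1}=\emptyset$) each skeleton $\mathring X^i=X^i\setminus X^{i-1}$ is empty or an $i$-dimensional definable $C^1$ submanifold of $R^n$, and such that the closure of each stratum (definably connected component of a skeleton) is a union of strata. For $a\in\mathring X^i$, $P_a\colon R^n\to R^n$ is the orthogonal projection onto the tangent space $T_a\mathring X^i$. **Mostowski Conditions.** Let $c,c',C',C'',C'''>0$ be in $R$. A *plain chain* is a sequence $a^0,\dots,a^m$ ($m\ge0$),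 $a^\ell\in\mathring X^{e_\ell}$, $e_0>\dots>e_m$, such that $\|a^0-a^\ell\|<c\operatorname{dist}(a^0,X^{e_\ell})$ for $1\le\ell\le m$ and, for each $i$ with $e_m\le i<e_0$: $\operatorname{dist}(a^0,X^{i-1})\ge C'\operatorname{dist}(a^0,X^i)$ if $i\in\{e_1,\dots,e_m\}$, and $\operatorname{dist}(a^0,X^{i-1})<c'\operatorname{dist}(a^0,X^i)$ otherwise. An *augmented chain* is a sequence $a^0,a^1,\dots,a^m$ ($m\ge1$) where $a^0,a^2,\dots,a^m$ is a plain chain and $a^1\ne a^0$ lies in $\mathring X^{e_1}$, $e_1:=e_0$, with $C''\|a^0-a^1\|\le\operatorname{dist}(a^0,X^{e_1-1})$. The stratification $\mathcal X$ *satisfies the Mostowski Conditions for $(c,c',C',C'',C''')$* if $$\|(1-P_{a^0})P_{a^1}\cdots P_{a^m}\|<\frac{C'''\|a^0-a^1\|}{\operatorname{dist}(a^0,X^{e_m-1})}\quad\text{for all plain chains with } m\ge1,$$ $$\|(P_{a^0}-P_{a^1})P_{a^2}\cdots P_{a^m}\|<\frac{C'''\|a^0-a^1\|}{\operatorname{dist}(a^0,X^{e_m-1})}\quad\text{for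 all augmented chains},$$ where, if $X^{e_m-1}=\emptyset$, the left-hand side is required to be $0$. **Valuative conditions.** Let $R_0\preceq R$ be an elementary $\mathcal L$-substructure such that some element of $R$ is larger than all elements of $R_0$. Let $v$ be the (non-trivial) valuation on $R$ whose valuation ring is the convex closure of $R_0$. Put $v(a)=v(\|a\|)$ for vectors, $v(M)=\min_{i,j}v(M_{ij})$ for matrices, and $\operatorname{vdist}(a,X)=v(\operatorname{dist}(a,X))$, $\operatorname{vdist}(a,\emptyset)=-\infty$. A *plain (strict) val-chain* is a sequence $a^0,\dots,a^m$, $a^\ell\in\mathring X^{e_\ell}$, $e_0>\dots>e_m$, with $$\text{(i)}\ v(a^0-a^\ell)>\operatorname{vdist}(a^0,X^{e_\ell-1}),\qquad\text{(ii)}\ v(a^0-a^\ell)=\operatorname{vdist}(a^0,X^{e_{\ell-1}-1})\qquad(1\le\ell\le m).$$ An *augmented* val-chain has $m\ge1$ and $e_0=e_1>e_2>\dots>e_m$, with (i) for $1\le\ell\le m$ and (ii) for $2\le\ell\le m$. *Weak* val-chains are defined with $\ge$ instead of $>$ in (i). The *valuative Mostowski Condition* at a val-chain with $m\ge1$ is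 $$v(M)\ge v(a^0-a^1)-\operatorname{vdist}(a^0,X^{e_m-1}),$$ where $M=(1-P_{a^0})P_{a^1}\cdots P_{a^m}$ for plain and $M=(P_{a^0}-P_{a^1})P_{a^2}\cdots P_{a^m}$ for augmented val-chains, read as $M=0$ if $X^{e_m-1}=\emptyset$. $\mathcal X$ is a *valuative Lipschitz stratification* if this holds at every strict val-chain. **Proposition.** (A) Let $\mathcal X$ be an $\mathcal L$-definable stratification and let $c_0>1$ in $R$ be fixed. The following are equivalent: (1) $\mathcal X$ is a Lipschitz stratification in the sense of Parusiński: there is $C>0$ such that $\mathcal X$ satisfies the Mostowski Conditions for $(c_0,2c_0^2,2c_0^2,2c_0,C)$; (2) for every $c>0$ there is $C>0$ such that $\mathcal X$ satisfies the Mostowski Conditions for $(c,c,C,C,C)$; (3) for every $c>0$ there is $C>0$ such that $\mathcal X$ satisfies the Mostowski Conditions for $(c,c,1,\frac1c,C)$. (B) Let $\mathcal X=(\mathcal X_q)_{q\in Q}$ be an $\mathcal L$-definable family of stratifications (of an $\mathcal L$-definable family of $d$-dimensional subsets of $R^n$), $Q\subseteq R^N$ $\mathcal L$-definable. The following are equivalent: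 (1) for every $c>0$ there is $C>0$ such that all $\mathcal X_q$, $q\in Q$, satisfy the Mostowski Conditions for $(c,2c^2,2c^2,2c,C)$; (2) the same with $(c,c,C,C,C)$; (3) the same with $(c,c,1,\frac1c,C)$. (C) In (B), if $R_0\preceq R$ is as above, then (1), (2), (3) are also equivalent to each of: (2') for each $q\in Q$, $\mathcal X_q$ is a valuative Lipschitz stratification; (3') for each $q\in Q$, $\mathcal X_q$ satisfies the valuative Mostowski Condition at every weak val-chain. (D) In (B), let $R'\succeq R$ be any elementary extension having an element larger than all elements of $R$, and let $\mathcal X'=(\mathcal X'_q)_{q\in Q'}$ be the family of tuples of sets defined in $R'$ by the same formulas as $\mathcal X$ in $R$. Then (1), (2), (3) for $\mathcal X$ in $R$ are also equivalent to each of (1), (2), (3) for $\mathcal X'$ in $R'$, and to each of (2'), (3') for $\mathcal X'$ in $R'$, with respect to the valuation given by the convex closure of $R$ in $R'$. (Here the conditions (2'), (3') mean the valuative Mostowski Conditions at all strict, respectively weak, val-chains of $\mathcal X'_q$.) -/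

import Mathlib

open Set FirstOrder

noncomputable section

namespace LipStrat

universe u u₁ u₂

/-! ### o-minimality and power-boundedness -/

section Model

variable (L : FirstOrder.Language.{u₁, u₂}) (K : Type u) [L.Structure K]

/-- Definability with arbitrary parameters. -/
def Def {K : Type u} [L.Structure K] {α : Type} (s : Set (α → K)) : Prop :=
  (univ : Set K).Definable L s

/-- Every subset of `K` which is definable with parameters is a finite union of points and open
intervals (with endpoints in `K ∪ {±∞}`). -/
def OMinimal [LinearOrder K] : Prop :=
  ∀ s : Set K, (univ : Set K).Definable₁ L s →
    ∃ F : Set (Set K), F.Finite ∧ s = ⋃₀ F ∧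
      ∀ t ∈ F, (∃ a, t = {a}) ∨ (∃ a b, t = Ioo a b) ∨ (∃ a, t = Iio a) ∨ (∃ a, t = Ioi a) ∨
        t = univ

/-- Every definable function `K → K` is ultimately bounded by a power function, i.e. by a definable
endomorphism of the multiplicative group of `K`. -/
def PowerBounded [Field K] [LinearOrder K] : Prop :=
  ∀ f : K → K, (univ : Set K).Definable₂ L {p | p.2 = f p.1} →
    ∃ g : Kˣ →* Kˣ, (univ : Set K).Definable₂ L {p | ∃ u : Kˣ, p.1 = u ∧ p.2 = g u} ∧
      ∃ b : K, ∀ x : Kˣ, b < x → |f x| ≤ g x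

end Model

/-! ### Norms, distances, projections -/

section Euclid

variable {K : Type u} [Field K] [LinearOrder K]

/-- The Euclidean norm on `K ^ n`: the non-negative square root of the sum of the squares. (The root
exists since `K` is real closed.) -/
def vnorm {n : ℕ} (a : Fin n → K) : K :=
  open Classical in
  if h : ∃ b : K, 0 ≤ b ∧ b ^ 2 = ∑ i, a i ^ 2 then h.choose else 0

/-- The distance from a point to a set. It is `⊤` if the set is empty (the empty set has no greatest
lower bound in `K`); for non-empty definable sets the infimum exists by o-minimality. -/
def setDist {n : ℕ} (a : Fin n → K) (X : Set (Fin n → K)) : WithTop K :=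
  open Classical in
  if h : ∃ r : K, IsGLB ((fun x => vnorm (a - x)) '' X) r then (h.choose : WithTop K) else ⊤

/-- The operator norm `sup {‖M x‖ : ‖x‖ = 1}` of a matrix (`0` for the matrices of size `0`). -/
def opNorm {n : ℕ} (M : Matrix (Fin n) (Fin n) K) : K :=
  open Classical in
  if h : ∃ s : K, IsLUB {r | ∃ x : Fin n → K, vnorm x = 1 ∧ r = vnorm (M.mulVec x)} s
  then h.choose else 0

/-- `P` is the matrix of the orthogonal projection onto the subspace `T` of `K ^ n`. -/
def IsOrthProj {n : ℕ} (T : Submodule K (Fin n → K)) (P : Matrix (Fin n) (Fin n) K) : Prop :=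
  ∀ v, P.mulVec v ∈ T ∧ ∀ w ∈ T, w ⬝ᵥ (v - P.mulVec v) = 0

/-- The orthogonal projection onto `T` (it exists and is unique, `K` being an ordered field). -/
def orthProj {n : ℕ} (T : Submodule K (Fin n → K)) : Matrix (Fin n) (Fin n) K :=
  open Classical in
  if h : ∃ P, IsOrthProj T P then h.choose else 0

/-- The tangent space at `a` of a subset `X` of `K ^ n`: the space spanned by the limits of secants
of `X` at `a`. If `X` is a `C¹` submanifold with a chart `φ` around `a = φ x`, these
limits are exactly the vectors in the range of the derivative of `φ` at `x`. -/
def tangentSpace {n : ℕ} (X : Set (Fin n → K)) (a : Fin n → K) : Submodule K (Fin n → K) :=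
  Submodule.span K {v | ∀ ε > 0, ∃ x ∈ X, ∃ t : K, 0 < t ∧
    vnorm (x - a) < ε ∧ vnorm (t • (x - a) - v) < ε}

end Euclid

/-! ### Definable manifolds, dimension, stratifications -/

section Strat

variable (L : FirstOrder.Language.{u₁, u₂}) {K : Type u} [Field K] [LinearOrder K] [TopologicalSpace K]
  [L.Structure K]

/-- `dim X ≥ k`: some projection of `X` to `k` of the coordinates has non-empty interior. -/
def DimGE {n : ℕ} (X : Set (Fin n → K)) (k : ℕ) : Prop :=
  ∃ e : Fin k ↪ Fin n, (interior ((fun x : Fin n → K => x ∘ e) '' X)).Nonempty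

/-- `dim X ≤ k`. -/
def DimLE {n : ℕ} (X : Set (Fin n → K)) (k : ℕ) : Prop := ¬ DimGE X (k + 1)

/-- `J` is the Jacobian matrix of `f` at the point `x` of the open set `V`. -/
def HasJacobianAt {d n : ℕ} (V : Set (Fin d → K)) (f : (Fin d → K) → (Fin n → K))
    (J : Matrix (Fin n) (Fin d) K) (x : Fin d → K) : Prop :=
  ∀ ε > 0, ∃ δ > 0, ∀ y ∈ V, vnorm (y - x) < δ →
    vnorm (f y - f x - J.mulVec (y - x)) ≤ ε * vnorm (y - x)

/-- `φ` restricts to a definable `C¹` parametrization `V → U` of a subset `U` of `K ^ n` by an open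
definable subset `V` of `K ^ d`: a homeomorphism which is `C¹` with injective derivatives. -/
structure IsChart {d n : ℕ} (U : Set (Fin n → K)) (V : Set (Fin d → K))
    (φ : (Fin d → K) → (Fin n → K)) : Prop where
  isOpen : IsOpen V
  definable_source : Def L V
  definable_map : Def L
    {p : Fin d ⊕ Fin n → K | p ∘ Sum.inl ∈ V ∧ φ (p ∘ Sum.inl) = p ∘ Sum.inr}
  bijOn : BijOn φ V U
  inverse_continuous : ∃ ψ : (Fin n → K) → (Fin d → K), ContinuousOn ψ U ∧ LeftInvOn ψ φ V
  contDiff : ∃ J : (Fin d → K) → Matrix (Fin n) (Fin d) K, ContinuousOn J V ∧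
    ∀ x ∈ V, HasJacobianAt V φ (J x) x ∧ Function.Injective (J x).mulVec

/-- `X` is a definable `C¹` submanifold of `K ^ n` of dimension `d`: it has a finite definable open
cover by sets that are parametrized by open subsets of `K ^ d`. -/
def IsC1Submanifold {n : ℕ} (d : ℕ) (X : Set (Fin n → K)) : Prop :=
  Def L X ∧
  ∃ (r : ℕ) (U : Fin r → Set (Fin n → K)) (V : Fin r → Set (Fin d → K))
    (φ : Fin r → (Fin d → K) → (Fin n → K)),
    X = ⋃ j, U j ∧
    ∀ j, Def L (U j) ∧ (∃ W, IsOpen W ∧ U j = X ∩ W) ∧ IsChart L (U j) (V j) (φ j)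

/-- `X` is not the disjoint union of two non-empty, relatively closed, definable subsets. -/
def DefConnected {n : ℕ} (X : Set (Fin n → K)) : Prop :=
  ∀ A B : Set (Fin n → K), Def L A → Def L B → X = A ∪ B → Disjoint A B →
    closure A ∩ X ⊆ A → closure B ∩ X ⊆ B → A = ∅ ∨ B = ∅

/-- `S` is a definably connected component of `X`. -/
def IsDefComponent {n : ℕ} (X S : Set (Fin n → K)) : Prop :=
  Def L S ∧ S.Nonempty ∧ S ⊆ X ∧ DefConnected L S ∧
    ∀ S', Def L S' → DefConnected L S' → S ⊆ S' → S' ⊆ X → S' = S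

/-- `X ^ (i - 1)`, where `X ^ (-1) = ∅`. -/
def prev {α : Type*} {d : ℕ} (X : Fin (d + 1) → Set α) (i : Fin (d + 1)) : Set α :=
  Fin.cases (motive := fun _ => Set α) ∅ (fun j : Fin d => X j.castSucc) i

/-- The `i`-th skeleton `X ^ i \ X ^ (i - 1)`. -/
def skel {α : Type*} {d : ℕ} (X : Fin (d + 1) → Set α) (i : Fin (d + 1)) : Set α :=
  X i \ prev X i

/-- A stratum is a definably connected component of a skeleton. -/
def IsStratum {n d : ℕ} (X : Fin (d + 1) → Set (Fin n → K)) (S : Set (Fin n → K)) : Prop :=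
  ∃ i, IsDefComponent L (skel X i) S

/-- `X ^ 0 ⊆ ... ⊆ X ^ d` is a definable stratification of the `d`-dimensional set `X ^ d`. -/
structure IsStratification {n d : ℕ} (X : Fin (d + 1) → Set (Fin n → K)) : Prop where
  definable : ∀ i, Def L (X i)
  mono : Monotone X
  dim_ge : DimGE (X (Fin.last d)) d
  closed : ∀ i, closure (X i) ∩ X (Fin.last d) ⊆ X i
  dim_le : ∀ i, DimLE (X i) i
  manifold : ∀ i, skel X i = ∅ ∨ IsC1Submanifold L (i : ℕ) (skel X i)
  frontier : ∀ S, IsStratum L X S → ∃ F : Set (Set (Fin n → K)),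
    (∀ S' ∈ F, IsStratum L X S') ∧ closure S = ⋃₀ F

end Strat

/-! ### Chains and the Mostowski conditions -/

section Mostowski

variable {K : Type u} [Field K] [LinearOrder K] {n d : ℕ}

/-- The projection `P_a` onto the tangent space at `a` of the `i`-th skeleton (for `a` in it). -/
def proj (X : Fin (d + 1) → Set (Fin n → K)) (i : Fin (d + 1)) (a : Fin n → K) :
    Matrix (Fin n) (Fin n) K :=
  orthProj (tangentSpace (skel X i) a)

/-- The product `P_{a 1} P_{a 2} ⋯ P_{a m}` for a sequence `a 0, ..., a m`. -/
def tailProd (X : Fin (d + 1) → Set (Fin n → K)) {m : ℕ} (e : Fin (m + 1) → Fin (d + 1))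
    (a : Fin (m + 1) → Fin n → K) : Matrix (Fin n) (Fin n) K :=
  (List.ofFn fun l : Fin m => proj X (e l.succ) (a l.succ)).prod

/-- Plain chains for the constants `(c, c', C')`, with `a l` in the skeleton of dimension `e l`. -/
structure IsPlainChain (X : Fin (d + 1) → Set (Fin n → K)) (c c' C' : K) {m : ℕ}
    (e : Fin (m + 1) → Fin (d + 1)) (a : Fin (m + 1) → Fin n → K) : Prop where
  mem : ∀ l, a l ∈ skel X (e l)
  anti : StrictAnti e
  near : ∀ l : Fin m,
    ((vnorm (a 0 - a l.succ) : K) : WithTop K) < (c : WithTop K) * setDist (a 0) (X (e l.succ))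
  far : ∀ i, e (Fin.last m) ≤ i → i < e 0 → (∃ l : Fin m, i = e l.succ) →
    (C' : WithTop K) * setDist (a 0) (X i) ≤ setDist (a 0) (prev X i)
  gap : ∀ i, e (Fin.last m) ≤ i → i < e 0 → (¬ ∃ l : Fin m, i = e l.succ) →
    setDist (a 0) (prev X i) < (c' : WithTop K) * setDist (a 0) (X i)

/-- `M` has norm less than `C * r / D`; if `D = ⊤`, this is read as `M` having norm `0`. -/
def MostBound (M : Matrix (Fin n) (Fin n) K) (C r : K) (D : WithTop K) : Prop :=
  (D = ⊤ → opNorm M = 0) ∧ ∀ w : K, D = w → opNorm M < C * r / w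

/-- The Mostowski conditions for `(c, c', C', C'', C''')`, where the constants are positive. In `m2`,
the augmented chain is `a 0, b, a 1, ..., a m`, that is, a plain chain `a` together with an additional
point `b ≠ a 0` in the skeleton of `a 0`, satisfying `‖a 0 - b‖ ≤ dist (a 0, X ^ (e 0 - 1)) / C''`. -/
structure Mostowski (X : Fin (d + 1) → Set (Fin n → K)) (c c' C' C'' C''' : K) : Prop where
  m1 : ∀ (m : ℕ) (e : Fin (m + 2) → Fin (d + 1)) (a : Fin (m + 2) → Fin n → K),
    IsPlainChain X c c' C' e a →
    MostBound ((1 - proj X (e 0) (a 0)) * tailProd X e a) C''' (vnorm (a 0 - a 1))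
      (setDist (a 0) (prev X (e (Fin.last (m + 1)))))
  m2 : ∀ (m : ℕ) (e : Fin (m + 1) → Fin (d + 1)) (a : Fin (m + 1) → Fin n → K) (b : Fin n → K),
    IsPlainChain X c c' C' e a → b ∈ skel X (e 0) → b ≠ a 0 →
    (C'' : WithTop K) * ((vnorm (a 0 - b) : K) : WithTop K) ≤ setDist (a 0) (prev X (e 0)) →
    MostBound ((proj X (e 0) (a 0) - proj X (e 0) b) * tailProd X e a) C''' (vnorm (a 0 - b))
      (setDist (a 0) (prev X (e (Fin.last m))))

/-- Lipschitz stratification in the sense of Parusiński, for a fixed constant `c`. -/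
def IsLipschitz (c : K) (X : Fin (d + 1) → Set (Fin n → K)) : Prop :=
  ∃ C > 0, Mostowski X c (2 * c ^ 2) (2 * c ^ 2) (2 * c) C

/-- A family `X` of tuples of sets, indexed by the set `Q`, is uniformly Lipschitz: version with the
constants `(c, 2c², 2c², 2c, C)`. -/
def UnifLip1 {ι : Type*} (Q : Set ι) (X : ι → Fin (d + 1) → Set (Fin n → K)) : Prop :=
  ∀ c > (0 : K), ∃ C > 0, ∀ q ∈ Q, Mostowski (X q) c (2 * c ^ 2) (2 * c ^ 2) (2 * c) C

/-- Version with the constants `(c, c, C, C, C)`. -/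
def UnifLip2 {ι : Type*} (Q : Set ι) (X : ι → Fin (d + 1) → Set (Fin n → K)) : Prop :=
  ∀ c > (0 : K), ∃ C > 0, ∀ q ∈ Q, Mostowski (X q) c c C C C

/-- Version with the constants `(c, c, 1, 1/c, C)`. -/
def UnifLip3 {ι : Type*} (Q : Set ι) (X : ι → Fin (d + 1) → Set (Fin n → K)) : Prop :=
  ∀ c > (0 : K), ∃ C > 0, ∀ q ∈ Q, Mostowski (X q) c c 1 (1 / c) C

end Mostowski

/-! ### The valuative notions -/

section Valuative

variable {K : Type u} [Field K] [LinearOrder K]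

/-- The underlying subring of a substructure, for a language expanding the language of rings. -/
def toSubring [FirstOrder.Ring.CompatibleRing K] {L : FirstOrder.Language.{u₁, u₂}} [L.Structure K]
    (ι : FirstOrder.Language.ring →ᴸ L) [ι.IsExpansionOn K] (S : L.Substructure K) : Subring K where
  carrier := S
  mul_mem' {a b} ha hb := by
    have := S.fun_mem (ι.onFunction FirstOrder.Ring.mulFunc) ![a, b] (by simpa [Fin.forall_fin_two] using And.intro ha hb)
    simpa using this
  one_mem' := by
    have := S.fun_mem (ι.onFunction FirstOrder.Ring.oneFunc) ![] (by simp)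
    simpa using this
  add_mem' {a b} ha hb := by
    have := S.fun_mem (ι.onFunction FirstOrder.Ring.addFunc) ![a, b] (by simpa [Fin.forall_fin_two] using And.intro ha hb)
    simpa using this
  zero_mem' := by
    have := S.fun_mem (ι.onFunction FirstOrder.Ring.zeroFunc) ![] (by simp)
    simpa using this
  neg_mem' {a} ha := by
    have := S.fun_mem (ι.onFunction FirstOrder.Ring.negFunc) ![a] (by simpa using ha)
    simpa using this

variable [IsStrictOrderedRing K]

/-- The convex closure `{a : ∃ b ∈ S, -b < a < b}` of a subring of an ordered field. -/
def convexClosure (S : Subring K) : ValuationSubring K where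
  carrier := {a | ∃ b ∈ S, |a| < b}
  mul_mem' := by
    rintro x y ⟨b, hb, hx⟩ ⟨b', hb', hy⟩
    exact ⟨b * b', S.mul_mem hb hb', by
      rw [abs_mul]; exact mul_lt_mul'' hx hy (abs_nonneg _) (abs_nonneg _)⟩
  one_mem' := ⟨1 + 1, S.add_mem S.one_mem S.one_mem, by simp⟩
  add_mem' := by
    rintro x y ⟨b, hb, hx⟩ ⟨b', hb', hy⟩
    exact ⟨b + b', S.add_mem hb hb', (abs_add_le x y).trans_lt (add_lt_add hx hy)⟩
  zero_mem' := ⟨1, S.one_mem, by simp⟩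
  neg_mem' := by
    rintro x ⟨b, hb, hx⟩
    exact ⟨b, hb, by rwa [abs_neg]⟩
  mem_or_inv_mem' x := by
    have h2 : (1 : K) + 1 ∈ S := S.add_mem S.one_mem S.one_mem
    rcases le_total |x| 1 with h | h
    · exact Or.inl ⟨1 + 1, h2, h.trans_lt (by simp)⟩
    · refine Or.inr ⟨1 + 1, h2, ?_⟩
      rw [abs_inv]
      exact (inv_le_one_of_one_le₀ h).trans_lt (by simp)

variable {n d : ℕ} (O : ValuationSubring K)

/-! Mathlib writes the valuation `O.valuation` of a valuation ring multiplicatively: bigger additive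
valuation means smaller multiplicative valuation, `∞` becomes `0`, and the additive value `-∞` (for
the distance to the empty set) becomes `⊤`. -/

/-- The valuation of a vector `a`, i.e. `v(‖a‖)`. -/
def vecVal (a : Fin n → K) : O.ValueGroup := O.valuation (vnorm a)

/-- The valuative distance `v(dist(a, X))`; it is `⊤` if `X = ∅`. -/
def valDist (a : Fin n → K) (X : Set (Fin n → K)) : WithTop O.ValueGroup :=
  (setDist a X).map O.valuation

/-- Plain val-chains. In additive notation, `nai` is `v(a⁰ - aˡ) > valdist(a⁰, X ^ (e_l - 1))`,
replaced by `≥` for weak val-chains, and `nae` is `v(a⁰ - aˡ) = valdist(a⁰, X ^ (e_{l-1} - 1))`. -/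
structure IsPlainValChain (weak : Prop) (X : Fin (d + 1) → Set (Fin n → K)) {m : ℕ}
    (e : Fin (m + 1) → Fin (d + 1)) (a : Fin (m + 1) → Fin n → K) : Prop where
  mem : ∀ l, a l ∈ skel X (e l)
  anti : StrictAnti e
  nai : ∀ l : Fin m,
    (vecVal O (a 0 - a l.succ) : WithTop O.ValueGroup) < valDist O (a 0) (prev X (e l.succ)) ∨
    (weak ∧
      (vecVal O (a 0 - a l.succ) : WithTop O.ValueGroup) ≤ valDist O (a 0) (prev X (e l.succ)))
  nae : ∀ l : Fin m,
    (vecVal O (a 0 - a l.succ) : WithTop O.ValueGroup) = valDist O (a 0) (prev X (e l.castSucc))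

/-- `v(M) ≥ v(r) - lam` in additive notation, where `v(M)` is the minimum of the valuations of the
entries; if `lam = ⊤` (additively, `-∞`), this is read as `M = 0`. -/
def ValBound (M : Matrix (Fin n) (Fin n) K) (r : O.ValueGroup) (lam : WithTop O.ValueGroup) : Prop :=
  (lam = ⊤ → M = 0) ∧ ∀ w : O.ValueGroup, lam = w → ∀ i j, O.valuation (M i j) * w ≤ r

/-- The valuative Mostowski conditions at all strict (or all weak) val-chains. In `vm2`, the augmented
val-chain is `a 0, b, a 1, ..., a m`, that is, a plain val-chain `a` together with an additional point
`b` in the skeleton of `a 0`, with `v(a 0 - b) > valdist(a 0, X ^ (e 0 - 1))` (`≥` if weak). -/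
structure ValMostowski (weak : Prop) (X : Fin (d + 1) → Set (Fin n → K)) : Prop where
  vm1 : ∀ (m : ℕ) (e : Fin (m + 2) → Fin (d + 1)) (a : Fin (m + 2) → Fin n → K),
    IsPlainValChain O weak X e a →
    ValBound O ((1 - proj X (e 0) (a 0)) * tailProd X e a) (vecVal O (a 0 - a 1))
      (valDist O (a 0) (prev X (e (Fin.last (m + 1)))))
  vm2 : ∀ (m : ℕ) (e : Fin (m + 1) → Fin (d + 1)) (a : Fin (m + 1) → Fin n → K) (b : Fin n → K),
    IsPlainValChain O weak X e a → b ∈ skel X (e 0) →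
    ((vecVal O (a 0 - b) : WithTop O.ValueGroup) < valDist O (a 0) (prev X (e 0)) ∨
      (weak ∧ (vecVal O (a 0 - b) : WithTop O.ValueGroup) ≤ valDist O (a 0) (prev X (e 0)))) →
    ValBound O ((proj X (e 0) (a 0) - proj X (e 0) b) * tailProd X e a) (vecVal O (a 0 - b))
      (valDist O (a 0) (prev X (e (Fin.last m))))

/-- Valuative Lipschitz stratifications: the conditions hold at every (strict) val-chain. -/
def IsValLipschitz (X : Fin (d + 1) → Set (Fin n → K)) : Prop := ValMostowski O False X

/-- The valuative Mostowski conditions hold at every weak val-chain. -/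
def IsWeakValLipschitz (X : Fin (d + 1) → Set (Fin n → K)) : Prop := ValMostowski O True X

end Valuative

/-! ### Families given by formulas without parameters -/

/-- Formulas defining a parameter set `Q ⊆ K ^ N` and families `X ^ 0, ..., X ^ d` of subsets of
`K ^ n` parametrized by `Q`, in any structure `K`. -/
structure Family (L : FirstOrder.Language.{u₁, u₂}) (N n d : ℕ) where
  base : L.Formula (Fin N)
  strat : Fin (d + 1) → L.Formula (Fin n ⊕ Fin N)

namespace Family

variable {L : FirstOrder.Language.{u₁, u₂}} {N n d : ℕ} (F : Family L N n d) (K : Type u) [L.Structure K]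

/-- The parameter set. -/
def Q : Set (Fin N → K) := {q | F.base.Realize q}

/-- The fibre at the parameter `q`. -/
def fiber (q : Fin N → K) (i : Fin (d + 1)) : Set (Fin n → K) :=
  {x | (F.strat i).Realize (Sum.elim x q)}

/-- In `K`, the formulas define a family of stratifications (of a family of `d`-dimensional sets). -/
def IsStratFamily [Field K] [LinearOrder K] [TopologicalSpace K] : Prop :=
  ∀ q ∈ F.Q K, IsStratification L (F.fiber K q)

end Family

end LipStrat

end

noncomputable section

set_option linter.unusedSectionVars false
set_option linter.unusedVariables false

namespace LipStrat

universe u₁ u₂ v₁ v₂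

/-! Everything is routed through the valuative condition at all weak val-chains. Let `S` be the
smaller structure and `v` the valuation whose ring is the convex closure of `S`. A factor from `S`
is invisible to `v`, while a strict inequality of values is an inequality by every factor from `S`.
Hence a plain chain for `(c, c, 1)` with `c ∈ S` is a weak val-chain, and a strict val-chain is a
plain chain for `(c, c, C)` with one suitable `c ∈ S` and every positive `C ∈ S`. Bounds translate
in the same way: a Mostowski bound with constant in `S` gives the valuative bound, and the valuative
bound gives the Mostowski bound with any constant exceeding `S`. Elementarity moves constants into
`S`, so (2) yields the bound at strict val-chains, and the bound at weak ones yields (3). From (3),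
the versions (1) and (2) follow by monotonicity in the constants (`Mostowski.enlarge`).

What remains is to reach weak val-chains from strict ones, or from Parusiński's constants for a
single `c > 1`. This is an ultrametric argument, `plainBound_and_augBound`. Give each chain point
its distance to `a⁰` as a radius. The estimates say that a product has entries of size at most `r /
s`, with `r` the starting and `s` the final radius, and such bounds multiply by cancelling
(`EntryBound.mul`). In a weak chain, delete the nodes whose radius equals the next one; the result
is strict. Compare it on one side with the original chain, and on the other with a chain of nearly
nearest points on all levels where the distance function of `a⁰` jumps. Both arise from the strict
chain by moving points within their radii and by inserting nodes. The difference of the products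
telescopes into terms containing a factor `P_x - P_y` or `1 - P_y` followed by a shorter chain
(`entryBound_sub_of_refine`). These are controlled by induction on the range of levels, and the
chain of nearest points is controlled by the hypothesis (`exists_plainChain`, `exists_valChain`).

For elementarity, all uniform conditions are written as one formula interpreted in two structures
(`UDef`). O-minimality supplies the infima and suprema in the definitions; these facts are
first-order and pass to extensions. An ultrapower provides a non-standard extension when none is
given. It also handles one fixed `c₀`, because `c₀` and its constant `C` then lie in the smaller
structure. -/

/-- Non-negative elements are squares. -/
class HasSqrt (K : Type*) [Field K] [LinearOrder K] : Prop where
  exists_sq : ∀ x : K, 0 ≤ x → ∃ y, 0 ≤ y ∧ y ^ 2 = x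

/-- Square roots are all that the argument takes from real closedness, so the ultrapower constructed
later only has to inherit these. -/
instance {K : Type*} [Field K] [LinearOrder K] [IsStrictOrderedRing K] [IsRealClosed K] :
    HasSqrt K where
  exists_sq x hx := by
    obtain ⟨y, hy⟩ := IsRealClosed.nonneg_iff_isSquare.1 hx
    exact ⟨|y|, abs_nonneg y, by rw [sq_abs, hy, sq]⟩

/-! ### The Euclidean norm -/

section Norm

variable {K : Type*} [Field K] [LinearOrder K] [IsStrictOrderedRing K] {n : ℕ}

lemma vnorm_nonneg (a : Fin n → K) : 0 ≤ vnorm a := by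
  unfold vnorm
  split_ifs with h
  · exact h.choose_spec.1
  · exact le_rfl

variable [HasSqrt K]

lemma vnorm_sq (a : Fin n → K) : vnorm a ^ 2 = ∑ i, a i ^ 2 := by
  have h : ∃ b : K, 0 ≤ b ∧ b ^ 2 = ∑ i, a i ^ 2 :=
    HasSqrt.exists_sq _ (Finset.sum_nonneg fun i _ => sq_nonneg _)
  unfold vnorm
  rw [dif_pos h]
  exact h.choose_spec.2

lemma eq_vnorm_iff (a : Fin n → K) (b : K) : b = vnorm a ↔ 0 ≤ b ∧ b ^ 2 = ∑ i, a i ^ 2 := by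
  constructor
  · rintro rfl; exact ⟨vnorm_nonneg a, vnorm_sq a⟩
  · rintro ⟨h0, h⟩
    rw [← vnorm_sq] at h
    exact (sq_eq_sq₀ h0 (vnorm_nonneg a)).1 h

lemma abs_le_vnorm (a : Fin n → K) (i : Fin n) : |a i| ≤ vnorm a := by
  rw [← sq_le_sq₀ (abs_nonneg _) (vnorm_nonneg a), vnorm_sq, sq_abs]
  exact Finset.single_le_sum (f := fun i => a i ^ 2) (fun i _ => sq_nonneg _) (Finset.mem_univ i)

lemma vnorm_eq_zero {a : Fin n → K} : vnorm a = 0 ↔ a = 0 := by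
  constructor
  · intro h
    funext i
    have := abs_le_vnorm a i
    rw [h] at this
    simpa using abs_nonpos_iff.1 this
  · rintro rfl
    exact ((eq_vnorm_iff _ _).2 ⟨le_rfl, by simp⟩).symm

lemma vnorm_sub_pos {a b : Fin n → K} (h : a ≠ b) : 0 < vnorm (a - b) :=
  lt_of_le_of_ne (vnorm_nonneg _) fun h0 => h (sub_eq_zero.1 (vnorm_eq_zero.1 h0.symm))

lemma vnorm_neg (a : Fin n → K) : vnorm (-a) = vnorm a :=
  ((eq_vnorm_iff _ _).2 ⟨vnorm_nonneg _, by rw [vnorm_sq]; simp⟩).symm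

lemma vnorm_sub_comm (a b : Fin n → K) : vnorm (a - b) = vnorm (b - a) := by
  rw [← vnorm_neg, neg_sub]

lemma vnorm_add_le (a b : Fin n → K) : vnorm (a + b) ≤ vnorm a + vnorm b := by
  have h0 : 0 ≤ vnorm a + vnorm b := add_nonneg (vnorm_nonneg a) (vnorm_nonneg b)
  rw [← sq_le_sq₀ (vnorm_nonneg _) h0, vnorm_sq, add_sq, vnorm_sq a, vnorm_sq b]
  have h1 : ∑ i, a i * b i ≤ vnorm a * vnorm b := by
    refine le_of_sq_le_sq ?_ (mul_nonneg (vnorm_nonneg a) (vnorm_nonneg b))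
    rw [mul_pow, vnorm_sq, vnorm_sq]
    exact Finset.sum_mul_sq_le_sq_mul_sq _ _ _
  have h2 : ∑ i, (a + b) i ^ 2 = ∑ i, a i ^ 2 + 2 * ∑ i, a i * b i + ∑ i, b i ^ 2 := by
    rw [Finset.mul_sum, ← Finset.sum_add_distrib, ← Finset.sum_add_distrib]
    exact Finset.sum_congr rfl fun i _ => by simp only [Pi.add_apply]; ring
  rw [h2]
  linarith

lemma vnorm_sub_le (a b c : Fin n → K) : vnorm (a - c) ≤ vnorm (a - b) + vnorm (b - c) := by
  simpa using vnorm_add_le (a - b) (b - c)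

lemma vnorm_le_sum_abs (a : Fin n → K) : vnorm a ≤ ∑ i, |a i| := by
  have h0 : 0 ≤ ∑ i, |a i| := Finset.sum_nonneg fun i _ => abs_nonneg _
  rw [← sq_le_sq₀ (vnorm_nonneg _) h0, vnorm_sq]
  have : ∀ i, a i ^ 2 = |a i| ^ 2 := fun i => (sq_abs _).symm
  simp_rw [this]
  exact Finset.sum_sq_le_sq_sum_of_nonneg fun i _ => abs_nonneg _

lemma vnorm_single (j : Fin n) : vnorm (Pi.single j (1 : K)) = 1 := by
  refine ((eq_vnorm_iff _ _).2 ⟨zero_le_one, ?_⟩).symm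
  simp [Pi.single_apply]

end Norm

/-! ### Distances to sets -/

section Dist

variable {K : Type*} [Field K] [LinearOrder K] {n : ℕ}

lemma setDist_eq_coe_iff (a : Fin n → K) (X : Set (Fin n → K)) (r : K) :
    setDist a X = r ↔ IsGLB ((fun x => vnorm (a - x)) '' X) r := by
  unfold setDist
  split_ifs with h
  · rw [WithTop.coe_eq_coe]
    exact ⟨fun e => e ▸ h.choose_spec, fun e => h.choose_spec.unique e⟩
  · exact ⟨fun e => by simp at e, fun e => (h ⟨r, e⟩).elim⟩

/-- Distances to `X` are attained as infima (unless `X` is empty). -/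
def HasDist (X : Set (Fin n → K)) : Prop :=
  ∀ a : Fin n → K, X.Nonempty → ∃ r : K, IsGLB ((fun x => vnorm (a - x)) '' X) r

lemma setDist_empty [IsStrictOrderedRing K] (a : Fin n → K) : setDist a ∅ = ⊤ := by
  unfold setDist
  rw [dif_neg]
  rintro ⟨r, hr⟩
  rw [image_empty, isGLB_empty_iff] at hr
  exact not_isTop r hr

lemma HasDist.exists {X : Set (Fin n → K)} (hX : HasDist X) (a : Fin n → K) (h : X.Nonempty) :
    ∃ r : K, setDist a X = r := by
  obtain ⟨r, hr⟩ := hX a h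
  exact ⟨r, (setDist_eq_coe_iff _ _ _).2 hr⟩

lemma setDist_nonneg [IsStrictOrderedRing K] {X : Set (Fin n → K)} {a : Fin n → K} {r : K}
    (h : setDist a X = r) : 0 ≤ r :=
  ((setDist_eq_coe_iff _ _ _).1 h).2 (by rintro _ ⟨x, -, rfl⟩; exact vnorm_nonneg _)

lemma le_vnorm_of_setDist {X : Set (Fin n → K)} {a x : Fin n → K} {r : K}
    (h : setDist a X = r) (hx : x ∈ X) : r ≤ vnorm (a - x) :=
  ((setDist_eq_coe_iff _ _ _).1 h).1 ⟨x, hx, rfl⟩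

lemma le_of_setDist {X : Set (Fin n → K)} {a : Fin n → K} {r t : K}
    (h : setDist a X = r) (ht : ∀ x ∈ X, t ≤ vnorm (a - x)) : t ≤ r :=
  ((setDist_eq_coe_iff _ _ _).1 h).2 (by rintro _ ⟨x, hx, rfl⟩; exact ht x hx)

lemma exists_vnorm_lt_of_setDist {X : Set (Fin n → K)} {a : Fin n → K} {r t : K}
    (h : setDist a X = r) (ht : r < t) : ∃ x ∈ X, vnorm (a - x) < t := by
  by_contra! hc
  exact ht.not_ge (le_of_setDist h hc)

lemma setDist_le_of_mem [IsStrictOrderedRing K] {X : Set (Fin n → K)} (hX : HasDist X)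
    {a x : Fin n → K} (hx : x ∈ X) : setDist a X ≤ (vnorm (a - x) : K) := by
  obtain ⟨r, hr⟩ := hX.exists a ⟨x, hx⟩
  rw [hr]
  exact WithTop.coe_le_coe.2 (le_vnorm_of_setDist hr hx)

lemma setDist_anti [IsStrictOrderedRing K] {X Y : Set (Fin n → K)} (hX : HasDist X)
    (hY : HasDist Y) (h : X ⊆ Y) (a : Fin n → K) : setDist a Y ≤ setDist a X := by
  rcases X.eq_empty_or_nonempty with rfl | hne
  · rw [setDist_empty]; exact le_top
  · obtain ⟨r, hr⟩ := hX.exists a hne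
    obtain ⟨s, hs⟩ := hY.exists a (hne.mono h)
    rw [hr, hs, WithTop.coe_le_coe]
    exact le_of_setDist hr fun x hx => le_vnorm_of_setDist hs (h hx)

lemma hasDist_empty : HasDist (∅ : Set (Fin n → K)) := fun _ h => (Set.not_nonempty_empty h).elim

end Dist

/-! ### Operator norms and orthogonal projections -/

section Op

variable {K : Type*} [Field K] [LinearOrder K] {n : ℕ}

/-- The suprema defining the operator norms exist. -/
def HasOpNorm (K : Type*) [Field K] [LinearOrder K] (n : ℕ) : Prop :=
  ∀ M : Matrix (Fin n) (Fin n) K, 0 < n →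
    ∃ s : K, IsLUB {r | ∃ x : Fin n → K, vnorm x = 1 ∧ r = vnorm (M.mulVec x)} s

/-- This eliminates the choice and the default value `0`, so that the graph of the norm can be
expressed by a formula. -/
lemma eq_opNorm_iff (M : Matrix (Fin n) (Fin n) K) (s : K) : s = opNorm M ↔
    IsLUB {r | ∃ x : Fin n → K, vnorm x = 1 ∧ r = vnorm (M.mulVec x)} s ∨
    (¬ ∃ t, IsLUB {r | ∃ x : Fin n → K, vnorm x = 1 ∧ r = vnorm (M.mulVec x)} t) ∧ s = 0 := by
  unfold opNorm
  split_ifs with h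
  · constructor
    · rintro rfl; exact Or.inl h.choose_spec
    · rintro (h' | h')
      · exact h'.unique h.choose_spec
      · exact (h'.1 h).elim
  · constructor
    · rintro rfl; exact Or.inr ⟨h, rfl⟩
    · rintro (h' | h')
      · exact (h ⟨s, h'⟩).elim
      · exact h'.2

variable [IsStrictOrderedRing K] [HasSqrt K]

lemma HasOpNorm.isLUB (h : HasOpNorm K n) (hn : 0 < n) (M : Matrix (Fin n) (Fin n) K) :
    IsLUB {r | ∃ x : Fin n → K, vnorm x = 1 ∧ r = vnorm (M.mulVec x)} (opNorm M) := by
  rcases (eq_opNorm_iff M _).1 rfl with h' | h'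
  · exact h'
  · exact (h'.1 (h M hn)).elim

lemma abs_entry_le_opNorm (h : HasOpNorm K n) (M : Matrix (Fin n) (Fin n) K) (i j : Fin n) :
    |M i j| ≤ opNorm M := by
  have h1 : vnorm (M.mulVec (Pi.single j 1)) ≤ opNorm M :=
    (h.isLUB i.pos M).1 ⟨_, vnorm_single j, rfl⟩
  refine le_trans ?_ h1
  refine le_trans (le_of_eq ?_) (abs_le_vnorm _ i)
  simp

/-- A crude factor `n²` is harmless: it lies in every subring, so norm and largest entry are
interchangeable up to the valuation. -/
lemma opNorm_le (h : HasOpNorm K n) (M : Matrix (Fin n) (Fin n) K) (B : K)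
    (hB : ∀ i j, |M i j| ≤ B) : opNorm M ≤ n * (n * B) := by
  -- For `n = 0` there are no unit vectors, and the empty set has no least upper bound, so the norm
  -- takes its default value `0`.
  rcases Nat.eq_zero_or_pos n with rfl | hn
  · have : ¬ ∃ t : K, IsLUB {r | ∃ x : Fin 0 → K, vnorm x = 1 ∧ r = vnorm (M.mulVec x)} t := by
      rintro ⟨t, ht⟩
      have hz : ∀ x : Fin 0 → K, vnorm x = 0 := fun x =>
        vnorm_eq_zero.2 (Subsingleton.elim _ _)
      have : {r | ∃ x : Fin 0 → K, vnorm x = 1 ∧ r = vnorm (M.mulVec x)} = ∅ := by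
        ext r
        simp [hz]
      rw [this, isLUB_empty_iff] at ht
      exact not_isBot t ht
    rw [← (eq_opNorm_iff M 0).2 (Or.inr ⟨this, rfl⟩)]
    simp
  · refine (h.isLUB hn M).2 ?_
    rintro _ ⟨x, hx, rfl⟩
    refine (vnorm_le_sum_abs _).trans ?_
    have key : ∀ i, |(M.mulVec x) i| ≤ n * B := fun i => by
      have e : (M.mulVec x) i = ∑ j, M i j * x j := rfl
      rw [e]
      refine (Finset.abs_sum_le_sum_abs _ _).trans ?_
      refine (Finset.sum_le_card_nsmul _ _ B fun j _ => ?_).trans (by simp)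
      rw [abs_mul]
      have := abs_le_vnorm x j
      rw [hx] at this
      calc |M i j| * |x j| ≤ B * 1 :=
            mul_le_mul (hB i j) this (abs_nonneg _) ((abs_nonneg _).trans (hB i j))
        _ = B := mul_one B
    refine (Finset.sum_le_card_nsmul _ _ (n * B) fun i _ => key i).trans (by simp)

lemma eq_zero_of_opNorm_eq_zero (h : HasOpNorm K n) {M : Matrix (Fin n) (Fin n) K}
    (hM : opNorm M = 0) : M = 0 := by
  ext i j
  have := abs_entry_le_opNorm h M i j
  rw [hM] at this
  simpa using abs_nonpos_iff.1 this

lemma opNorm_nonneg (h : HasOpNorm K n) (M : Matrix (Fin n) (Fin n) K) : 0 ≤ opNorm M := by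
  rcases Nat.eq_zero_or_pos n with rfl | hn
  · rcases (eq_opNorm_iff M _).1 rfl with h' | h'
    · have hz : ∀ x : Fin 0 → K, vnorm x = 0 := fun x =>
        vnorm_eq_zero.2 (Subsingleton.elim _ _)
      have : {r | ∃ x : Fin 0 → K, vnorm x = 1 ∧ r = vnorm (M.mulVec x)} = ∅ := by
        ext r
        simp [hz]
      rw [this, isLUB_empty_iff] at h'
      exact (not_isBot _ h').elim
    · exact h'.2.ge
  · exact (abs_nonneg _).trans (abs_entry_le_opNorm h M ⟨0, hn⟩ ⟨0, hn⟩)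

lemma opNorm_zero (h : HasOpNorm K n) : opNorm (0 : Matrix (Fin n) (Fin n) K) = 0 :=
  le_antisymm ((opNorm_le h 0 0 (by simp)).trans (by simp)) (opNorm_nonneg h 0)

/-- For each `v`, the vector `P v - P' v` lies in `T` and is orthogonal to `T`, hence to itself. -/
lemma IsOrthProj.unique {T : Submodule K (Fin n → K)} {P P' : Matrix (Fin n) (Fin n) K}
    (h : IsOrthProj T P) (h' : IsOrthProj T P') : P = P' := by
  refine Matrix.ext_of_mulVec_single fun j => ?_
  set v : Fin n → K := Pi.single j 1
  have hT : P.mulVec v - P'.mulVec v ∈ T := T.sub_mem (h v).1 (h' v).1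
  have h1 := (h v).2 _ hT
  have h2 := (h' v).2 _ hT
  have h3 : (P.mulVec v - P'.mulVec v) ⬝ᵥ (P.mulVec v - P'.mulVec v) = 0 := by
    have e : P.mulVec v - P'.mulVec v = (v - P'.mulVec v) - (v - P.mulVec v) := by abel
    conv_lhs => rw [e, ← e]
    nth_rewrite 2 [e]
    rw [dotProduct_sub, h1, h2, sub_zero]
  exact sub_eq_zero.1 (dotProduct_self_eq_zero.1 h3)

lemma eq_orthProj_iff (T : Submodule K (Fin n → K)) (P : Matrix (Fin n) (Fin n) K) :
    P = orthProj T ↔ IsOrthProj T P ∨ (¬ ∃ P, IsOrthProj T P) ∧ P = 0 := by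
  unfold orthProj
  split_ifs with h
  · constructor
    · rintro rfl; exact Or.inl h.choose_spec
    · rintro (h' | h')
      · exact h'.unique h.choose_spec
      · exact (h'.1 h).elim
  · constructor
    · rintro rfl; exact Or.inr ⟨h, rfl⟩
    · rintro (h' | h')
      · exact (h ⟨P, h'⟩).elim
      · exact h'.2

/-- The `j`-th column has squared length `P j j`. Thus `P j j` is at least its own square, so it is
at most `1` and bounds the square of every entry of that column. The default value `0` satisfies the
bound as well. -/
lemma abs_orthProj_le_one (T : Submodule K (Fin n → K)) (i j : Fin n) : |orthProj T i j| ≤ 1 := by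
  rcases (eq_orthProj_iff T _).1 rfl with h | h
  · set P := orthProj T
    set v : Fin n → K := Pi.single j 1 with hv
    have h1 := (h v).2 _ (h v).1
    have h2 : P.mulVec v ⬝ᵥ P.mulVec v = P j j := by
      rw [dotProduct_sub, sub_eq_zero] at h1
      rw [← h1, hv]
      simp
    have hsq : ∀ k, P k j ^ 2 ≤ P j j := fun k => by
      rw [← h2]
      have e : P k j ^ 2 = (fun k => (P.mulVec v) k * (P.mulVec v) k) k := by
        simp [hv, sq]
      rw [e]
      exact Finset.single_le_sum (f := fun k => (P.mulVec v) k * (P.mulVec v) k)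
        (fun k _ => mul_self_nonneg _) (Finset.mem_univ k)
    have hjj : P j j ≤ 1 := by
      have := hsq j
      by_contra! hc
      nlinarith
    have := (hsq i).trans hjj
    exact abs_le_one_iff_mul_self_le_one.2 (by rwa [← sq])
  · rw [h.2]; simp

end Op

/-! ### Valuative bounds for the entries of a matrix -/

section Bounds

variable {K Γ : Type*} [Field K] [LinearOrderedCommGroupWithZero Γ] (w : Valuation K Γ) {n : ℕ}

/-- All entries of `M` have valuation at most `r / s`. -/
def EntryBound (M : Matrix (Fin n) (Fin n) K) (r s : Γ) : Prop := ∀ i j, w (M i j) * s ≤ r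

variable {w} {M N : Matrix (Fin n) (Fin n) K} {r s t : Γ}

lemma entryBound_iff_div (hs : s ≠ 0) : EntryBound w M r s ↔ ∀ i j, w (M i j) ≤ r / s :=
  forall₂_congr fun _ _ => (le_div_iff₀ (zero_lt_iff.2 hs)).symm

lemma entryBound_zero_right : EntryBound w M r 0 := fun _ _ => by simp

lemma entryBound_zero : EntryBound w (0 : Matrix (Fin n) (Fin n) K) r s := fun _ _ => by simp

lemma EntryBound.add (hM : EntryBound w M r s) (hN : EntryBound w N r s) :
    EntryBound w (M + N) r s := by
  by_cases hs : s = 0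
  · rw [hs]; exact entryBound_zero_right
  rw [entryBound_iff_div hs] at *
  exact fun i j => w.map_add_le (hM i j) (hN i j)

lemma EntryBound.sub (hM : EntryBound w M r s) (hN : EntryBound w N r s) :
    EntryBound w (M - N) r s := by
  by_cases hs : s = 0
  · rw [hs]; exact entryBound_zero_right
  rw [entryBound_iff_div hs] at *
  exact fun i j => w.map_sub_le (hM i j) (hN i j)

/-- The fractions `r / s` and `s / t` cancel. This is what makes the estimates compose along a chain
that is cut in two. -/
lemma EntryBound.mul (hM : EntryBound w M r s) (hN : EntryBound w N s t) :
    EntryBound w (M * N) r t := by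
  by_cases ht : t = 0
  · rw [ht]; exact entryBound_zero_right
  rw [entryBound_iff_div ht]
  intro i j
  rw [Matrix.mul_apply]
  refine w.map_sum_le fun k _ => ?_
  rw [le_div_iff₀ (zero_lt_iff.2 ht), map_mul, mul_assoc]
  exact (mul_le_mul_right (hN k j) _).trans (hM i k)

lemma entryBound_self (hM : ∀ i j, w (M i j) ≤ 1) : EntryBound w M s s := fun i j => by
  simpa using mul_le_mul_left (hM i j) s

lemma EntryBound.mono {r' s' : Γ} (hM : EntryBound w M r s) (hr : r ≤ r') (hs : s' ≤ s) :
    EntryBound w M r' s' := fun i j =>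
  ((mul_le_mul_right hs _).trans (hM i j)).trans hr

end Bounds

/-! ### The ultrametric core: chains of nodes and their estimates -/

/-- An ultrametric filtered space with matrices of norm at most `1` attached to its points. -/
structure ChainGeometry (K Γ V : Type*) [Field K] [LinearOrderedCommGroupWithZero Γ] (n d : ℕ) where
  w : Valuation K Γ
  δ : V → V → Γ
  P : Fin (d + 1) → V → Matrix (Fin n) (Fin n) K
  X : Fin (d + 1) → Set V
  δ_self : ∀ a, δ a a = 0
  δ_comm : ∀ a b, δ a b = δ b a
  δ_ultra : ∀ a b c, δ a c ≤ max (δ a b) (δ b c)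
  P_le : ∀ e a i j, w (P e a i j) ≤ 1
  mono : Monotone X

/-- A point of a skeleton together with a radius. -/
structure Node (Γ V : Type*) (d : ℕ) where
  e : Fin (d + 1)
  pt : V
  r : Γ

/-- The radius of the first node of a list, or a given default. -/
def headRadius {Γ V : Type*} {d : ℕ} : List (Node Γ V d) → Γ → Γ
  | [], s => s
  | x :: _, _ => x.r

section

variable {Γ V : Type*} {d : ℕ}

@[simp] lemma headRadius_nil (s : Γ) : headRadius ([] : List (Node Γ V d)) s = s := rfl
@[simp] lemma headRadius_cons (x : Node Γ V d) (l : List (Node Γ V d)) (s : Γ) :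
    headRadius (x :: l) s = x.r := rfl

lemma headRadius_append (l l' : List (Node Γ V d)) (s : Γ) :
    headRadius (l ++ l') s = headRadius l (headRadius l' s) := by
  cases l <;> rfl

/-- The radii are strictly increasing. -/
def StrictRadii [LT Γ] (s : Γ) : List (Node Γ V d) → Prop
  | [] => True
  | x :: l => x.r < headRadius l s ∧ StrictRadii s l

end

namespace ChainGeometry

variable {K Γ V : Type*} [Field K] [LinearOrderedCommGroupWithZero Γ] {n d : ℕ}
  (G : ChainGeometry K Γ V n d)

/-- All points of the next lower level have distance at least `t`. -/
def Far (e : Fin (d + 1)) (a : V) (t : Γ) : Prop := ∀ p ∈ prev G.X e, t ≤ G.δ a p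

/-- The product of the matrices attached to a list of nodes. -/
def nodeProd (l : List (Node Γ V d)) : Matrix (Fin n) (Fin n) K :=
  (l.map fun x => G.P x.e x.pt).prod

@[simp] lemma nodeProd_nil : G.nodeProd [] = 1 := rfl
@[simp] lemma nodeProd_cons (x : Node Γ V d) (l : List (Node Γ V d)) :
    G.nodeProd (x :: l) = G.P x.e x.pt * G.nodeProd l := by simp [nodeProd]
lemma nodeProd_append (l l' : List (Node Γ V d)) :
    G.nodeProd (l ++ l') = G.nodeProd l * G.nodeProd l' := by simp [nodeProd]

/-- Chains of nodes with final radius `s`: either the radius does not change at a node, or the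
next lower level is far away. -/
def IsChain (s : Γ) : List (Node Γ V d) → Prop
  | [] => True
  | x :: l => x.pt ∈ skel G.X x.e ∧ (∀ z ∈ l, z.e < x.e ∧ G.δ x.pt z.pt ≤ z.r) ∧
      (x.r = headRadius l s ∨ x.r < headRadius l s ∧ G.Far x.e x.pt (headRadius l s)) ∧ IsChain s l

/-- `Refine l l'`: the list `l'` is obtained from `l` by moving points within their radii, and by
inserting nodes having the radius of the next node. -/
inductive Refine : List (Node Γ V d) → List (Node Γ V d) → Prop
  | nil : Refine [] []
  | same {x y l l'} : x.e = y.e → x.r = y.r → G.δ x.pt y.pt ≤ x.r → Refine l l' →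
      Refine (x :: l) (y :: l')
  | insert {x y l l'} : y.r = x.r → Refine (x :: l) l' → Refine (x :: l) (y :: l')

variable {G} {s : Γ}

lemma δ_trans {a b c : V} {r : Γ} (h : G.δ a b ≤ r) (h' : G.δ b c ≤ r) : G.δ a c ≤ r :=
  (G.δ_ultra a b c).trans (max_le h h')

lemma Far.congr {e : Fin (d + 1)} {a b : V} {t : Γ} (h : G.Far e a t) (hab : G.δ a b < t) :
    G.Far e b t := fun p hp => by
  by_contra! hc
  exact ((G.δ_ultra a b p).trans_lt (max_lt hab hc)).not_ge (h p hp)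

lemma IsChain.right {l l' : List (Node Γ V d)} (h : G.IsChain s (l ++ l')) : G.IsChain s l' := by
  induction l with
  | nil => exact h
  | cons x l ih => exact ih h.2.2.2

/-- An initial piece is again a chain once the first radius after the cut serves as its final
radius. -/
lemma IsChain.left {l l' : List (Node Γ V d)} (h : G.IsChain s (l ++ l')) :
    G.IsChain (headRadius l' s) l := by
  induction l with
  | nil => trivial
  | cons x l ih =>
    obtain ⟨h1, h2, h3, h4⟩ := h
    refine ⟨h1, fun z hz => h2 z (List.mem_append_left _ hz), ?_, ih h4⟩
    rwa [← headRadius_append]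

lemma IsChain.lt_of_mem {pre suf : List (Node Γ V d)} {x z : Node Γ V d}
    (h : G.IsChain s (pre ++ x :: suf)) (hz : z ∈ pre) : x.e < z.e := by
  induction pre with
  | nil => simp at hz
  | cons y pre ih =>
    rcases List.mem_cons.1 hz with rfl | hz
    · exact (h.2.1 x (by simp)).1
    · exact ih h.2.2.2 hz

lemma IsChain.radius_le {x : Node Γ V d} {l : List (Node Γ V d)} (h : G.IsChain s (x :: l)) :
    x.r ≤ headRadius l s := by
  rcases h.2.2.1 with h | h
  · exact h.le
  · exact h.1.le

lemma IsChain.headRadius_le {l : List (Node Γ V d)} (h : G.IsChain s l) :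
    headRadius l s ≤ s ∧ ∀ z ∈ l, headRadius l s ≤ z.r := by
  induction l with
  | nil => simp
  | cons x l ih =>
    have := ih h.2.2.2
    refine ⟨h.radius_le.trans this.1, fun z hz => ?_⟩
    rcases List.mem_cons.1 hz with rfl | hz
    · exact le_rfl
    · exact h.radius_le.trans (this.2 z hz)

lemma Refine.headRadius_eq {l l' : List (Node Γ V d)} (h : G.Refine l l') (s : Γ) :
    headRadius l s = headRadius l' s := by
  cases h with
  | nil => rfl
  | same _ h _ _ => exact h
  | insert h _ => exact h.symm

/-- Every node whose radius equals the next one is deleted, and `l` is recovered by inserting these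
nodes again. By `hlast` the last node survives, so there is always a later node whose radius the
inserted one shares. -/
lemma IsChain.exists_strict {l : List (Node Γ V d)} (h : G.IsChain s l)
    (hlast : ∀ pre x, l = pre ++ [x] → x.r < s) :
    ∃ zs, G.Refine zs l ∧ G.IsChain s zs ∧ StrictRadii s zs ∧ (∀ z ∈ zs, z ∈ l) ∧
      (l ≠ [] → zs ≠ []) := by
  induction l with
  | nil => exact ⟨[], .nil, trivial, trivial, by simp, by simp⟩
  | cons x l ih =>
    obtain ⟨zs, h1, h2, h3, h4, h5⟩ := ih h.2.2.2 fun pre y hy => hlast (x :: pre) y (by simp [hy])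
    by_cases hx : x.r = headRadius l s
    · have hl : l ≠ [] := by
        rintro rfl
        exact (hlast [] x rfl).ne hx
      obtain ⟨z, zs, rfl⟩ := List.exists_cons_of_ne_nil (h5 hl)
      refine ⟨z :: zs, .insert ?_ h1, h2, h3, fun y hy => List.mem_cons_of_mem _ (h4 y hy),
        by simp⟩
      rw [hx, ← h1.headRadius_eq s]
      rfl
    · refine ⟨x :: zs, .same rfl rfl (by simp [G.δ_self]) h1, ⟨h.1, fun z hz => h.2.1 z (h4 z hz),
        ?_, h2⟩, ⟨?_, h3⟩, ?_, by simp⟩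
      · rw [h1.headRadius_eq s]; exact h.2.2.1
      · rw [h1.headRadius_eq s]; exact h.radius_le.lt_of_ne hx
      · intro z hz
        rcases List.mem_cons.1 hz with rfl | hz
        · simp
        · exact List.mem_cons_of_mem _ (h4 z hz)

variable (G)

/-- The estimate for `(1 - P_a) P_1 ⋯ P_m` for chains whose levels range over at most `g` steps. -/
def PlainBound (g : ℕ) : Prop :=
  ∀ (e : Fin (d + 1)) (a : V) (l : List (Node Γ V d)) (s : Γ), a ∈ skel G.X e → G.IsChain s l →
    (∀ z ∈ l, z.e < e ∧ G.δ a z.pt ≤ z.r) → (∀ z ∈ l, (e : ℕ) ≤ z.e + g) →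
    EntryBound G.w ((1 - G.P e a) * G.nodeProd l) (headRadius l s) s

/-- The estimate for `(P_b - P_x) P_1 ⋯ P_m` for chains whose levels range over at most `g` steps. -/
def AugBound (g : ℕ) : Prop :=
  ∀ (x : Node Γ V d) (b : V) (l : List (Node Γ V d)) (s : Γ), G.IsChain s (x :: l) →
    b ∈ skel G.X x.e → G.δ b x.pt ≤ x.r → (∀ z ∈ l, (x.e : ℕ) ≤ z.e + g) →
    EntryBound G.w ((G.P x.e b - G.P x.e x.pt) * G.nodeProd l) x.r s

variable {G}

lemma entryBound_one_sub (e : Fin (d + 1)) (a : V) : EntryBound G.w (1 - G.P e a) s s := by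
  refine EntryBound.sub (entryBound_self fun i j => ?_) (entryBound_self (G.P_le e a))
  rw [Matrix.one_apply]
  split_ifs <;> simp

/-- The products are exchanged node by node, with `zs` in front and `ys` behind the place of
exchange. A moved point contributes a factor `P_x - P_y`, an inserted node a factor `1 - P_y`. The
front part is bounded by `hN` and the rest by the induction hypothesis; the radius at the place of
exchange cancels. -/
lemma entryBound_sub_of_refine {g : ℕ}
    (ih : ∀ g' < g, G.PlainBound g' ∧ G.AugBound g') {zs ys : List (Node Γ V d)}
    (hR : G.Refine zs ys) {e : Fin (d + 1)} (hzs : G.IsChain s zs) (hys : G.IsChain s ys)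
    (ey : ∀ z ∈ ys, z.e < e ∧ (e : ℕ) ≤ z.e + g) (N : Matrix (Fin n) (Fin n) K) (r₀ : Γ)
    (hN : ∀ pre suf, zs = pre ++ suf → suf ≠ [] →
      EntryBound G.w (N * G.nodeProd pre) r₀ (headRadius suf s)) :
    EntryBound G.w (N * (G.nodeProd zs - G.nodeProd ys)) r₀ s := by
  induction hR generalizing N with
  | nil => simpa using entryBound_zero
  | @same x y l l' he hr hδ hR ihR =>
    -- Since `y.e < e`, levels counted from `y.e` range over one step less. The same inequality
    -- forces `g > 0`.
    have hg : g - 1 < g ∧ ∀ z ∈ l', (y.e : ℕ) ≤ z.e + (g - 1) := by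
      have := ey y (by simp)
      refine ⟨by have := this.1; omega, fun z hz => ?_⟩
      have h1 := ey z (by simp [hz])
      omega
    have h1 : EntryBound G.w (N * ((G.P y.e x.pt - G.P y.e y.pt) * G.nodeProd l')) r₀ s := by
      have := hN [] (x :: l) rfl (by simp)
      rw [nodeProd_nil, mul_one, headRadius_cons, hr] at this
      exact this.mul ((ih _ hg.1).2 y x.pt l' s hys (he ▸ hzs.1) (hr ▸ hδ) hg.2)
    have h2 := ihR hzs.2.2.2 hys.2.2.2 (fun z hz => ey z (by simp [hz])) (N * G.P x.e x.pt)
      fun pre suf hl hs => by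
        have := hN (x :: pre) suf (by simp [hl]) hs
        rwa [nodeProd_cons, ← mul_assoc] at this
    have e1 : N * (G.nodeProd (x :: l) - G.nodeProd (y :: l')) =
        N * G.P x.e x.pt * (G.nodeProd l - G.nodeProd l') +
          N * ((G.P y.e x.pt - G.P y.e y.pt) * G.nodeProd l') := by
      rw [nodeProd_cons, nodeProd_cons, ← he]
      noncomm_ring
    rw [e1]
    exact h2.add h1
  | @insert x y l l' hr hR ihR =>
    have hg : g - 1 < g ∧ ∀ z ∈ l', (y.e : ℕ) ≤ z.e + (g - 1) := by
      have := ey y (by simp)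
      refine ⟨by have := this.1; omega, fun z hz => ?_⟩
      have h1 := ey z (by simp [hz])
      omega
    have h1 : EntryBound G.w (N * ((1 - G.P y.e y.pt) * G.nodeProd l')) r₀ s := by
      have := hN [] (x :: l) rfl (by simp)
      rw [nodeProd_nil, mul_one, hR.headRadius_eq s] at this
      exact this.mul ((ih _ hg.1).1 y.e y.pt l' s hys.1 hys.2.2.2 hys.2.1 hg.2)
    have h2 := ihR hzs hys.2.2.2 (fun z hz => ey z (by simp [hz])) N hN
    have e1 : N * (G.nodeProd (x :: l) - G.nodeProd (y :: l')) =
        N * (G.nodeProd (x :: l) - G.nodeProd l') +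
          N * ((1 - G.P y.e y.pt) * G.nodeProd l') := by
      rw [nodeProd_cons _ y]
      noncomm_ring
    rw [e1]
    exact h2.add h1

/-- A strict chain is refined by any choice of nearest points on sufficiently many levels. -/
lemma exists_refine {a : V} {y : Fin (d + 1) → V} (Js : List (Fin (d + 1)))
    (hJs : Js.Pairwise (· > ·)) (zs : List (Node Γ V d)) (hzs : G.IsChain s zs)
    (hst : StrictRadii s zs) (ha : ∀ z ∈ zs, G.δ a z.pt ≤ z.r) (hz : ∀ z ∈ zs, z.e ∈ Js)
    (hJ : ∀ i ∈ Js, (∃ z ∈ zs, z.e ≤ i) ∧ y i ∈ skel G.X i ∧ ∀ p ∈ G.X i, G.δ a (y i) ≤ G.δ a p) :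
    ∃ ys, G.Refine zs ys ∧ G.IsChain s ys ∧ G.nodeProd ys = (Js.map fun i => G.P i (y i)).prod ∧
      ∀ z ∈ ys, z.e ∈ Js ∧ G.δ a z.pt ≤ z.r ∧ headRadius zs s ≤ z.r := by
  induction Js generalizing zs with
  | nil =>
    cases zs with
    | nil => exact ⟨[], .nil, trivial, rfl, by simp⟩
    | cons z zs => simpa using hz z (by simp)
  | cons i Js ih =>
    rw [List.pairwise_cons] at hJs
    have hJi := hJ i (by simp)
    cases zs with
    | nil => simp at hJi
    | cons x xs =>
      have hxi : x.e ≤ i := by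
        rcases List.mem_cons.1 (hz x (by simp)) with h | h
        · exact h.le
        · exact (hJs.1 _ h).le
      -- The point of `x` lies in level `i` too, so the nearest point there is no further away.
      have hnear : G.δ a (y i) ≤ x.r :=
        (hJi.2.2 x.pt (G.mono hxi hzs.1.1)).trans (ha x (by simp))
      -- A level already present has its point moved; a missing level is inserted with the radius of
      -- the node below it.
      by_cases hi : i = x.e
      · subst hi
        obtain ⟨ys, h1, h2, h3, h4⟩ := ih hJs.2 xs hzs.2.2.2 hst.2
          (fun z h => ha z (by simp [h]))
          (fun z h => by
            rcases List.mem_cons.1 (hz z (by simp [h])) with h' | h'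
            · exact absurd h' (hzs.2.1 z h).1.ne
            · exact h')
          (fun j hj => by
            obtain ⟨⟨z, hz', hzj⟩, h2⟩ := hJ j (by simp [hj])
            refine ⟨?_, h2⟩
            rcases List.mem_cons.1 hz' with rfl | hz'
            · exact absurd hzj (hJs.1 j hj).not_ge
            · exact ⟨z, hz', hzj⟩)
        have hδ : G.δ x.pt (y x.e) ≤ x.r :=
          δ_trans (by rw [G.δ_comm]; exact ha x (by simp)) hnear
        refine ⟨⟨x.e, y x.e, x.r⟩ :: ys, .same rfl rfl hδ h1, ⟨hJi.2.1, fun z hz => ?_, Or.inr ?_, h2⟩,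
          by simp [h3], ?_⟩
        · obtain ⟨h5, h6, h7⟩ := h4 z hz
          refine ⟨hJs.1 _ h5, δ_trans ?_ h6⟩
          rw [G.δ_comm]
          exact hnear.trans (hst.1.le.trans h7)
        · rw [← h1.headRadius_eq s]
          refine ⟨hst.1, ?_⟩
          have := hzs.2.2.1.resolve_left hst.1.ne
          -- The point moves by less than the next radius, so by the ultrametric inequality the
          -- lower levels remain far away.
          exact this.2.congr (hδ.trans_lt hst.1)
        · intro z hz
          rcases List.mem_cons.1 hz with rfl | hz
          · exact ⟨by simp, hnear, le_rfl⟩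
          · obtain ⟨h5, h6, h7⟩ := h4 z hz
            exact ⟨by simp [h5], h6, hst.1.le.trans h7⟩
      · have hJs' : ∀ z ∈ x :: xs, z.e ∈ Js := fun z h => by
          rcases List.mem_cons.1 (hz z h) with h' | h'
          · exfalso
            have h6 : z.e ≤ x.e := by
              rcases List.mem_cons.1 h with rfl | h
              · exact le_rfl
              · exact (hzs.2.1 z h).1.le
            exact hi (le_antisymm (h' ▸ h6) hxi)
          · exact h'
        obtain ⟨ys, h1, h2, h3, h4⟩ := ih hJs.2 (x :: xs) hzs hst ha hJs'
          (fun j hj => hJ j (by simp [hj]))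
        refine ⟨⟨i, y i, x.r⟩ :: ys, .insert rfl h1, ⟨hJi.2.1, fun z hz => ?_, Or.inl ?_, h2⟩,
          by simp [h3], ?_⟩
        · obtain ⟨h5, h6, h7⟩ := h4 z hz
          refine ⟨hJs.1 _ h5, δ_trans ?_ h6⟩
          rw [G.δ_comm]
          exact hnear.trans h7
        · rw [← h1.headRadius_eq s]; rfl
        · intro z hz
          rcases List.mem_cons.1 hz with rfl | hz
          · exact ⟨by simp, hnear, le_rfl⟩
          · obtain ⟨h5, h6, h7⟩ := h4 z hz
            exact ⟨by simp [h5], h6, h7⟩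

variable (G)

/-- Nearest points on the levels `Js`, which contain the levels of the chain `zs`. -/
structure IsNearChoice (zs : List (Node Γ V d)) (a : V) (Js : List (Fin (d + 1)))
    (y : Fin (d + 1) → V) : Prop where
  sorted : Js.Pairwise (· > ·)
  mem : ∀ z ∈ zs, z.e ∈ Js
  ge : ∀ i ∈ Js, ∃ z ∈ zs, z.e ≤ i
  mem_skel : ∀ i ∈ Js, y i ∈ skel G.X i
  near : ∀ i ∈ Js, ∀ p ∈ G.X i, G.δ a (y i) ≤ G.δ a p

/-- Every strict chain can be compared with a chain of nearest points satisfying the estimate for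
`(1 - P_a) P_1 ⋯ P_m`. -/
def PlainWitness : Prop :=
  ∀ (e : Fin (d + 1)) (a : V) (zs : List (Node Γ V d)) (s : Γ), a ∈ skel G.X e → zs ≠ [] →
    G.IsChain s zs → StrictRadii s zs → (∀ z ∈ zs, z.e < e ∧ G.δ a z.pt ≤ z.r) →
    ∃ Js y, G.IsNearChoice zs a Js y ∧ (∀ i ∈ Js, i < e) ∧
      EntryBound G.w ((1 - G.P e a) * (Js.map fun i => G.P i (y i)).prod) (headRadius zs s) s

/-- Every strict chain can be compared with a chain of nearest points satisfying the estimate for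
`(P_b - P_x) P_1 ⋯ P_m`. -/
def AugWitness : Prop :=
  ∀ (x : Node Γ V d) (b : V) (zs : List (Node Γ V d)) (s : Γ), G.IsChain s (x :: zs) →
    StrictRadii s (x :: zs) → b ∈ skel G.X x.e → G.δ b x.pt ≤ x.r →
    ∃ Js y, G.IsNearChoice zs b Js y ∧ (∀ i ∈ Js, i < x.e) ∧
      EntryBound G.w ((G.P x.e b - G.P x.e x.pt) * (Js.map fun i => G.P i (y i)).prod) x.r s

variable {G}

/-- Both `l` and the chain of nearest points refine the strict chain `zs`, so the known bound for
the latter is carried to `l` through `zs`. The factor `N` is `1 - P_a` or `P_b - P_x`, which lets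
one argument serve both estimates. -/
lemma entryBound_of_nearChoice {g : ℕ} (ih : ∀ g' < g, G.PlainBound g' ∧ G.AugBound g')
    {l zs : List (Node Γ V d)} (hl : G.IsChain s l) (hR : G.Refine zs l) (hzs : G.IsChain s zs)
    (hst : StrictRadii s zs) {e : Fin (d + 1)} {a : V} (ha : ∀ z ∈ zs, G.δ a z.pt ≤ z.r)
    (el : ∀ z ∈ l, z.e < e ∧ (e : ℕ) ≤ z.e + g) (ez : ∀ z ∈ zs, (e : ℕ) ≤ z.e + g)
    {Js : List (Fin (d + 1))} {y : Fin (d + 1) → V} (hJ : G.IsNearChoice zs a Js y)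
    (hJe : ∀ i ∈ Js, i < e) {N : Matrix (Fin n) (Fin n) K} {r₀ : Γ}
    (hN : ∀ pre suf, zs = pre ++ suf → suf ≠ [] →
      EntryBound G.w (N * G.nodeProd pre) r₀ (headRadius suf s))
    (hB : EntryBound G.w (N * (Js.map fun i => G.P i (y i)).prod) r₀ s) :
    EntryBound G.w (N * G.nodeProd l) r₀ s := by
  obtain ⟨ys, h1, h2, h3, h4⟩ := exists_refine (a := a) (y := y) Js hJ.sorted zs hzs hst ha hJ.mem
    fun i hi => ⟨hJ.ge i hi, hJ.mem_skel i hi, hJ.near i hi⟩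
  have ey : ∀ z ∈ ys, z.e < e ∧ (e : ℕ) ≤ z.e + g := fun z hz => by
    refine ⟨hJe _ (h4 z hz).1, ?_⟩
    obtain ⟨z', hz', hle⟩ := hJ.ge _ (h4 z hz).1
    have := ez z' hz'
    have : (z'.e : ℕ) ≤ z.e := hle
    omega
  have b1 := entryBound_sub_of_refine ih h1 hzs h2 ey N r₀ hN
  have b2 := entryBound_sub_of_refine ih hR hzs hl el N r₀ hN
  rw [← h3] at hB
  have e1 : N * G.nodeProd l = N * G.nodeProd ys + N * (G.nodeProd zs - G.nodeProd ys) -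
      N * (G.nodeProd zs - G.nodeProd l) := by noncomm_ring
  rw [e1]
  exact (hB.add b1).sub b2

/-- The two estimates are proved together, because comparing chains for either one produces terms of
both kinds with a smaller range of levels. At equal range the plain estimate comes first, since the
augmented one uses it. -/
lemma plainBound_and_augBound (h1 : G.PlainWitness) (h2 : G.AugWitness) (g : ℕ) :
    G.PlainBound g ∧ G.AugBound g := by
  induction g using Nat.strong_induction_on with
  | _ g ih =>
  have hP : G.PlainBound g := by
    intro e a l s ha hl hla hle
    rcases eq_or_ne l [] with rfl | hne
    · simpa using entryBound_one_sub e a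
    by_cases hlast : ∀ pre x, l = pre ++ [x] → x.r < s
    · obtain ⟨zs, hR, hzs, hst, hsub, hzne⟩ := hl.exists_strict hlast
      obtain ⟨Js, y, hJ, hJe, hB⟩ := h1 e a zs s ha (hzne hne) hzs hst fun z hz => hla z (hsub z hz)
      rw [← hR.headRadius_eq s]
      refine entryBound_of_nearChoice (e := e) ih hl hR hzs hst
        (fun z hz => (hla z (hsub z hz)).2) (fun z hz => ⟨(hla z hz).1, hle z hz⟩)
        (fun z hz => hle z (hsub z hz)) hJ hJe ?_ hB
      intro pre suf hps hsuf
      subst hps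
      obtain ⟨x, suf, rfl⟩ := List.exists_cons_of_ne_nil hsuf
      have hx := hla x (hsub x (by simp))
      have hx' := hle x (hsub x (by simp))
      rw [headRadius_append]
      -- A proper initial piece of `zs` stops strictly above the level of the first deleted node, so
      -- its range is smaller.
      refine (ih (g - 1) (by have := hx.1; omega)).1 e a pre _ ha hzs.left
        (fun z hz => hla z (hsub z (by simp [hz]))) fun z hz => ?_
      have := hzs.lt_of_mem hz
      omega
    -- If the last radius equals `s`, that last node only multiplies by a matrix with entries of
    -- size at most `1`; it is split off.
    · push Not at hlast
      obtain ⟨pre, x, rfl, hx⟩ := hlast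
      have hxs : x.r = s := by
        have := (hl.right).radius_le
        exact le_antisymm this hx
      have hxe := hla x (by simp)
      have hxe' := hle x (by simp)
      have hb := (ih (g - 1) (by have := hxe.1; omega)).1 e a pre _ ha hl.left
        (fun z hz => hla z (by simp [hz])) fun z hz => by
          have := hl.lt_of_mem hz
          omega
      rw [nodeProd_append, ← mul_assoc, headRadius_append]
      refine hb.mul ?_
      rw [headRadius_cons, hxs]
      simpa using entryBound_self (G.P_le x.e x.pt)
  refine ⟨hP, ?_⟩
  intro x b l s hl hb hbx hle
  by_cases hx : x.r = headRadius l s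
  -- When the first radius is already the next one, nothing is gained from the closeness of `b` to
  -- `x.pt`, and two plain estimates suffice.
  · have e1 : (G.P x.e b - G.P x.e x.pt) * G.nodeProd l =
        (1 - G.P x.e x.pt) * G.nodeProd l - (1 - G.P x.e b) * G.nodeProd l := by noncomm_ring
    rw [e1, hx]
    refine (hP x.e x.pt l s hl.1 hl.2.2.2 hl.2.1 hle).sub
      (hP x.e b l s hb hl.2.2.2 (fun z hz => ⟨(hl.2.1 z hz).1, ?_⟩) hle)
    exact δ_trans (hbx.trans (hl.radius_le.trans (hl.2.2.2.headRadius_le.2 z hz))) (hl.2.1 z hz).2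
  by_cases hlast : ∀ pre z, l = pre ++ [z] → z.r < s
  · obtain ⟨zs, hR, hzs, hst, hsub, -⟩ := hl.2.2.2.exists_strict hlast
    have hxzs : G.IsChain s (x :: zs) := by
      refine ⟨hl.1, fun z hz => hl.2.1 z (hsub z hz), ?_, hzs⟩
      rw [hR.headRadius_eq s]
      exact hl.2.2.1
    obtain ⟨Js, y, hJ, hJe, hB⟩ := h2 x b zs s hxzs
      ⟨by rw [hR.headRadius_eq s]; exact hl.radius_le.lt_of_ne hx, hst⟩ hb hbx
    refine entryBound_of_nearChoice (e := x.e) ih hl.2.2.2 hR hzs hst (fun z hz => ?_)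
      (fun z hz => ⟨(hl.2.1 z hz).1, hle z hz⟩) (fun z hz => hle z (hsub z hz)) hJ hJe ?_ hB
    · exact δ_trans (hbx.trans (hxzs.radius_le.trans (hzs.headRadius_le.2 z hz)))
        (hxzs.2.1 z hz).2
    · intro pre suf hps hsuf
      subst hps
      obtain ⟨z, suf, rfl⟩ := List.exists_cons_of_ne_nil hsuf
      have hz1 := hl.2.1 z (hsub z (by simp))
      have hz2 := hle z (hsub z (by simp))
      refine (ih (g - 1) (by have := hz1.1; omega)).2 x b pre _
        (IsChain.left (l := x :: pre) hxzs) hb hbx fun z' hz' => ?_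
      have := hzs.lt_of_mem hz'
      omega
  · push Not at hlast
    obtain ⟨pre, z, rfl, hz⟩ := hlast
    have hzs : z.r = s := le_antisymm (hl.2.2.2.right).radius_le hz
    have hz1 := hl.2.1 z (by simp)
    have hz2 := hle z (by simp)
    have hb' := (ih (g - 1) (by have := hz1.1; omega)).2 x b pre _
      (IsChain.left (l := x :: pre) hl) hb hbx fun z' hz' => by
        have := hl.2.2.2.lt_of_mem hz'
        omega
    rw [nodeProd_append, ← mul_assoc]
    refine hb'.mul ?_
    rw [headRadius_cons, hzs]
    simpa using entryBound_self (G.P_le z.e z.pt)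

end ChainGeometry

/-! ### Consecutive levels of a filtration -/

section Levels

variable {α : Type*} {d : ℕ} {X : Fin (d + 1) → Set α}

lemma prev_zero : prev X 0 = ∅ := rfl
lemma prev_succ (j : Fin d) : prev X j.succ = X j.castSucc := rfl

lemma subset_prev (hX : Monotone X) {i j : Fin (d + 1)} (h : i < j) : X i ⊆ prev X j := by
  cases j using Fin.cases with
  | zero => exact absurd h (Fin.not_lt_zero i)
  | succ j => exact hX (Fin.le_castSucc_iff.2 h)

lemma prev_subset (hX : Monotone X) (i : Fin (d + 1)) : prev X i ⊆ X i := by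
  cases i using Fin.cases with
  | zero => exact empty_subset _
  | succ j => exact hX (Fin.castSucc_lt_succ).le

end Levels

/-! ### The valuation of a convex closure -/

section Valuation

variable {K : Type*} [Field K] [LinearOrder K] [IsStrictOrderedRing K] {S : Subring K} {x y c : K}

lemma valuation_le_iff (hy : y ≠ 0) : (convexClosure S).valuation x ≤ (convexClosure S).valuation y ↔
    ∃ c ∈ S, |x| < c * |y| := by
  have hy' : (convexClosure S).valuation y ≠ 0 := (Valuation.ne_zero_iff _).2 hy
  rw [← div_le_one₀ (zero_lt_iff.2 hy'), ← map_div₀, ValuationSubring.valuation_le_one_iff]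
  refine exists_congr fun c => and_congr_right fun _ => ?_
  rw [abs_div, div_lt_iff₀ (abs_pos.2 hy)]

lemma valuation_le_of_le (hc : c ∈ S) (h : |x| ≤ c * |y|) :
    (convexClosure S).valuation x ≤ (convexClosure S).valuation y := by
  by_cases hy : y = 0
  · subst hy
    have : x = 0 := by simpa using h
    rw [this]
  · rw [valuation_le_iff hy]
    refine ⟨c + 1, S.add_mem hc S.one_mem, h.trans_lt ?_⟩
    have := abs_pos.2 hy
    nlinarith

lemma valuation_mono (hx : 0 ≤ x) (h : x ≤ y) :
    (convexClosure S).valuation x ≤ (convexClosure S).valuation y :=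
  valuation_le_of_le S.one_mem (by rwa [one_mul, abs_of_nonneg hx, abs_of_nonneg (hx.trans h)])

lemma mul_abs_lt_of_valuation_lt
    (h : (convexClosure S).valuation x < (convexClosure S).valuation y) (hc : c ∈ S) :
    c * |x| < |y| := by
  by_contra! hle
  exact h.not_ge (valuation_le_of_le hc hle)

/-- The sum `1 + ∑ |f i|` stays in `S` and is positive even for an empty index set. -/
lemma exists_mem_bound {ι : Type*} [Fintype ι] (f : ι → K) (hf : ∀ i, f i ∈ S) :
    ∃ c ∈ S, 0 < c ∧ ∀ i, f i ≤ c := by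
  have habs : ∀ i, |f i| ∈ S := fun i => by
    rcases abs_choice (f i) with h | h <;> rw [h]
    · exact hf i
    · exact S.neg_mem (hf i)
  have h0 : ∀ i ∈ (Finset.univ : Finset ι), 0 ≤ |f i| := fun i _ => abs_nonneg _
  refine ⟨1 + ∑ i, |f i|, S.add_mem S.one_mem (S.sum_mem fun i _ => habs i), ?_, fun i => ?_⟩
  · have := Finset.sum_nonneg h0
    linarith
  · have := Finset.single_le_sum h0 (Finset.mem_univ i)
    have := le_abs_self (f i)
    linarith

end Valuation

/-! ### Valuative distances and the geometry of a stratification -/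

section Tame

variable {K : Type*} [Field K] [LinearOrder K] {n d : ℕ}

/-- The metric properties of definable stratifications used in the comparison of the conditions. -/
structure Tame (X : Fin (d + 1) → Set (Fin n → K)) : Prop where
  mono : Monotone X
  hasDist : ∀ i, HasDist (X i)
  dist_ne_zero : ∀ i, ∀ a ∈ X (Fin.last d), a ∉ X i → setDist a (X i) ≠ (0 : K)

variable [IsStrictOrderedRing K] [HasSqrt K] {X : Fin (d + 1) → Set (Fin n → K)}

lemma Tame.hasDist_prev (hX : Tame X) (i : Fin (d + 1)) : HasDist (prev X i) := by
  cases i using Fin.cases with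
  | zero => exact hasDist_empty
  | succ j => exact hX.hasDist _

lemma Tame.notMem_of_lt (hX : Tame X) {e i : Fin (d + 1)} {a : Fin n → K} (ha : a ∈ skel X e)
    (hi : i < e) : a ∉ X i := fun h => ha.2 (subset_prev hX.mono hi h)

lemma Tame.pos (hX : Tame X) {e i : Fin (d + 1)} {a : Fin n → K} (ha : a ∈ skel X e)
    (hi : i < e) {r : K} (hr : setDist a (X i) = r) : 0 < r := by
  refine (setDist_nonneg hr).lt_of_ne fun h => ?_
  refine hX.dist_ne_zero i a (hX.mono (Fin.le_last e) ha.1) (hX.notMem_of_lt ha hi) ?_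
  rw [hr, ← h]

lemma Tame.pos_prev (hX : Tame X) {e i : Fin (d + 1)} {a : Fin n → K} (ha : a ∈ skel X e)
    (hi : i ≤ e) {r : K} (hr : setDist a (prev X i) = r) : 0 < r := by
  cases i using Fin.cases with
  | zero => rw [prev_zero, setDist_empty] at hr; exact (WithTop.top_ne_coe hr).elim
  | succ j => exact hX.pos ha (Fin.castSucc_lt_succ.trans_le hi) hr

lemma proj_entry_le (i j : Fin n) (e : Fin (d + 1)) (a : Fin n → K) : |proj X e a i j| ≤ 1 :=
  abs_orthProj_le_one _ i j

variable (S : Subring K)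

lemma valDist_coe {a : Fin n → K} {Y : Set (Fin n → K)} {r : K} (h : setDist a Y = r) :
    valDist (convexClosure S) a Y = ((convexClosure S).valuation r : WithTop _) := by
  rw [valDist, h, WithTop.map_coe]

lemma valDist_top {a : Fin n → K} {Y : Set (Fin n → K)} (h : setDist a Y = ⊤) :
    valDist (convexClosure S) a Y = ⊤ := by
  rw [valDist, h, WithTop.map_top]

variable {S}

lemma valDist_anti {Y Z : Set (Fin n → K)} (hY : HasDist Y) (hZ : HasDist Z) (h : Y ⊆ Z)
    (a : Fin n → K) : valDist (convexClosure S) a Z ≤ valDist (convexClosure S) a Y := by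
  have := setDist_anti hY hZ h a
  rcases Y.eq_empty_or_nonempty with rfl | hne
  · rw [valDist_top S (setDist_empty a)]; exact le_top
  · obtain ⟨r, hr⟩ := hY.exists a hne
    obtain ⟨s, hs⟩ := hZ.exists a (hne.mono h)
    rw [valDist_coe S hr, valDist_coe S hs, WithTop.coe_le_coe]
    rw [hr, hs, WithTop.coe_le_coe] at this
    exact valuation_mono (setDist_nonneg hs) this

lemma valDist_le_of_mem {Y : Set (Fin n → K)} (hY : HasDist Y) {a p : Fin n → K} (hp : p ∈ Y) :
    valDist (convexClosure S) a Y ≤ (vecVal (convexClosure S) (a - p) : WithTop _) := by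
  obtain ⟨r, hr⟩ := hY.exists a ⟨p, hp⟩
  rw [valDist_coe S hr, WithTop.coe_le_coe]
  exact valuation_mono (setDist_nonneg hr) (le_vnorm_of_setDist hr hp)

lemma le_vecVal_of_le_valDist {Y : Set (Fin n → K)} (hY : HasDist Y) {a p : Fin n → K}
    (hp : p ∈ Y) {t : (convexClosure S).ValueGroup}
    (ht : (t : WithTop _) ≤ valDist (convexClosure S) a Y) : t ≤ vecVal (convexClosure S) (a - p) :=
  WithTop.coe_le_coe.1 (ht.trans (valDist_le_of_mem hY hp))

lemma two_mem (S : Subring K) : (2 : K) ∈ S := by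
  rw [← one_add_one_eq_two]; exact S.add_mem S.one_mem S.one_mem

/-- A point within twice the distance exists when the distance is positive, and `v` does not see the
factor `2`. So valuative distances are attained. -/
lemma exists_near_valDist {Y : Set (Fin n → K)} {a : Fin n → K} {r : K}
    (hr : setDist a Y = r) (hr0 : 0 < r) : ∃ p ∈ Y,
      (vecVal (convexClosure S) (a - p) : WithTop _) = valDist (convexClosure S) a Y := by
  obtain ⟨p, hp, hlt⟩ := exists_vnorm_lt_of_setDist hr (by linarith : r < 2 * r)
  refine ⟨p, hp, ?_⟩
  rw [valDist_coe S hr, WithTop.coe_eq_coe]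
  refine le_antisymm (valuation_le_of_le (two_mem S) ?_)
    (valuation_mono hr0.le (le_vnorm_of_setDist hr hp))
  rw [abs_of_nonneg (vnorm_nonneg _), abs_of_pos hr0]
  exact hlt.le

lemma le_valDist {Y : Set (Fin n → K)} (hY : HasDist Y) {a : Fin n → K}
    (h0 : ∀ r : K, setDist a Y = r → 0 < r) {t : (convexClosure S).ValueGroup}
    (ht : ∀ p ∈ Y, t ≤ vecVal (convexClosure S) (a - p)) :
    (t : WithTop _) ≤ valDist (convexClosure S) a Y := by
  rcases Y.eq_empty_or_nonempty with rfl | hne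
  · rw [valDist_top S (setDist_empty a)]; exact le_top
  · obtain ⟨r, hr⟩ := hY.exists a hne
    obtain ⟨p, hp, h⟩ := exists_near_valDist (S := S) hr (h0 r hr)
    rw [← h]
    exact WithTop.coe_le_coe.2 (ht p hp)

/-- If no intermediate level `k` shows a jump, the distances from level `i` up to the one just below
`j` have the same value. This is how condition (ii) of a val-chain is verified. -/
lemma valDist_le_valDist_prev {a : Fin n → K} {i j : Fin (d + 1)} (hij : i < j)
    (h : ∀ k, i < k → k < j →
      valDist (convexClosure S) a (prev X k) ≤ valDist (convexClosure S) a (X k)) :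
    valDist (convexClosure S) a (X i) ≤ valDist (convexClosure S) a (prev X j) := by
  induction j using Fin.induction with
  | zero => exact absurd hij (Fin.not_lt_zero i)
  | succ j ih =>
    rw [prev_succ]
    rcases (Fin.le_castSucc_iff.2 hij).eq_or_lt with rfl | hlt
    · exact le_rfl
    · exact (ih hlt fun k hk hkj => h k hk (hkj.trans Fin.castSucc_lt_succ)).trans
        (h _ hlt Fin.castSucc_lt_succ)

variable (S) in
/-- The ultrametric geometry of a stratification for the valuation given by `S`. -/
def geometry (hX : Monotone X) : ChainGeometry K (convexClosure S).ValueGroup (Fin n → K) n d where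
  w := (convexClosure S).valuation
  δ a b := vecVal (convexClosure S) (a - b)
  P := proj X
  X := X
  δ_self a := by simp [vecVal, vnorm_eq_zero.2]
  δ_comm a b := by rw [vecVal, vnorm_sub_comm]; rfl
  δ_ultra a b c :=
    (valuation_mono (vnorm_nonneg _) (vnorm_sub_le a b c)).trans ((convexClosure S).valuation.map_add _ _)
  P_le e a i j := by
    rw [← map_one (convexClosure S).valuation]
    exact valuation_le_of_le S.one_mem (by simpa using proj_entry_le i j e a)
  mono := hX

lemma valBound_zero {r : (convexClosure S).ValueGroup} {lam : WithTop (convexClosure S).ValueGroup} :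
    ValBound (convexClosure S) (0 : Matrix (Fin n) (Fin n) K) r lam :=
  ⟨fun _ => rfl, fun w _ i j => by simp⟩

lemma ValBound.entryBound {M : Matrix (Fin n) (Fin n) K} {r s : (convexClosure S).ValueGroup}
    {lam : WithTop (convexClosure S).ValueGroup} (h : ValBound (convexClosure S) M r lam)
    (hs : (s : WithTop _) ≤ lam) : EntryBound (convexClosure S).valuation M r s := by
  induction lam using WithTop.recTopCoe with
  | top => rw [h.1 rfl]; exact entryBound_zero
  | coe w => exact EntryBound.mono (h.2 w rfl) le_rfl (WithTop.coe_le_coe.1 hs)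

/-- The core has final radii in the value group, whereas the distance may be infinite. In that case
letting `s` grow forces `M = 0`; this needs a non-trivial valuation, which `hbig` provides. -/
lemma valBound_of_entryBound (hbig : ∃ x : K, ∀ s ∈ S, s < x) {M : Matrix (Fin n) (Fin n) K} {ρ : K}
    {r₀ : (convexClosure S).ValueGroup} {lam : WithTop (convexClosure S).ValueGroup}
    (hr : (r₀ : WithTop _) ≤ lam)
    (h : ∀ s : (convexClosure S).ValueGroup, r₀ ≤ s → (s : WithTop _) ≤ lam →
      EntryBound (convexClosure S).valuation M ((convexClosure S).valuation ρ) s) :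
    ValBound (convexClosure S) M ((convexClosure S).valuation ρ) lam := by
  constructor
  · rintro rfl
    have hall : ∀ s, EntryBound (convexClosure S).valuation M ((convexClosure S).valuation ρ) s :=
      fun s => (h (max r₀ s) (le_max_left _ _) le_top).mono le_rfl (le_max_right _ _)
    ext i j
    by_contra hne
    have hne' : M i j ≠ 0 := hne
    by_cases hρ : ρ = 0
    · have := hall 1 i j
      rw [hρ, map_zero, mul_one, le_zero_iff, map_eq_zero] at this
      exact hne' this
    · obtain ⟨x, hx⟩ := hbig
      -- With this radius the bound would say `v x ≤ 1` in multiplicative notation, although `x`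
      -- exceeds all of `S`.
      have := hall ((convexClosure S).valuation (x * ρ / M i j)) i j
      rw [← map_mul, mul_div_cancel₀ _ hne', valuation_le_iff hρ] at this
      obtain ⟨c, hc, hlt⟩ := this
      rw [abs_mul] at hlt
      have h1 := lt_of_mul_lt_mul_right hlt (abs_nonneg _)
      exact absurd (hx c hc) (((le_abs_self x).trans_lt h1).le.not_gt)
  · rintro w rfl
    exact h w (WithTop.coe_le_coe.1 hr) le_rfl

end Tame

/-! ### Chains given by finite sequences -/

section OfFn

variable {K Γ V : Type*} [Field K] [LinearOrderedCommGroupWithZero Γ] {n d : ℕ}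
  {G : ChainGeometry K Γ V n d}

lemma ChainGeometry.isChain_ofFn {m : ℕ} (f : Fin m → Node Γ V d) (R : Fin (m + 1) → Γ)
    (hR : ∀ l, (f l).r = R l.castSucc) (hmem : ∀ l, (f l).pt ∈ skel G.X (f l).e)
    (hpair : ∀ l l', l < l' → (f l').e < (f l).e ∧ G.δ (f l).pt (f l').pt ≤ (f l').r)
    (hstep : ∀ l : Fin m, R l.castSucc = R l.succ ∨
      R l.castSucc < R l.succ ∧ G.Far (f l).e (f l).pt (R l.succ)) :
    G.IsChain (R (Fin.last m)) (List.ofFn f) ∧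
      headRadius (List.ofFn f) (R (Fin.last m)) = R 0 := by
  induction m with
  | zero => exact ⟨trivial, rfl⟩
  | succ m ih =>
    obtain ⟨h1, h2⟩ := ih (f ∘ Fin.succ) (R ∘ Fin.succ) (fun l => hR l.succ)
      (fun l => hmem l.succ) (fun l l' h => hpair _ _ (Fin.succ_lt_succ_iff.2 h))
      (fun l => hstep l.succ)
    rw [List.ofFn_succ]
    refine ⟨⟨hmem 0, fun z hz => ?_, ?_, h1⟩, hR 0⟩
    · obtain ⟨l, rfl⟩ := (List.mem_ofFn' _ _).1 hz
      exact hpair _ _ (Fin.succ_pos l)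
    · have h2' : headRadius (List.ofFn fun i => f i.succ) (R (Fin.last (m + 1))) = R 1 := h2
      rw [h2', hR 0]
      exact hstep 0

end OfFn

/-! ### From val-chains to chains of nodes -/

section Weak

variable {K : Type*} [Field K] [LinearOrder K] [IsStrictOrderedRing K] [HasSqrt K] {n d : ℕ}
  {X : Fin (d + 1) → Set (Fin n → K)} {S : Subring K}

/-- The nodes of a val-chain. -/
def chainNodes (S : Subring K) {m : ℕ} (e : Fin (m + 1) → Fin (d + 1))
    (a : Fin (m + 1) → Fin n → K) : List (Node (convexClosure S).ValueGroup (Fin n → K) d) :=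
  List.ofFn fun l : Fin m => ⟨e l.succ, a l.succ, vecVal (convexClosure S) (a 0 - a l.succ)⟩

lemma nodeProd_chainNodes (hX : Monotone X) {m : ℕ} (e : Fin (m + 1) → Fin (d + 1))
    (a : Fin (m + 1) → Fin n → K) :
    (geometry S hX).nodeProd (chainNodes S e a) = tailProd X e a := by
  rw [ChainGeometry.nodeProd, chainNodes, List.map_ofFn]
  rfl

lemma headRadius_chainNodes_succ {m : ℕ} (e : Fin (m + 2) → Fin (d + 1))
    (a : Fin (m + 2) → Fin n → K) (s : (convexClosure S).ValueGroup) :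
    headRadius (chainNodes S e a) s = vecVal (convexClosure S) (a 0 - a 1) := by
  rw [chainNodes, List.ofFn_succ]
  rfl

/-- By condition (ii), the radius of the next node is the distance from `a⁰` to the level below the
current one. Condition (i) then says that radii do not decrease; where they increase strictly, the
ultrametric inequality passes the distance from `a⁰` on to the chain point. -/
lemma IsPlainValChain.isChain (hX : Tame X) {m : ℕ} {e : Fin (m + 1) → Fin (d + 1)}
    {a : Fin (m + 1) → Fin n → K} {weak : Prop}
    (h : IsPlainValChain (convexClosure S) weak X e a)
    {s : (convexClosure S).ValueGroup}
    (hs : (s : WithTop _) ≤ valDist (convexClosure S) (a 0) (prev X (e (Fin.last m))))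
    (hs' : ∀ l : Fin m, vecVal (convexClosure S) (a 0 - a l.succ) ≤ s) :
    (geometry S hX.mono).IsChain s (chainNodes S e a) := by
  -- The final radius is appended to the node radii, so that every node, including the last, has a
  -- successor in `R`.
  set R : Fin (m + 1) → (convexClosure S).ValueGroup := Fin.snoc (fun l : Fin m => vecVal (convexClosure S) (a 0 - a l.succ)) s
  have hnai : ∀ l : Fin m, (vecVal (convexClosure S) (a 0 - a l.succ) : WithTop (convexClosure S).ValueGroup) ≤
      valDist (convexClosure S) (a 0) (prev X (e l.succ)) := fun l => (h.nai l).elim (fun h => h.le) fun h => h.2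
  have hR1 : ∀ l : Fin m, R l.castSucc = vecVal (convexClosure S) (a 0 - a l.succ) := fun l => by simp [R]
  have hR2 : ∀ l : Fin m, (R l.succ : WithTop (convexClosure S).ValueGroup) ≤ valDist (convexClosure S) (a 0) (prev X (e l.succ)) := by
    intro l
    induction m with
    | zero => exact l.elim0
    | succ m _ =>
      induction l using Fin.lastCases with
      | last => rw [Fin.succ_last]; simpa [R] using hs
      | cast l =>
        rw [Fin.succ_castSucc, hR1]
        have := h.nae l.succ
        rw [← Fin.succ_castSucc] at this ⊢
        exact this.le
  have hR3 : ∀ l : Fin m, R l.castSucc ≤ R l.succ := by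
    intro l
    induction m with
    | zero => exact l.elim0
    | succ m _ =>
      induction l using Fin.lastCases with
      | last => rw [Fin.succ_last, hR1]; simpa [R] using hs' (Fin.last m)
      | cast l =>
        have h1 := hnai l.castSucc
        have h2 := h.nae l.succ
        rw [hR1, Fin.succ_castSucc, hR1, ← WithTop.coe_le_coe]
        rw [h2]
        rwa [Fin.succ_castSucc] at h1
  have hR4 : ∀ l l' : Fin m, l ≤ l' → R l.castSucc ≤ R l'.castSucc := by
    have : Monotone R := Fin.monotone_iff_le_succ.2 hR3
    exact fun l l' hl => this (Fin.castSucc_le_castSucc_iff.2 hl)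
  have hlast : R (Fin.last m) = s := by simp [R]
  have key := (geometry S hX.mono).isChain_ofFn
    (fun l : Fin m => ⟨e l.succ, a l.succ, vecVal (convexClosure S) (a 0 - a l.succ)⟩) R
    (fun l => (hR1 l).symm) (fun l => h.mem l.succ)
    (fun l l' hl => ⟨h.anti (Fin.succ_lt_succ_iff.2 hl), by
      refine ChainGeometry.δ_trans (b := a 0) ?_ le_rfl
      rw [ChainGeometry.δ_comm]
      have := hR4 l l' hl.le
      rwa [hR1, hR1] at this⟩)
    (fun l => by
      rcases (hR3 l).eq_or_lt with h1 | h1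
      · exact Or.inl h1
      · refine Or.inr ⟨h1, ?_⟩
        have hf : (geometry S hX.mono).Far (e l.succ) (a 0) (R l.succ) := fun p hp =>
          le_vecVal_of_le_valDist (hX.hasDist_prev _) hp (hR2 l)
        refine hf.congr ?_
        rw [hR1] at h1
        exact h1)
  rw [hlast] at key
  exact key.1

/-- The core estimate is applied with `g = d`, which covers all levels, and with every admissible
final radius. -/
lemma weak_of_witness (hX : Tame X) (hbig : ∃ x : K, ∀ s ∈ S, s < x)
    (h1 : (geometry S hX.mono).PlainWitness) (h2 : (geometry S hX.mono).AugWitness) :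
    IsWeakValLipschitz (convexClosure S) X := by
  have hG := ChainGeometry.plainBound_and_augBound h1 h2 d
  have hnai : ∀ {m : ℕ} {e : Fin (m + 1) → Fin (d + 1)} {a : Fin (m + 1) → Fin n → K},
      IsPlainValChain (convexClosure S) True X e a → ∀ l : Fin m, (vecVal (convexClosure S) (a 0 - a l.succ) : WithTop (convexClosure S).ValueGroup) ≤
      valDist (convexClosure S) (a 0) (prev X (e l.succ)) := fun h l => (h.nai l).elim (fun h => h.le) fun h => h.2
  have hmono : ∀ {m : ℕ} {e : Fin (m + 2) → Fin (d + 1)} {a : Fin (m + 2) → Fin n → K},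
      IsPlainValChain (convexClosure S) True X e a → ∀ l : Fin (m + 1),
        vecVal (convexClosure S) (a 0 - a l.succ) ≤ vecVal (convexClosure S) (a 0 - a (Fin.last m).succ) := by
    intro m e a h l
    have : Monotone fun l : Fin (m + 1) => vecVal (convexClosure S) (a 0 - a l.succ) := by
      refine Fin.monotone_iff_le_succ.2 fun l => ?_
      rw [← WithTop.coe_le_coe, h.nae l.succ]
      have := hnai h l.castSucc
      rwa [Fin.succ_castSucc] at this
    exact this (Fin.le_last l)
  constructor
  · intro m e a h
    refine valBound_of_entryBound hbig (r₀ := vecVal (convexClosure S) (a 0 - a (Fin.last m).succ)) (hnai h _)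
      fun s hs hs' => ?_
    have hc := h.isChain hX hs' fun l => (hmono h l).trans hs
    have := hG.1 (e 0) (a 0) _ s (h.mem 0) hc (fun z hz => by
      obtain ⟨l, rfl⟩ := (List.mem_ofFn' _ _).1 hz
      exact ⟨h.anti (Fin.succ_pos l), le_rfl⟩) (fun z hz => by omega)
    rw [headRadius_chainNodes_succ, nodeProd_chainNodes] at this
    exact this
  · intro m e a b h hb hab
    replace hab : (vecVal (convexClosure S) (a 0 - b) : WithTop (convexClosure S).ValueGroup) ≤ valDist (convexClosure S) (a 0) (prev X (e 0)) :=
      hab.elim (fun h => h.le) fun h => h.2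
    -- The smallest useful final radius is the radius of the last node, or that of `b` if there are
    -- no further points.
    obtain ⟨r₀, hr₀, hrl, hrb⟩ : ∃ r₀ : (convexClosure S).ValueGroup,
        (r₀ : WithTop (convexClosure S).ValueGroup) ≤ valDist (convexClosure S) (a 0) (prev X (e (Fin.last m))) ∧
        (∀ l : Fin m, vecVal (convexClosure S) (a 0 - a l.succ) ≤ r₀) ∧ vecVal (convexClosure S) (a 0 - b) ≤ r₀ := by
      cases m with
      | zero => exact ⟨_, hab, fun l => l.elim0, le_rfl⟩
      | succ m =>
        refine ⟨vecVal (convexClosure S) (a 0 - a (Fin.last m).succ), hnai h _, hmono h, ?_⟩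
        refine le_trans ?_ (hmono h 0)
        rw [← WithTop.coe_le_coe, h.nae 0]
        exact hab
    refine valBound_of_entryBound hbig hr₀ fun s hs hs' => ?_
    have hc := h.isChain hX hs' fun l => (hrl l).trans hs
    set t := headRadius (chainNodes S e a) s with ht
    have hbt : vecVal (convexClosure S) (a 0 - b) ≤ t ∧ (t : WithTop (convexClosure S).ValueGroup) ≤ valDist (convexClosure S) (a 0) (prev X (e 0)) ∧
        ∀ z ∈ chainNodes S e a, t ≤ z.r := by
      refine ⟨?_, ?_, hc.headRadius_le.2⟩
      · cases m with
        | zero => exact hrb.trans hs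
        | succ m =>
          rw [ht, headRadius_chainNodes_succ, ← WithTop.coe_le_coe]
          exact hab.trans (h.nae 0).ge
      · cases m with
        | zero => exact hs'
        | succ m =>
          rw [ht, headRadius_chainNodes_succ]
          exact (h.nae 0).le
    have hzb : ∀ z ∈ chainNodes S e a, z.e < e 0 ∧ (geometry S hX.mono).δ b z.pt ≤ z.r := by
      intro z hz
      have hz' := hz
      obtain ⟨l, rfl⟩ := (List.mem_ofFn' _ _).1 hz
      refine ⟨h.anti (Fin.succ_pos l), ChainGeometry.δ_trans (b := a 0) ?_ le_rfl⟩
      rw [ChainGeometry.δ_comm]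
      exact hbt.1.trans (hbt.2.2 _ hz')
    -- Here `b` becomes the first node of the chain and `a 0` the nearby point of the same skeleton.
    have := hG.2 ⟨e 0, b, vecVal (convexClosure S) (a 0 - b)⟩ (a 0) (chainNodes S e a) s
      ⟨hb, hzb, ?_, hc⟩ (h.mem 0) le_rfl (fun z hz => by omega)
    · rw [nodeProd_chainNodes] at this
      exact this
    · rcases hbt.1.eq_or_lt with h3 | h3
      · exact Or.inl h3
      · refine Or.inr ⟨h3, ?_⟩
        have hf : (geometry S hX.mono).Far (e 0) (a 0) t := fun p hp =>
          le_vecVal_of_le_valDist (hX.hasDist_prev _) hp hbt.2.1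
        exact hf.congr h3

end Weak

/-! ### Sequences built from a list of levels -/

section Sequences

variable {d : ℕ} {V : Type*}

/-- The levels `e, Js 0, Js 1, …`. -/
def levelSeq (e : Fin (d + 1)) (Js : List (Fin (d + 1))) : Fin (Js.length + 1) → Fin (d + 1) :=
  Fin.cons e Js.get

/-- The points `a, y (Js 0), y (Js 1), …`. -/
def pointSeq (a : V) (Js : List (Fin (d + 1))) (y : Fin (d + 1) → V) : Fin (Js.length + 1) → V :=
  Fin.cons a fun k => y (Js.get k)

variable {e : Fin (d + 1)} {Js : List (Fin (d + 1))} {a : V} {y : Fin (d + 1) → V}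

@[simp] lemma levelSeq_zero : levelSeq e Js 0 = e := rfl
@[simp] lemma levelSeq_succ (l : Fin Js.length) : levelSeq e Js l.succ = Js.get l := rfl
@[simp] lemma pointSeq_zero : pointSeq a Js y 0 = a := rfl
@[simp] lemma pointSeq_succ (l : Fin Js.length) : pointSeq a Js y l.succ = y (Js.get l) := rfl

lemma pointSeq_one {j : Fin (d + 1)} {js : List (Fin (d + 1))} :
    pointSeq a (j :: js) y (1 : Fin (js.length + 2)) = y j := rfl

lemma strictAnti_levelSeq (hJs : Js.Pairwise (· > ·)) (he : ∀ i ∈ Js, i < e) :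
    StrictAnti (levelSeq e Js) := by
  intro k l hkl
  cases l using Fin.cases with
  | zero => exact absurd hkl (Fin.not_lt_zero k)
  | succ l =>
    cases k using Fin.cases with
    | zero => exact he _ (List.get_mem _ _)
    | succ k => exact List.pairwise_iff_get.1 hJs k l (Fin.succ_lt_succ_iff.1 hkl)

lemma exists_levelSeq_eq {i : Fin (d + 1)} (hi : i ∈ Js) : ∃ l : Fin Js.length, i = levelSeq e Js l.succ := by
  obtain ⟨l, hl⟩ := List.mem_iff_get.1 hi
  exact ⟨l, hl.symm⟩

lemma levelSeq_last : levelSeq e Js (Fin.last _) ∈ Js ∨ Js = [] ∧ levelSeq e Js (Fin.last _) = e := by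
  cases Js with
  | nil => exact Or.inr ⟨rfl, rfl⟩
  | cons j js => exact Or.inl (List.get_mem (j :: js) (Fin.last _))

lemma tailProd_levelSeq {K : Type*} [Field K] [LinearOrder K] {n : ℕ} (X : Fin (d + 1) → Set (Fin n → K))
    (a : Fin n → K) (y : Fin (d + 1) → Fin n → K) :
    tailProd X (levelSeq e Js) (pointSeq a Js y) = (Js.map fun i => proj X i (y i)).prod := by
  rw [tailProd]
  congr 1
  conv_rhs => rw [← List.ofFn_get Js, List.map_ofFn]
  rfl

end Sequences

/-! ### Choosing nearest points on the jump levels -/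

section NearChoice

variable {K Γ V : Type*} [Field K] [LinearOrderedCommGroupWithZero Γ] {n d : ℕ}
  {G : ChainGeometry K Γ V n d} {s : Γ}

namespace ChainGeometry

lemma IsChain.exists_far {zs : List (Node Γ V d)} (h : G.IsChain s zs) (hs : StrictRadii s zs) :
    ∀ z ∈ zs, ∃ t, z.r < t ∧ G.Far z.e z.pt t := by
  induction zs with
  | nil => simp
  | cons x l ih =>
    intro z hz
    rcases List.mem_cons.1 hz with rfl | hz
    · exact ⟨_, h.2.2.1.resolve_left hs.1.ne⟩
    · exact ih h.2.2.2 hs.2 z hz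

lemma IsChain.exists_last {zs : List (Node Γ V d)} (h : G.IsChain s zs) (hs : StrictRadii s zs)
    (hne : zs ≠ []) : ∃ z ∈ zs, (∀ z' ∈ zs, z.e ≤ z'.e) ∧ z.r < s ∧ G.Far z.e z.pt s := by
  induction zs with
  | nil => exact (hne rfl).elim
  | cons x l ih =>
    cases l with
    | nil => exact ⟨x, by simp, by simp, h.2.2.1.resolve_left hs.1.ne⟩
    | cons y l =>
      obtain ⟨z, hz, h1, h2⟩ := ih h.2.2.2 hs.2 (by simp)
      refine ⟨z, List.mem_cons_of_mem _ hz, fun z' hz' => ?_, h2⟩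
      rcases List.mem_cons.1 hz' with rfl | hz'
      · exact (h.2.1 z hz).1.le
      · exact h1 z' hz'

/-- All levels below `e`, down to the lowest one of `zs`, at which `jump` holds are collected in
decreasing order. The predicates `jump` and `Q` are left open so that metric and valuative chains
are treated alike. -/
lemma exists_isNearChoice {zs : List (Node Γ V d)} {a : V} {e : Fin (d + 1)}
    (hze : ∀ z ∈ zs, z.e < e) (jump : Fin (d + 1) → Prop) (hz : ∀ z ∈ zs, jump z.e)
    (Q : Fin (d + 1) → V → Prop)
    (hy : ∀ i < e, (∃ z ∈ zs, z.e ≤ i) → jump i →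
      ∃ p ∈ skel G.X i, Q i p ∧ ∀ p' ∈ G.X i, G.δ a p ≤ G.δ a p') :
    ∃ Js y, G.IsNearChoice zs a Js y ∧ (∀ i ∈ Js, Q i (y i)) ∧
      ∀ i, i ∈ Js ↔ (∃ z ∈ zs, z.e ≤ i) ∧ i < e ∧ jump i := by
  classical
  set Js := (List.finRange (d + 1)).reverse.filter
    fun i => (∃ z ∈ zs, z.e ≤ i) ∧ i < e ∧ jump i with hJs
  have hmem : ∀ i, i ∈ Js ↔ (∃ z ∈ zs, z.e ≤ i) ∧ i < e ∧ jump i := fun i => by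
    simp [hJs]
  have : ∀ i, ∃ p, i ∈ Js → p ∈ skel G.X i ∧ Q i p ∧ ∀ p' ∈ G.X i, G.δ a p ≤ G.δ a p' := fun i => by
    by_cases hi : i ∈ Js
    · have := (hmem i).1 hi
      obtain ⟨p, hp⟩ := hy i this.2.1 this.1 this.2.2
      exact ⟨p, fun _ => hp⟩
    · exact ⟨a, fun h => (hi h).elim⟩
  choose y hy' using this
  refine ⟨Js, y, ⟨?_, ?_, ?_, ?_, ?_⟩, fun i hi => (hy' i hi).2.1, hmem⟩
  · refine List.Pairwise.filter _ ?_
    rw [List.pairwise_reverse]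
    exact List.pairwise_lt_finRange _
  · exact fun z h => (hmem _).2 ⟨⟨z, h, le_rfl⟩, hze z h, hz z h⟩
  · exact fun i hi => ((hmem i).1 hi).1
  · exact fun i hi => (hy' i hi).1
  · exact fun i hi => (hy' i hi).2.2

/-- The lowest chosen level is the lowest level of `zs`, where strictness places everything below at
distance at least `s`. For an empty chain the assumption `h0` takes over. -/
lemma IsNearChoice.far_last {zs : List (Node Γ V d)} {a : V} {e : Fin (d + 1)}
    {Js : List (Fin (d + 1))} {y : Fin (d + 1) → V} (hJ : G.IsNearChoice zs a Js y)
    (h : G.IsChain s zs) (hs : StrictRadii s zs) (ha : ∀ z ∈ zs, G.δ a z.pt ≤ z.r)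
    (h0 : zs = [] → G.Far e a s) : G.Far (levelSeq e Js (Fin.last _)) a s := by
  rcases levelSeq_last (e := e) (Js := Js) with hl | ⟨hl, hl'⟩
  · obtain ⟨z₀, hz₀, hle₀⟩ := hJ.ge _ hl
    obtain ⟨z, hz, h1, h2, h3⟩ := h.exists_last hs (List.ne_nil_of_mem hz₀)
    have : levelSeq e Js (Fin.last _) = z.e := by
      refine le_antisymm ?_ ((h1 _ hz₀).trans hle₀)
      obtain ⟨l, hl⟩ := exists_levelSeq_eq (e := e) (hJ.mem z hz)
      have hanti : Antitone (levelSeq e Js) ∨ True := Or.inr trivial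
      rw [hl]
      rcases (Fin.le_last l.succ).eq_or_lt with h4 | h4
      · rw [h4]
      · have hlt : ∀ k : Fin Js.length, l < k → Js.get k < Js.get l := fun k hk =>
          List.pairwise_iff_get.1 hJ.sorted l k hk
        obtain ⟨k, hk⟩ := Fin.exists_succ_eq.2 ((Fin.zero_le _).trans_lt h4).ne'
        rw [← hk] at h4 ⊢
        exact (hlt k (Fin.succ_lt_succ_iff.1 h4)).le
    rw [this]
    refine h3.congr ?_
    rw [G.δ_comm]
    exact (ha z hz).trans_lt h2
  · have : zs = [] := by
      cases zs with
      | nil => rfl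
      | cons z zs =>
        have := hJ.mem z (by simp)
        rw [hl] at this
        simp at this
    rw [hl']
    exact h0 this

lemma IsNearChoice.near_head {x : Node Γ V d} {zs : List (Node Γ V d)} {a : V}
    {j : Fin (d + 1)} {js : List (Fin (d + 1))} {y : Fin (d + 1) → V}
    (hJ : G.IsNearChoice (x :: zs) a (j :: js) y) (hx : x.pt ∈ skel G.X x.e)
    (ha : G.δ a x.pt ≤ x.r) : G.δ a (y j) ≤ x.r := by
  refine (hJ.near j (by simp) x.pt ?_).trans ha
  refine G.mono ?_ hx.1
  rcases List.mem_cons.1 (hJ.mem x (by simp)) with h | h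
  · exact h.le
  · exact ((List.pairwise_cons.1 hJ.sorted).1 _ h).le

end ChainGeometry

end NearChoice

/-! ### Witnesses from the Mostowski and the strict valuative conditions -/

section Witness

variable {K : Type*} [Field K] [LinearOrder K] [IsStrictOrderedRing K] [HasSqrt K] {n d : ℕ}
  {X : Fin (d + 1) → Set (Fin n → K)} {S : Subring K}

lemma valBound_of_mostBound (hop : HasOpNorm K n) {M : Matrix (Fin n) (Fin n) K} {C ρ : K}
    (hC : C ∈ S) (hρ : 0 ≤ ρ) {a : Fin n → K} {Y : Set (Fin n → K)}
    (hpos : ∀ r : K, setDist a Y = r → 0 < r) (h : MostBound M C ρ (setDist a Y)) :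
    ValBound (convexClosure S) M ((convexClosure S).valuation ρ) (valDist (convexClosure S) a Y) := by
  generalize hD : setDist a Y = D at h hpos
  induction D using WithTop.recTopCoe with
  | top =>
    rw [eq_zero_of_opNorm_eq_zero hop (h.1 rfl)]
    exact valBound_zero
  | coe r =>
    rw [valDist_coe S hD]
    refine ⟨fun h => (WithTop.coe_ne_top h).elim, fun w hw i j => ?_⟩
    obtain rfl := WithTop.coe_eq_coe.1 hw
    have hr := hpos r rfl
    have h1 := (abs_entry_le_opNorm hop M i j).trans_lt (h.2 r rfl)
    rw [lt_div_iff₀ hr] at h1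
    rw [← map_mul]
    refine valuation_le_of_le hC ?_
    rw [abs_mul, abs_of_pos hr, abs_of_nonneg hρ]
    exact h1.le

lemma IsGLB_mul_le {a : Fin n → K} {Y : Set (Fin n → K)} (hY : HasDist Y) {c ρ : K}
    (h : ∀ p ∈ Y, c * ρ ≤ vnorm (a - p)) : (c : WithTop K) * ((ρ : K) : WithTop K) ≤ setDist a Y := by
  rcases Y.eq_empty_or_nonempty with rfl | hne
  · rw [setDist_empty]; exact le_top
  · obtain ⟨r, hr⟩ := hY.exists a hne
    rw [hr, ← WithTop.coe_mul, WithTop.coe_le_coe]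
    exact le_of_setDist hr h

/-- A jump of the distances with respect to the valuation is a jump by any factor in `S`. -/
lemma mul_le_setDist_of_far {a z : Fin n → K} {Y : Set (Fin n → K)} (hY : HasDist Y) {c : K}
    (hc : c ∈ S) (h : ∀ p ∈ Y, vecVal (convexClosure S) (a - z) < vecVal (convexClosure S) (a - p)) :
    (c : WithTop K) * ((vnorm (a - z) : K) : WithTop K) ≤ setDist a Y := by
  refine IsGLB_mul_le hY fun p hp => ?_
  have := mul_abs_lt_of_valuation_lt (h p hp) hc
  rw [abs_of_nonneg (vnorm_nonneg _), abs_of_nonneg (vnorm_nonneg _)] at this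
  exact this.le

variable {zs : List (Node (convexClosure S).ValueGroup (Fin n → K) d)}
  {s : (convexClosure S).ValueGroup} {e : Fin (d + 1)} {a : Fin n → K}

/-- A jump here means a jump of the distance by the factor `2c²`. A strict chain jumps valuatively,
hence by this factor, at its own levels. Taking all such levels makes the gap condition automatic at
the omitted ones. -/
lemma exists_plainChain (hX : Tame X) {c : K} (hc : c ∈ S) (hc1 : 1 < c) (ha : a ∈ skel X e)
    (h : (geometry S hX.mono).IsChain s zs) (hs : StrictRadii s zs)
    (hz : ∀ z ∈ zs, z.e < e ∧ vecVal (convexClosure S) (a - z.pt) ≤ z.r) :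
    ∃ Js y, (geometry S hX.mono).IsNearChoice zs a Js y ∧ (∀ i ∈ Js, i < e) ∧
      IsPlainChain X c (2 * c ^ 2) (2 * c ^ 2) (levelSeq e Js) (pointSeq a Js y) := by
  have hc0 : 0 < c := zero_lt_one.trans hc1
  have hcc : (2 * c ^ 2) ∈ S := S.mul_mem (two_mem S) (S.pow_mem hc 2)
  obtain ⟨Js, y, hJ, hQ, hmem⟩ := (geometry S hX.mono).exists_isNearChoice (zs := zs) (a := a)
    (fun z h => (hz z h).1)
    (fun i => ((2 * c ^ 2 : K) : WithTop K) * setDist a (X i) ≤ setDist a (prev X i))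
    (fun z hzz => by
      obtain ⟨t, ht, hfar⟩ := h.exists_far hs z hzz
      have hfar' : ∀ p ∈ prev X z.e,
          vecVal (convexClosure S) (a - z.pt) < vecVal (convexClosure S) (a - p) := by
        intro p hp
        have := (hfar.congr (b := a) (by
          rw [ChainGeometry.δ_comm]; exact (hz z hzz).2.trans_lt ht)) p hp
        exact (hz z hzz).2.trans_lt (ht.trans_le this)
      have hzm : z.pt ∈ X z.e := by
        have := List.mem_iff_append.1 hzz
        obtain ⟨l, l', rfl⟩ := this
        exact h.right.1.1
      obtain ⟨r, hr⟩ := (hX.hasDist z.e).exists a ⟨_, hzm⟩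
      refine le_trans ?_ (mul_le_setDist_of_far (hX.hasDist_prev _) hcc hfar')
      rw [hr, ← WithTop.coe_mul, ← WithTop.coe_mul, WithTop.coe_le_coe]
      exact mul_le_mul_of_nonneg_left (le_vnorm_of_setDist hr hzm) (by positivity))
    (fun i p => ((vnorm (a - p) : K) : WithTop K) < (c : WithTop K) * setDist a (X i))
    (fun i hi ⟨z, hzz, hzi⟩ hjump => by
      have hzm : z.pt ∈ X z.e := by
        have := List.mem_iff_append.1 hzz
        obtain ⟨l, l', rfl⟩ := this
        exact h.right.1.1
      obtain ⟨r, hr⟩ := (hX.hasDist i).exists a ⟨_, hX.mono hzi hzm⟩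
      have hr0 := hX.pos ha hi hr
      -- Because `c > 1`, some point is nearer than `c` times the distance. It avoids the lower
      -- level, since points there are at distance at least `2c² r > c r`; and as `c ∈ S` it is
      -- nearest for the valuation.
      obtain ⟨p, hp, hlt⟩ := exists_vnorm_lt_of_setDist hr (by nlinarith : r < c * r)
      refine ⟨p, ⟨hp, fun hp' => ?_⟩, ?_, fun p' hp' => ?_⟩
      · have h1 := hjump.trans (setDist_le_of_mem (hX.hasDist_prev i) hp')
        rw [hr, ← WithTop.coe_mul, WithTop.coe_le_coe] at h1
        nlinarith [mul_pos hc0 hr0]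
      · rw [hr, ← WithTop.coe_mul, WithTop.coe_lt_coe]
        exact hlt
      · refine valuation_le_of_le hc ?_
        rw [abs_of_nonneg (vnorm_nonneg _), abs_of_nonneg (vnorm_nonneg _)]
        have := le_vnorm_of_setDist hr hp'
        exact hlt.le.trans (mul_le_mul_of_nonneg_left this hc0.le))
  have hJe : ∀ i ∈ Js, i < e := fun i hi => ((hmem i).1 hi).2.1
  have hanti := strictAnti_levelSeq hJ.sorted hJe
  refine ⟨Js, y, hJ, hJe, ⟨?_, hanti, ?_, ?_, ?_⟩⟩
  · intro l
    cases l using Fin.cases with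
    | zero => exact ha
    | succ l => exact hJ.mem_skel _ (List.get_mem _ _)
  · exact fun l => hQ _ (List.get_mem _ _)
  · rintro i - - ⟨l, rfl⟩
    exact ((hmem _).1 (List.get_mem Js l)).2.2
  · intro i hi1 hi2 hi3
    have hiJ : i ∉ Js := fun hi => hi3 (exists_levelSeq_eq hi)
    have hge : ∃ z ∈ zs, z.e ≤ i := by
      rcases levelSeq_last (e := e) (Js := Js) with hl | ⟨-, hl⟩
      · obtain ⟨z, hz, hle⟩ := hJ.ge _ hl
        exact ⟨z, hz, hle.trans hi1⟩
      · rw [hl] at hi1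
        exact absurd hi2 hi1.not_gt
    by_contra hlt
    exact hiJ ((hmem i).2 ⟨hge, hi2, not_lt.1 hlt⟩)

/-- The selected levels are exactly the valuative jumps in the relevant range, so the resulting
chain is strict. Between two consecutive ones the valuative distance is constant, which gives
condition (ii). -/
lemma exists_valChain (hX : Tame X) (ha : a ∈ skel X e)
    (h : (geometry S hX.mono).IsChain s zs) (hs : StrictRadii s zs)
    (hz : ∀ z ∈ zs, z.e < e ∧ vecVal (convexClosure S) (a - z.pt) ≤ z.r) :
    ∃ Js y, (geometry S hX.mono).IsNearChoice zs a Js y ∧ (∀ i ∈ Js, i < e) ∧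
      IsPlainValChain (convexClosure S) False X (levelSeq e Js) (pointSeq a Js y) := by
  have hmemz : ∀ z ∈ zs, z.pt ∈ X z.e := fun z hzz => by
    obtain ⟨l, l', rfl⟩ := List.mem_iff_append.1 hzz
    exact h.right.1.1
  obtain ⟨Js, y, hJ, hQ, hmem⟩ := (geometry S hX.mono).exists_isNearChoice (zs := zs) (a := a)
    (fun z h => (hz z h).1)
    (fun i => valDist (convexClosure S) a (X i) < valDist (convexClosure S) a (prev X i))
    (fun z hzz => by
      obtain ⟨t, ht, hfar⟩ := h.exists_far hs z hzz
      have hfar' : (t : WithTop _) ≤ valDist (convexClosure S) a (prev X z.e) := by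
        refine le_valDist (hX.hasDist_prev _) (fun r hr => hX.pos_prev ha (hz z hzz).1.le hr)
          (hfar.congr (b := a) ?_)
        rw [ChainGeometry.δ_comm]; exact (hz z hzz).2.trans_lt ht
      refine lt_of_lt_of_le ?_ hfar'
      refine (valDist_le_of_mem (hX.hasDist _) (hmemz z hzz)).trans_lt ?_
      exact WithTop.coe_lt_coe.2 ((hz z hzz).2.trans_lt ht))
    (fun i p => (vecVal (convexClosure S) (a - p) : WithTop _) = valDist (convexClosure S) a (X i))
    (fun i hi ⟨z, hzz, hzi⟩ hjump => by
      obtain ⟨r, hr⟩ := (hX.hasDist i).exists a ⟨_, hX.mono hzi (hmemz z hzz)⟩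
      obtain ⟨p, hp, hpv⟩ := exists_near_valDist (S := S) hr (hX.pos ha hi hr)
      refine ⟨p, ⟨hp, fun hp' => ?_⟩, hpv, fun p' hp' => ?_⟩
      · have := valDist_le_of_mem (S := S) (hX.hasDist_prev i) (a := a) hp'
        rw [hpv] at this
        exact hjump.not_ge this
      · exact le_vecVal_of_le_valDist (hX.hasDist i) hp' hpv.le)
  have hJe : ∀ i ∈ Js, i < e := fun i hi => ((hmem i).1 hi).2.1
  have hanti := strictAnti_levelSeq hJ.sorted hJe
  refine ⟨Js, y, hJ, hJe, ⟨?_, hanti, ?_, ?_⟩⟩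
  · intro l
    cases l using Fin.cases with
    | zero => exact ha
    | succ l => exact hJ.mem_skel _ (List.get_mem _ _)
  · intro l
    have hl := List.get_mem Js l
    refine Or.inl ?_
    have := ((hmem _).1 hl).2.2
    rw [← hQ _ hl] at this
    exact this
  · intro l
    have hl := List.get_mem Js l
    have hlt : levelSeq e Js l.succ < levelSeq e Js l.castSucc := hanti Fin.castSucc_lt_succ
    refine (hQ _ hl).trans (le_antisymm ?_ ?_)
    · refine valDist_le_valDist_prev hlt fun k hk1 hk2 => ?_
      by_contra hlt'
      rw [not_le] at hlt'
      have hkJ : k ∈ Js := by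
        obtain ⟨z, hz, hle⟩ := hJ.ge _ hl
        refine (hmem k).2 ⟨⟨z, hz, hle.trans hk1.le⟩, hk2.trans_le ?_, hlt'⟩
        exact hanti.antitone (Fin.zero_le l.castSucc)
      obtain ⟨l', rfl⟩ := exists_levelSeq_eq (e := e) hkJ
      have h1 := hanti.lt_iff_gt.1 (show levelSeq e Js l.succ < _ from hk1)
      have h2 := hanti.lt_iff_gt.1 hk2
      rw [Fin.lt_def] at h1 h2
      simp at h1 h2
      omega
    · exact valDist_anti (hX.hasDist _) (hX.hasDist_prev _) (subset_prev hX.mono hlt) a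

lemma far_le_valDist (hX : Tame X) (ha : a ∈ skel X e) {i : Fin (d + 1)} (hi : i ≤ e)
    (h : ∀ p ∈ prev X i, s ≤ vecVal (convexClosure S) (a - p)) : (s : WithTop _) ≤ valDist (convexClosure S) a (prev X i) :=
  le_valDist (hX.hasDist_prev _) (fun _ hr => hX.pos_prev ha hi hr) h

lemma levelSeq_last_le {Js : List (Fin (d + 1))} (hJ : ∀ i ∈ Js, i < e) :
    levelSeq e Js (Fin.last _) ≤ e := by
  rcases levelSeq_last (e := e) (Js := Js) with hl | ⟨-, hl⟩
  · exact (hJ _ hl).le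
  · exact hl.le

/-- It suffices to find the bounds for chains of nearest points. -/
lemma plainWitness_of_forall (hX : Tame X)
    (H : ∀ (e : Fin (d + 1)) (a : Fin n → K) (zs : List (Node (convexClosure S).ValueGroup (Fin n → K) d))
      (s : (convexClosure S).ValueGroup), a ∈ skel X e → zs ≠ [] →
      (geometry S hX.mono).IsChain s zs → StrictRadii s zs →
      (∀ z ∈ zs, z.e < e ∧ vecVal (convexClosure S) (a - z.pt) ≤ z.r) →
      ∃ Js y, (geometry S hX.mono).IsNearChoice zs a Js y ∧ (∀ i ∈ Js, i < e) ∧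
        ∀ j js, Js = j :: js →
          ValBound (convexClosure S) ((1 - proj X e a) * tailProd X (levelSeq e Js) (pointSeq a Js y))
            (vecVal (convexClosure S) (a - y j))
            (valDist (convexClosure S) a (prev X (levelSeq e Js (Fin.last _))))) :
    (geometry S hX.mono).PlainWitness := by
  intro e a zs s ha hne h hs hz
  obtain ⟨Js, y, hJ, hJe, hB⟩ := H e a zs s ha hne h hs hz
  refine ⟨Js, y, hJ, hJe, ?_⟩
  obtain ⟨x, zs, rfl⟩ := List.exists_cons_of_ne_nil hne
  cases Js with
  | nil => simpa using hJ.mem x (by simp)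
  | cons j js =>
    have hfar := hJ.far_last (e := e) h hs (fun z h => (hz z h).2) (by simp)
    have := (hB j js rfl).entryBound (far_le_valDist hX ha (levelSeq_last_le hJe) hfar)
    rw [tailProd_levelSeq] at this
    exact this.mono (hJ.near_head h.1 (hz x (by simp)).2) le_rfl

/-- The case `x.pt = b` is separated because the augmented chains of Mostowski demand distinct
points. The matrix then vanishes and any near choice will do, whence `H'`. -/
lemma augWitness_of_forall (hX : Tame X)
    (H : ∀ (x : Node (convexClosure S).ValueGroup (Fin n → K) d) (b : Fin n → K)
      (zs : List (Node (convexClosure S).ValueGroup (Fin n → K) d))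
      (s : (convexClosure S).ValueGroup),
      (geometry S hX.mono).IsChain s zs → StrictRadii s zs → x.pt ∈ skel X x.e →
      b ∈ skel X x.e → x.pt ≠ b → vecVal (convexClosure S) (b - x.pt) ≤ x.r →
      x.r < headRadius zs s →
      (∀ p ∈ prev X x.e, headRadius zs s ≤ vecVal (convexClosure S) (b - p)) →
      (∀ z ∈ zs, z.e < x.e ∧ vecVal (convexClosure S) (b - z.pt) ≤ z.r) →
      ∃ Js y, (geometry S hX.mono).IsNearChoice zs b Js y ∧ (∀ i ∈ Js, i < x.e) ∧
          ValBound (convexClosure S)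
            ((proj X x.e b - proj X x.e x.pt) * tailProd X (levelSeq x.e Js) (pointSeq b Js y))
            (vecVal (convexClosure S) (b - x.pt))
            (valDist (convexClosure S) b (prev X (levelSeq x.e Js (Fin.last _)))))
    (H' : ∀ (e : Fin (d + 1)) (a : Fin n → K) (zs : List (Node (convexClosure S).ValueGroup (Fin n → K) d))
      (s : (convexClosure S).ValueGroup), a ∈ skel X e →
      (geometry S hX.mono).IsChain s zs → StrictRadii s zs →
      (∀ z ∈ zs, z.e < e ∧ vecVal (convexClosure S) (a - z.pt) ≤ z.r) →
      ∃ Js y, (geometry S hX.mono).IsNearChoice zs a Js y ∧ ∀ i ∈ Js, i < e) :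
    (geometry S hX.mono).AugWitness := by
  intro x b zs s h hs hb hbx
  have hz : ∀ z ∈ zs, z.e < x.e ∧ vecVal (convexClosure S) (b - z.pt) ≤ z.r := fun z hz =>
    ⟨(h.2.1 z hz).1, ChainGeometry.δ_trans (G := geometry S hX.mono)
      (hbx.trans (h.radius_le.trans (h.2.2.2.headRadius_le.2 z hz))) (h.2.1 z hz).2⟩
  by_cases hne : x.pt = b
  · obtain ⟨Js, y, hJ, hJe⟩ := H' x.e b zs s hb h.2.2.2 hs.2 hz
    refine ⟨Js, y, hJ, hJe, ?_⟩
    rw [hne, sub_self, zero_mul]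
    exact entryBound_zero
  have hfar : (geometry S hX.mono).Far x.e b (headRadius zs s) := by
    refine (h.2.2.1.resolve_left hs.1.ne).2.congr ?_
    rw [ChainGeometry.δ_comm]
    exact hbx.trans_lt hs.1
  obtain ⟨Js, y, hJ, hJe, hB⟩ := H x b zs s h.2.2.2 hs.2 h.1 hb hne hbx hs.1 hfar hz
  refine ⟨Js, y, hJ, hJe, ?_⟩
  have hfar' := hJ.far_last (e := x.e) h.2.2.2 hs.2 (fun z h => (hz z h).2) (by
    rintro rfl; exact hfar)
  have := hB.entryBound (far_le_valDist hX hb (levelSeq_last_le hJe) hfar')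
  rw [tailProd_levelSeq] at this
  exact this.mono hbx le_rfl

/-- A single constant `c > 1` in `S` is enough, because the core only asks for one good chain of
nearest points to compare with, and `C ∈ S` disappears under the valuation. -/
lemma weak_of_mostowski (hX : Tame X) (hop : HasOpNorm K n) (hbig : ∃ x : K, ∀ s ∈ S, s < x) {c C : K}
    (hc : c ∈ S) (hc1 : 1 < c) (hC : C ∈ S) (hM : Mostowski X c (2 * c ^ 2) (2 * c ^ 2) (2 * c) C) :
    IsWeakValLipschitz (convexClosure S) X := by
  refine weak_of_witness hX hbig (plainWitness_of_forall hX ?_) (augWitness_of_forall hX ?_ ?_)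
  · intro e a zs s ha hne h hs hz
    obtain ⟨Js, y, hJ, hJe, hch⟩ := exists_plainChain hX hc hc1 ha h hs hz
    refine ⟨Js, y, hJ, hJe, ?_⟩
    rintro j js rfl
    have h1 := hM.m1 js.length (levelSeq e (j :: js)) (pointSeq a (j :: js) y) hch
    rw [pointSeq_one, pointSeq_zero, levelSeq_zero] at h1
    exact valBound_of_mostBound hop hC (vnorm_nonneg _)
      (fun r hr => hX.pos_prev ha (levelSeq_last_le hJe) hr) h1
  · intro x b zs s h hs hx hb hne hbx hxr hfar hz
    obtain ⟨Js, y, hJ, hJe, hch⟩ := exists_plainChain hX hc hc1 hb h hs hz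
    refine ⟨Js, y, hJ, hJe, ?_⟩
    have h0 := mul_le_setDist_of_far (z := x.pt) (hX.hasDist_prev x.e) (S.mul_mem (two_mem S) hc)
      fun p hp => hbx.trans_lt (hxr.trans_le (hfar p hp))
    have h1 := hM.m2 Js.length (levelSeq x.e Js) (pointSeq b Js y) x.pt hch hx hne h0
    rw [pointSeq_zero, levelSeq_zero] at h1
    exact valBound_of_mostBound hop hC (vnorm_nonneg _)
      (fun r hr => hX.pos_prev hb (levelSeq_last_le hJe) hr) h1
  · intro e a zs s ha h hs hz
    obtain ⟨Js, y, hJ, hJe, -⟩ := exists_plainChain hX hc hc1 ha h hs hz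
    exact ⟨Js, y, hJ, hJe⟩

lemma weak_of_isValLipschitz (hX : Tame X) (hbig : ∃ x : K, ∀ s ∈ S, s < x)
    (hV : IsValLipschitz (convexClosure S) X) : IsWeakValLipschitz (convexClosure S) X := by
  refine weak_of_witness hX hbig (plainWitness_of_forall hX ?_) (augWitness_of_forall hX ?_ ?_)
  · intro e a zs s ha hne h hs hz
    obtain ⟨Js, y, hJ, hJe, hch⟩ := exists_valChain hX ha h hs hz
    refine ⟨Js, y, hJ, hJe, ?_⟩
    rintro j js rfl
    have h1 := hV.vm1 js.length (levelSeq e (j :: js)) (pointSeq a (j :: js) y) hch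
    rw [pointSeq_one, pointSeq_zero, levelSeq_zero] at h1
    exact h1
  · intro x b zs s h hs hx hb hne hbx hxr hfar hz
    obtain ⟨Js, y, hJ, hJe, hch⟩ := exists_valChain hX hb h hs hz
    have h0 := (WithTop.coe_lt_coe.2 (hbx.trans_lt hxr)).trans_le (far_le_valDist hX hb le_rfl hfar)
    have h1 := hV.vm2 Js.length (levelSeq x.e Js) (pointSeq b Js y) x.pt hch hx (Or.inl h0)
    rw [pointSeq_zero, levelSeq_zero] at h1
    exact ⟨Js, y, hJ, hJe, h1⟩
  · intro e a zs s ha h hs hz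
    obtain ⟨Js, y, hJ, hJe, -⟩ := exists_valChain hX ha h hs hz
    exact ⟨Js, y, hJ, hJe⟩

end Witness

/-! ### Comparison of metric and valuative chains -/

section Compare

variable {K : Type*} [Field K] [LinearOrder K] [IsStrictOrderedRing K] {n d : ℕ}

lemma coe_mul_top {c : K} (hc : 0 < c) : (c : WithTop K) * ⊤ = ⊤ :=
  WithTop.mul_top (by simpa using hc.ne')

lemma mul_setDist_mono {c c' : K} (hc : 0 < c) (h : c ≤ c') (a : Fin n → K) (Y : Set (Fin n → K)) :
    (c : WithTop K) * setDist a Y ≤ (c' : WithTop K) * setDist a Y := by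
  generalize hD : setDist a Y = D
  induction D using WithTop.recTopCoe with
  | top => rw [coe_mul_top hc, coe_mul_top (hc.trans_le h)]
  | coe r =>
    rw [← WithTop.coe_mul, ← WithTop.coe_mul, WithTop.coe_le_coe]
    exact mul_le_mul_of_nonneg_right h (setDist_nonneg hD)

lemma MostBound.mono {M : Matrix (Fin n) (Fin n) K} {C C' ρ : K} {a : Fin n → K}
    {Y : Set (Fin n → K)} (h : MostBound M C ρ (setDist a Y)) (hC : C ≤ C') (hρ : 0 ≤ ρ) :
    MostBound M C' ρ (setDist a Y) :=
  ⟨h.1, fun w hw => (h.2 w hw).trans_le (div_le_div_of_nonneg_right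
    (mul_le_mul_of_nonneg_right hC hρ) (setDist_nonneg hw))⟩

variable [HasSqrt K] {X : Fin (d + 1) → Set (Fin n → K)} {S : Subring K}

/-- Fewer chains and a larger bound make a weaker condition. No relation to `C₁'` is required, as
the far condition with constant `1` holds by monotonicity of the levels. -/
lemma Mostowski.enlarge (hX : Tame X) {c c₁ c₁' C₁' C₁'' C C₁ : K} (h : Mostowski X c c 1 (1 / c) C)
    (hc₁ : 0 < c₁) (hc₁' : 0 < c₁') (h1 : c₁ ≤ c) (h2 : c₁' ≤ c) (h3 : 1 / c ≤ C₁'') (h4 : C ≤ C₁) :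
    Mostowski X c₁ c₁' C₁' C₁'' C₁ := by
  have key : ∀ {m : ℕ} {e : Fin (m + 1) → Fin (d + 1)} {a : Fin (m + 1) → Fin n → K},
      IsPlainChain X c₁ c₁' C₁' e a → IsPlainChain X c c 1 e a := fun hch =>
    ⟨hch.mem, hch.anti, fun l => (hch.near l).trans_le (mul_setDist_mono hc₁ h1 _ _),
      fun i _ _ _ => by
        rw [WithTop.coe_one, one_mul]
        exact setDist_anti (hX.hasDist_prev i) (hX.hasDist i) (prev_subset hX.mono i) _,
      fun i h5 h6 h7 => (hch.gap i h5 h6 h7).trans_le (mul_setDist_mono hc₁' h2 _ _)⟩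
  refine ⟨fun m e a hch => (h.m1 m e a (key hch)).mono h4 (vnorm_nonneg _), fun m e a b hch hb hne hab =>
    (h.m2 m e a b (key hch) hb hne (le_trans ?_ hab)).mono h4 (vnorm_nonneg _)⟩
  rw [← WithTop.coe_mul, ← WithTop.coe_mul, WithTop.coe_le_coe]
  exact mul_le_mul_of_nonneg_right h3 (vnorm_nonneg _)

lemma exists_coe_of_mem {Y : Set (Fin n → K)} (hY : HasDist Y) {a p : Fin n → K} (hp : p ∈ Y) :
    ∃ r : K, setDist a Y = r ∧ 0 ≤ r ∧ r ≤ vnorm (a - p) := by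
  obtain ⟨r, hr⟩ := hY.exists a ⟨p, hp⟩
  exact ⟨r, hr, setDist_nonneg hr, le_vnorm_of_setDist hr hp⟩

/-- Up to factors from `S`, each `aˡ` realizes the distance to its level, and the distance does not
change at omitted levels. Nothing forces a valuative jump at the levels of the chain, so the result
is only a weak val-chain. -/
lemma IsPlainChain.isPlainValChain (hX : Tame X) {c C' : K} (hc : c ∈ S)
    {m : ℕ} {e : Fin (m + 1) → Fin (d + 1)} {a : Fin (m + 1) → Fin n → K}
    (h : IsPlainChain X c c C' e a) : IsPlainValChain (convexClosure S) True X e a := by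
  have hval : ∀ l : Fin m, (vecVal (convexClosure S) (a 0 - a l.succ) : WithTop _) =
      valDist (convexClosure S) (a 0) (X (e l.succ)) := fun l => by
    obtain ⟨r, hr, hr0, hle⟩ := exists_coe_of_mem (hX.hasDist (e l.succ)) (a := a 0) (h.mem l.succ).1
    have hn := h.near l
    rw [hr, ← WithTop.coe_mul, WithTop.coe_lt_coe] at hn
    rw [valDist_coe S hr, WithTop.coe_eq_coe]
    refine le_antisymm (valuation_le_of_le hc ?_) (valuation_mono hr0 hle)
    rw [abs_of_nonneg (vnorm_nonneg _), abs_of_nonneg hr0]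
    exact hn.le
  refine ⟨h.mem, h.anti, fun l => Or.inr ⟨trivial, ?_⟩, fun l => ?_⟩
  · rw [hval]
    exact valDist_anti (hX.hasDist_prev _) (hX.hasDist _) (prev_subset hX.mono _) _
  · have hlt : e l.succ < e l.castSucc := h.anti Fin.castSucc_lt_succ
    rw [hval]
    refine le_antisymm ?_ (valDist_anti (hX.hasDist _) (hX.hasDist_prev _) (subset_prev hX.mono hlt) _)
    refine valDist_le_valDist_prev hlt fun k hk1 hk2 => ?_
    have hg := h.gap k ((h.anti.antitone (Fin.le_last l.succ)).trans hk1.le)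
      (hk2.trans_le (h.anti.antitone (Fin.zero_le l.castSucc))) (by
        rintro ⟨l', rfl⟩
        have h1 := h.anti.lt_iff_gt.1 hk1
        have h2 := h.anti.lt_iff_gt.1 hk2
        rw [Fin.lt_def] at h1 h2
        simp at h1 h2
        omega)
    obtain ⟨r, hr, hr0, -⟩ := exists_coe_of_mem (hX.hasDist k) (a := a 0)
      (hX.mono hk1.le (h.mem l.succ).1)
    rw [hr, ← WithTop.coe_mul] at hg
    obtain ⟨r', hr'⟩ := WithTop.ne_top_iff_exists.1 (hg.trans_le le_top).ne
    rw [← hr', WithTop.coe_lt_coe] at hg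
    rw [valDist_coe S hr, valDist_coe S hr'.symm, WithTop.coe_le_coe]
    refine valuation_le_of_le hc ?_
    rw [abs_of_nonneg (setDist_nonneg hr'.symm), abs_of_nonneg hr0]
    exact hg.le

/-- Each entry is bounded with a constant from `S`. The maximum of these times `n²` is still in `S`,
hence below `C`. -/
lemma mostBound_of_valBound (hop : HasOpNorm K n) {M : Matrix (Fin n) (Fin n) K} {C ρ : K}
    (hC : ∀ s ∈ S, s < C) (hρ : 0 < ρ) {a : Fin n → K} {Y : Set (Fin n → K)}
    (hpos : ∀ r : K, setDist a Y = r → 0 < r)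
    (h : ValBound (convexClosure S) M ((convexClosure S).valuation ρ) (valDist (convexClosure S) a Y)) :
    MostBound M C ρ (setDist a Y) := by
  constructor
  · intro hD
    rw [h.1 (valDist_top S hD), opNorm_zero hop]
  · intro r hr
    have hr0 := hpos r hr
    have h2 := h.2 _ (valDist_coe S hr)
    have h3 : ∀ p : Fin n × Fin n, ∃ c ∈ S, |M p.1 p.2 * r| < c * |ρ| := fun p => by
      rw [← valuation_le_iff hρ.ne', map_mul]
      exact h2 p.1 p.2
    choose f hf hlt using h3
    obtain ⟨c, hc, hc0, hfc⟩ := exists_mem_bound f hf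
    have h4 : opNorm M ≤ n * (n * (c * ρ / r)) := opNorm_le hop M _ fun i j => by
      rw [le_div_iff₀ hr0]
      have := hlt (i, j)
      rw [abs_mul, abs_of_pos hr0, abs_of_pos hρ] at this
      exact this.le.trans (mul_le_mul_of_nonneg_right (hfc (i, j)) hρ.le)
    refine h4.trans_lt ?_
    have hnc : (n * (n * c) : K) < C := hC _ (S.mul_mem (natCast_mem S n) (S.mul_mem (natCast_mem S n) hc))
    rw [lt_div_iff₀ hr0]
    have : (n * (n * (c * ρ / r)) : K) * r = (n * (n * c)) * ρ := by field_simp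
    rw [this]
    exact mul_lt_mul_of_pos_right hnc hρ

lemma mostowski_of_weak (hX : Tame X) (hop : HasOpNorm K n) {c C : K} (hc : c ∈ S) (hc0 : 0 < c)
    (hC : ∀ s ∈ S, s < C) (hV : IsWeakValLipschitz (convexClosure S) X) :
    Mostowski X c c 1 (1 / c) C := by
  constructor
  · intro m e a hch
    refine mostBound_of_valBound hop hC ?_
      (fun r hr => hX.pos_prev (hch.mem 0) (hch.anti.antitone (Fin.zero_le _)) hr)
      (hV.vm1 m e a (hch.isPlainValChain hX hc))
    refine vnorm_sub_pos fun h => ?_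
    have h0 := hch.mem 0
    rw [h] at h0
    exact hX.notMem_of_lt h0 (hch.anti Fin.zero_lt_one) (hch.mem 1).1
  · intro m e a b hch hb hne hab
    refine mostBound_of_valBound hop hC (vnorm_sub_pos hne.symm)
      (fun r hr => hX.pos_prev (hch.mem 0) (hch.anti.antitone (Fin.zero_le _)) hr)
      (hV.vm2 m e a b (hch.isPlainValChain hX hc) hb (Or.inr ⟨trivial, ?_⟩))
    generalize hD : setDist (a 0) (prev X (e 0)) = D at hab
    induction D using WithTop.recTopCoe with
    | top => rw [valDist_top S hD]; exact le_top
    | coe r =>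
      rw [valDist_coe S hD, WithTop.coe_le_coe]
      rw [← WithTop.coe_mul, WithTop.coe_le_coe] at hab
      refine valuation_le_of_le hc ?_
      rw [abs_of_nonneg (vnorm_nonneg _), abs_of_nonneg (setDist_nonneg hD)]
      rwa [one_div, inv_mul_le_iff₀ hc0] at hab

lemma exists_succ_le_lt {α : Type*} [LinearOrder α] {m : ℕ} (f : Fin (m + 1) → α) {i : α}
    (h1 : f (Fin.last m) ≤ i) (h2 : i < f 0) : ∃ l : Fin m, f l.succ ≤ i ∧ i < f l.castSucc := by
  by_contra! hc
  have : ∀ k, i < f k := fun k => by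
    induction k using Fin.induction with
    | zero => exact h2
    | succ k ih =>
      by_contra! hk
      exact (hc k hk).not_gt ih
  exact h1.not_gt (this _)

/-- Finitely many comparisons of values determine `c`. Strictness of (i) is a jump by every factor
from `S`, so `C` may be selected after `c`, in the order of quantifiers of version (2). -/
lemma IsPlainValChain.exists_const (hX : Tame X) {m : ℕ} {e : Fin (m + 1) → Fin (d + 1)}
    {a : Fin (m + 1) → Fin n → K} (h : IsPlainValChain (convexClosure S) False X e a) :
    ∃ c ∈ S, 0 < c ∧ ∀ C ∈ S, 0 < C → IsPlainChain X c c C e a := by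
  have hle : ∀ (l : Fin m) (i : Fin (d + 1)), i < e l.castSucc →
      (vecVal (convexClosure S) (a 0 - a l.succ) : WithTop _) ≤ valDist (convexClosure S) (a 0) (X i) :=
    fun l i hi => (h.nae l).le.trans
      (valDist_anti (hX.hasDist _) (hX.hasDist_prev _) (subset_prev hX.mono hi) _)
  have hlt0 : ∀ (l : Fin m) (i : Fin (d + 1)), i < e l.castSucc → i < e 0 := fun l i hi =>
    hi.trans_le (h.anti.antitone (Fin.zero_le _))
  have key : ∀ (l : Fin m) (i : Fin (d + 1)), e l.succ ≤ i → i < e l.castSucc →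
      ∃ c ∈ S, ∃ r : K, setDist (a 0) (X i) = r ∧ 0 < r ∧ vnorm (a 0 - a l.succ) < c * r := by
    intro l i h1 h2
    obtain ⟨r, hr, -, -⟩ := exists_coe_of_mem (hX.hasDist i) (a := a 0) (hX.mono h1 (h.mem l.succ).1)
    have hr0 := hX.pos (h.mem 0) (hlt0 l i h2) hr
    have := hle l i h2
    rw [valDist_coe S hr, WithTop.coe_le_coe, vecVal, valuation_le_iff hr0.ne'] at this
    obtain ⟨c, hc, hlt⟩ := this
    rw [abs_of_nonneg (vnorm_nonneg _), abs_of_pos hr0] at hlt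
    exact ⟨c, hc, r, hr, hr0, hlt⟩
  have key' : ∀ p : Fin m × Fin (d + 1), ∃ c ∈ S, e p.1.succ ≤ p.2 → p.2 < e p.1.castSucc →
      ∃ r : K, setDist (a 0) (X p.2) = r ∧ 0 < r ∧ vnorm (a 0 - a p.1.succ) < c * r := by
    rintro ⟨l, i⟩
    by_cases hi : e l.succ ≤ i ∧ i < e l.castSucc
    · obtain ⟨c, hc, hc'⟩ := key l i hi.1 hi.2
      exact ⟨c, hc, fun _ _ => hc'⟩
    -- For pairs outside the relevant range any constant serves.
    · exact ⟨0, S.zero_mem, fun h1 h2 => (hi ⟨h1, h2⟩).elim⟩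
  choose f hf hf' using key'
  obtain ⟨c, hc, hc0, hfc⟩ := exists_mem_bound f hf
  have main : ∀ (l : Fin m) (i : Fin (d + 1)), e l.succ ≤ i → i < e l.castSucc →
      ∃ r : K, setDist (a 0) (X i) = r ∧ 0 < r ∧ vnorm (a 0 - a l.succ) < c * r := by
    intro l i h1 h2
    obtain ⟨r, hr, hr0, hlt⟩ := hf' (l, i) h1 h2
    exact ⟨r, hr, hr0, hlt.trans_le (mul_le_mul_of_nonneg_right (hfc (l, i)) hr0.le)⟩
  refine ⟨c, hc, hc0, fun C hC hC0 => ⟨h.mem, h.anti, fun l => ?_, ?_, fun i h1 h2 h3 => ?_⟩⟩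
  · obtain ⟨r, hr, hr0, hlt⟩ := main l _ le_rfl (h.anti Fin.castSucc_lt_succ)
    rw [hr, ← WithTop.coe_mul, WithTop.coe_lt_coe]
    exact hlt
  · rintro i - - ⟨l, rfl⟩
    obtain ⟨r, hr, hr0, hle'⟩ := exists_coe_of_mem (hX.hasDist (e l.succ)) (a := a 0) (h.mem l.succ).1
    have h1 := (h.nai l).resolve_right fun h => h.1
    have h2 := mul_le_setDist_of_far (hX.hasDist_prev (e l.succ)) hC fun p hp =>
      WithTop.coe_lt_coe.1 (h1.trans_le (valDist_le_of_mem (hX.hasDist_prev _) hp))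
    refine le_trans ?_ h2
    rw [hr, ← WithTop.coe_mul, ← WithTop.coe_mul, WithTop.coe_le_coe]
    exact mul_le_mul_of_nonneg_left hle' hC0.le
  · obtain ⟨l, hl1, hl2⟩ := exists_succ_le_lt e h1 h2
    obtain ⟨r, hr, hr0, hlt⟩ := main l i hl1 hl2
    have hl1' : e l.succ < i := lt_of_le_of_ne hl1 fun h => h3 ⟨l, h.symm⟩
    rw [hr, ← WithTop.coe_mul]
    exact (setDist_le_of_mem (hX.hasDist_prev i)
      (subset_prev hX.mono hl1' (h.mem l.succ).1)).trans_lt (WithTop.coe_lt_coe.2 hlt)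

lemma isValLipschitz_of_mostowski (hX : Tame X) (hop : HasOpNorm K n)
    (H : ∀ c ∈ S, 0 < c → ∃ C ∈ S, 0 < C ∧ Mostowski X c c C C C) :
    IsValLipschitz (convexClosure S) X := by
  constructor
  · intro m e a hch
    obtain ⟨c, hc, hc0, hC⟩ := hch.exists_const hX
    obtain ⟨C, hCS, hC0, hM⟩ := H c hc hc0
    exact valBound_of_mostBound hop hCS (vnorm_nonneg _)
      (fun r hr => hX.pos_prev (hch.mem 0) (hch.anti.antitone (Fin.zero_le _)) hr)
      (hM.m1 m e a (hC C hCS hC0))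
  · intro m e a b hch hb hab
    by_cases hne : b = a 0
    · rw [hne, sub_self, zero_mul]
      exact valBound_zero
    obtain ⟨c, hc, hc0, hC⟩ := hch.exists_const hX
    obtain ⟨C, hCS, hC0, hM⟩ := H c hc hc0
    refine valBound_of_mostBound hop hCS (vnorm_nonneg _)
      (fun r hr => hX.pos_prev (hch.mem 0) (hch.anti.antitone (Fin.zero_le _)) hr)
      (hM.m2 m e a b (hC C hCS hC0) hb hne ?_)
    exact mul_le_setDist_of_far (hX.hasDist_prev _) hCS fun p hp => WithTop.coe_lt_coe.1
      ((hab.resolve_right fun h => h.1).trans_le (valDist_le_of_mem (hX.hasDist_prev _) hp))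

end Compare

/-! ### Monotonicity in the constants for families -/

section Uniform

variable {K : Type*} [Field K] [LinearOrder K] [IsStrictOrderedRing K] [HasSqrt K] {n d : ℕ}
  {ι : Type*} {Q : Set ι} {X : ι → Fin (d + 1) → Set (Fin n → K)}

lemma UnifLip3.unifLip1 (hX : ∀ q ∈ Q, Tame (X q)) (h : UnifLip3 Q X) : UnifLip1 Q X := by
  intro c hc
  -- The new constant must dominate `c` and `2c²`, and its inverse must be at most `2c`.
  have h0 : 0 < max c (max (2 * c ^ 2) (1 / (2 * c))) := lt_max_of_lt_left hc
  obtain ⟨C, hC, hM⟩ := h _ h0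
  refine ⟨C, hC, fun q hq => (hM q hq).enlarge (hX q hq) hc (by positivity) (le_max_left _ _)
    ((le_max_left _ _).trans (le_max_right _ _)) ?_ le_rfl⟩
  rw [one_div_le h0 (by positivity)]
  exact (le_max_right _ _).trans (le_max_right _ _)

lemma UnifLip3.unifLip2 (hX : ∀ q ∈ Q, Tame (X q)) (h : UnifLip3 Q X) : UnifLip2 Q X := by
  intro c hc
  obtain ⟨C, hC, hM⟩ := h c hc
  -- In version (2) the same constant also restricts the augmented point, so it has to be at least
  -- `1 / c`.
  exact ⟨max C (1 / c), lt_max_of_lt_left hC, fun q hq => (hM q hq).enlarge (hX q hq) hc hc le_rfl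
    le_rfl (le_max_right _ _) (le_max_left _ _)⟩

end Uniform

/-! ### Properties given by the same formula in two structures -/

section UDef

variable (L : FirstOrder.Language.{u₁, u₂}) {K : Type v₁} {K' : Type v₂} [L.Structure K] [L.Structure K']
  {α β : Type}

/-- The two predicates are defined by the same formula without parameters. -/
def UDef (P : (α → K) → Prop) (P' : (α → K') → Prop) : Prop :=
  ∃ φ : L.Formula α, (∀ v, φ.Realize v ↔ P v) ∧ ∀ v, φ.Realize v ↔ P' v

/-- The graphs of the two functions are defined by the same formula without parameters. -/
def UFun (f : (α → K) → K) (f' : (α → K') → K') : Prop :=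
  UDef L (fun w : α ⊕ Unit → K => w (Sum.inr ()) = f (w ∘ Sum.inl))
    (fun w : α ⊕ Unit → K' => w (Sum.inr ()) = f' (w ∘ Sum.inl))

variable {L} {P Q : (α → K) → Prop} {P' Q' : (α → K') → Prop}

lemma UDef.congr (h : UDef L P P') (h1 : ∀ v, P v ↔ Q v) (h2 : ∀ v, P' v ↔ Q' v) : UDef L Q Q' := by
  obtain ⟨φ, hφ, hφ'⟩ := h
  exact ⟨φ, fun v => (hφ v).trans (h1 v), fun v => (hφ' v).trans (h2 v)⟩

lemma UDef.not (h : UDef L P P') : UDef L (fun v => ¬ P v) (fun v => ¬ P' v) := by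
  obtain ⟨φ, hφ, hφ'⟩ := h
  exact ⟨φ.not, fun v => by rw [Language.Formula.realize_not, hφ],
    fun v => by rw [Language.Formula.realize_not, hφ']⟩

lemma UDef.and (h : UDef L P P') (h' : UDef L Q Q') :
    UDef L (fun v => P v ∧ Q v) (fun v => P' v ∧ Q' v) := by
  obtain ⟨φ, hφ, hφ'⟩ := h
  obtain ⟨ψ, hψ, hψ'⟩ := h'
  exact ⟨φ ⊓ ψ, fun v => by rw [Language.Formula.realize_inf, hφ, hψ],
    fun v => by rw [Language.Formula.realize_inf, hφ', hψ']⟩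

lemma UDef.or (h : UDef L P P') (h' : UDef L Q Q') :
    UDef L (fun v => P v ∨ Q v) (fun v => P' v ∨ Q' v) :=
  (h.not.and h'.not).not.congr (fun v => by tauto) (fun v => by tauto)

lemma UDef.imp (h : UDef L P P') (h' : UDef L Q Q') :
    UDef L (fun v => P v → Q v) (fun v => P' v → Q' v) :=
  (h.not.or h').congr (fun v => by tauto) (fun v => by tauto)

lemma UDef.relabel {P : (α → K) → Prop} {P' : (α → K') → Prop} (f : α → β) (h : UDef L P P') :
    UDef L (fun v : β → K => P (v ∘ f)) (fun v : β → K' => P' (v ∘ f)) := by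
  obtain ⟨φ, hφ, hφ'⟩ := h
  exact ⟨φ.relabel f, fun v => by rw [Language.Formula.realize_relabel, hφ],
    fun v => by rw [Language.Formula.realize_relabel, hφ']⟩

lemma UDef.const (p : Prop) : UDef L (fun _ : α → K => p) (fun _ : α → K' => p) := by
  by_cases hp : p
  · exact ⟨⊤, fun v => by simp [hp], fun v => by simp [hp]⟩
  · exact ⟨⊥, fun v => by simp [hp], fun v => by simp [hp]⟩

lemma UDef.all [Finite β] {G : (α → K) → (β → K) → Prop} {G' : (α → K') → (β → K') → Prop}
    (h : UDef L (fun w : α ⊕ β → K => G (w ∘ Sum.inl) (w ∘ Sum.inr))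
      (fun w : α ⊕ β → K' => G' (w ∘ Sum.inl) (w ∘ Sum.inr))) :
    UDef L (fun v => ∀ y, G v y) (fun v => ∀ y, G' v y) := by
  obtain ⟨φ, hφ, hφ'⟩ := h
  exact ⟨φ.iAlls β, fun v => by rw [Language.Formula.realize_iAlls]; exact forall_congr' fun y => hφ _,
    fun v => by rw [Language.Formula.realize_iAlls]; exact forall_congr' fun y => hφ' _⟩

lemma UDef.ex [Finite β] {G : (α → K) → (β → K) → Prop} {G' : (α → K') → (β → K') → Prop}
    (h : UDef L (fun w : α ⊕ β → K => G (w ∘ Sum.inl) (w ∘ Sum.inr))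
      (fun w : α ⊕ β → K' => G' (w ∘ Sum.inl) (w ∘ Sum.inr))) :
    UDef L (fun v => ∃ y, G v y) (fun v => ∃ y, G' v y) := by
  obtain ⟨φ, hφ, hφ'⟩ := h
  exact ⟨φ.iExs β, fun v => by rw [Language.Formula.realize_iExs]; exact exists_congr fun y => hφ _,
    fun v => by rw [Language.Formula.realize_iExs]; exact exists_congr fun y => hφ' _⟩

lemma UDef.all₁ {G : (α → K) → K → Prop} {G' : (α → K') → K' → Prop}
    (h : UDef L (fun w : α ⊕ Unit → K => G (w ∘ Sum.inl) (w (Sum.inr ())))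
      (fun w : α ⊕ Unit → K' => G' (w ∘ Sum.inl) (w (Sum.inr ())))) :
    UDef L (fun v => ∀ y, G v y) (fun v => ∀ y, G' v y) :=
  (UDef.all (β := Unit) (G := fun v y => G v (y ())) (G' := fun v y => G' v (y ())) h).congr
    (fun v => ⟨fun h y => h fun _ => y, fun h y => h _⟩)
    (fun v => ⟨fun h y => h fun _ => y, fun h y => h _⟩)

lemma UDef.ex₁ {G : (α → K) → K → Prop} {G' : (α → K') → K' → Prop}
    (h : UDef L (fun w : α ⊕ Unit → K => G (w ∘ Sum.inl) (w (Sum.inr ())))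
      (fun w : α ⊕ Unit → K' => G' (w ∘ Sum.inl) (w (Sum.inr ())))) :
    UDef L (fun v => ∃ y, G v y) (fun v => ∃ y, G' v y) :=
  (UDef.ex (β := Unit) (G := fun v y => G v (y ())) (G' := fun v y => G' v (y ())) h).congr
    (fun v => ⟨fun ⟨y, h⟩ => ⟨_, h⟩, fun ⟨y, h⟩ => ⟨fun _ => y, h⟩⟩)
    (fun v => ⟨fun ⟨y, h⟩ => ⟨_, h⟩, fun ⟨y, h⟩ => ⟨fun _ => y, h⟩⟩)

lemma UDef.all₂ {γ : Type} [Finite β] [Finite γ] {G : (α → K) → (β → γ → K) → Prop}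
    {G' : (α → K') → (β → γ → K') → Prop}
    (h : UDef L (fun w : α ⊕ β × γ → K => G (w ∘ Sum.inl) fun i j => w (Sum.inr (i, j)))
      (fun w : α ⊕ β × γ → K' => G' (w ∘ Sum.inl) fun i j => w (Sum.inr (i, j)))) :
    UDef L (fun v => ∀ y, G v y) (fun v => ∀ y, G' v y) :=
  (UDef.all (β := β × γ) (G := fun v y => G v fun i j => y (i, j))
    (G' := fun v y => G' v fun i j => y (i, j)) h).congr
    (fun v => ⟨fun h y => h fun p => y p.1 p.2, fun h y => h _⟩)
    (fun v => ⟨fun h y => h fun p => y p.1 p.2, fun h y => h _⟩)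

lemma UDef.ex₂ {γ : Type} [Finite β] [Finite γ] {G : (α → K) → (β → γ → K) → Prop}
    {G' : (α → K') → (β → γ → K') → Prop}
    (h : UDef L (fun w : α ⊕ β × γ → K => G (w ∘ Sum.inl) fun i j => w (Sum.inr (i, j)))
      (fun w : α ⊕ β × γ → K' => G' (w ∘ Sum.inl) fun i j => w (Sum.inr (i, j)))) :
    UDef L (fun v => ∃ y, G v y) (fun v => ∃ y, G' v y) :=
  (UDef.ex (β := β × γ) (G := fun v y => G v fun i j => y (i, j))
    (G' := fun v y => G' v fun i j => y (i, j)) h).congr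
    (fun v => ⟨fun ⟨y, h⟩ => ⟨_, h⟩, fun ⟨y, h⟩ => ⟨fun p => y p.1 p.2, h⟩⟩)
    (fun v => ⟨fun ⟨y, h⟩ => ⟨_, h⟩, fun ⟨y, h⟩ => ⟨fun p => y p.1 p.2, h⟩⟩)

lemma UDef.forallFinite {κ : Type*} [Finite κ] {P : κ → (α → K) → Prop} {P' : κ → (α → K') → Prop}
    (h : ∀ k, UDef L (P k) (P' k)) : UDef L (fun v => ∀ k, P k v) (fun v => ∀ k, P' k v) := by
  choose φ hφ hφ' using h
  exact ⟨Language.Formula.iInf φ,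
    fun v => by rw [Language.Formula.realize_iInf]; exact forall_congr' fun k => hφ k v,
    fun v => by rw [Language.Formula.realize_iInf]; exact forall_congr' fun k => hφ' k v⟩

/-- Quantification over the length of a chain is not first-order, but it is a finite conjunction
once long chains are known not to exist. -/
lemma UDef.forallNat {P : ℕ → (α → K) → Prop} {P' : ℕ → (α → K') → Prop} (N : ℕ)
    (h : ∀ k, UDef L (P k) (P' k)) (hN : ∀ k, N ≤ k → ∀ v, P k v) (hN' : ∀ k, N ≤ k → ∀ v, P' k v) :
    UDef L (fun v => ∀ k, P k v) (fun v => ∀ k, P' k v) :=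
  (UDef.forallFinite (κ := Fin N) fun k => h k).congr
    (fun v => ⟨fun h k => (lt_or_ge k N).elim (fun hk => h ⟨k, hk⟩) fun hk => hN k hk v,
      fun h k => h k⟩)
    (fun v => ⟨fun h k => (lt_or_ge k N).elim (fun hk => h ⟨k, hk⟩) fun hk => hN' k hk v,
      fun h k => h k⟩)

lemma UFun.var (a : α) : UFun L (fun v : α → K => v a) (fun v : α → K' => v a) :=
  ⟨Language.Term.equal (Language.var (Sum.inr ())) (Language.var (Sum.inl a)),
    fun v => by simp [Language.Formula.realize_equal],
    fun v => by simp [Language.Formula.realize_equal]⟩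

lemma UFun.relabel {f : (α → K) → K} {f' : (α → K') → K'} (h : UFun L f f') (g : α → β) :
    UFun L (fun v : β → K => f (v ∘ g)) (fun v : β → K' => f' (v ∘ g)) :=
  UDef.relabel (Sum.map g id) h

/-- The values are named by existential quantifiers, since the functions are given by graphs and not
by terms. -/
lemma UDef.subst [Finite β] {P : (β → K) → Prop} {P' : (β → K') → Prop} (hP : UDef L P P')
    {f : (α → K) → β → K} {f' : (α → K') → β → K'}
    (hf : ∀ b, UFun L (fun v => f v b) (fun v => f' v b)) :
    UDef L (fun v => P (f v)) (fun v => P' (f' v)) := by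
  have : UDef L (fun v => ∃ y : β → K, (∀ b, y b = f v b) ∧ P y)
      (fun v => ∃ y : β → K', (∀ b, y b = f' v b) ∧ P' y) := by
    refine UDef.ex ((UDef.forallFinite fun b => ?_).and (hP.relabel Sum.inr))
    exact UDef.relabel (Sum.elim Sum.inl fun _ => Sum.inr b) (hf b)
  exact this.congr
    (fun v => ⟨fun ⟨y, hy, h⟩ => (funext hy : y = f v) ▸ h, fun h => ⟨_, fun _ => rfl, h⟩⟩)
    (fun v => ⟨fun ⟨y, hy, h⟩ => (funext hy : y = f' v) ▸ h, fun h => ⟨_, fun _ => rfl, h⟩⟩)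

variable {f g : (α → K) → K} {f' g' : (α → K') → K'}

lemma UFun.eq (hf : UFun L f f') (hg : UFun L g g') :
    UDef L (fun v => f v = g v) (fun v => f' v = g' v) := by
  have : UDef L (fun w : Bool → K => w true = w false) (fun w : Bool → K' => w true = w false) :=
    ⟨Language.Term.equal (Language.var true) (Language.var false),
      fun v => by simp [Language.Formula.realize_equal],
      fun v => by simp [Language.Formula.realize_equal]⟩
  exact this.subst (f := fun v b => bif b then f v else g v)
    (f' := fun v b => bif b then f' v else g' v) fun b => by cases b <;> assumption

/-- A function is definable if its graph is. -/
lemma UFun.of_graph {R : (α ⊕ Unit → K) → Prop} {R' : (α ⊕ Unit → K') → Prop}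
    (h : UDef L R R')
    (h1 : ∀ w, R w ↔ w (Sum.inr ()) = f (w ∘ Sum.inl))
    (h2 : ∀ w, R' w ↔ w (Sum.inr ()) = f' (w ∘ Sum.inl)) : UFun L f f' :=
  UDef.congr h h1 h2

end UDef

/-- The order symbol is not part of the language; square roots make the order definable from the
ring operations. -/
lemma exists_eq_add_mul_self_iff {F : Type*} [Field F] [LinearOrder F] [IsStrictOrderedRing F]
    [HasSqrt F] (x y : F) : (∃ z, y = x + z * z) ↔ x ≤ y := by
  constructor
  · rintro ⟨z, rfl⟩
    exact le_add_of_nonneg_right (mul_self_nonneg z)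
  · intro h
    obtain ⟨z, -, hz⟩ := HasSqrt.exists_sq (y - x) (sub_nonneg.2 h)
    exact ⟨z, by rw [← sq, hz]; ring⟩

lemma div_graph_iff {F : Type*} [Field F] (x y z : F) :
    (y = 0 ∧ z = 0) ∨ (¬ y = 0 ∧ z * y = x) ↔ z = x / y := by
  by_cases hy : y = 0
  · simp [hy]
  · simp [hy, eq_div_iff]

/-! ### Uniform definability of the field operations and the order -/

section Field

variable {L : FirstOrder.Language.{u₁, u₂}} {K : Type v₁} {K' : Type v₂}
  [Field K] [LinearOrder K] [IsStrictOrderedRing K] [HasSqrt K] [L.Structure K]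
  [Field K'] [LinearOrder K'] [IsStrictOrderedRing K'] [HasSqrt K'] [L.Structure K']
  {α β : Type}

variable (L K K') in
/-- The ring operations are given by symbols of the language. -/
class UniformRing : Prop where
  add : UDef L (fun v : Fin 3 → K => v 0 = v 1 + v 2) (fun v : Fin 3 → K' => v 0 = v 1 + v 2)
  mul : UDef L (fun v : Fin 3 → K => v 0 = v 1 * v 2) (fun v : Fin 3 → K' => v 0 = v 1 * v 2)
  one : UDef L (fun v : Fin 1 → K => v 0 = 1) (fun v : Fin 1 → K' => v 0 = 1)

theorem uniformRing (ι : FirstOrder.Language.ring →ᴸ L)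
    [FirstOrder.Ring.CompatibleRing K] [ι.IsExpansionOn K]
    [FirstOrder.Ring.CompatibleRing K'] [ι.IsExpansionOn K'] : UniformRing L K K' where
  add := ⟨Language.Term.equal (Language.var 0)
      ((ι.onFunction Ring.addFunc).apply₂ (Language.var 1) (Language.var 2)),
    fun v => by simp [Language.Formula.realize_equal],
    fun v => by simp [Language.Formula.realize_equal]⟩
  mul := ⟨Language.Term.equal (Language.var 0)
      ((ι.onFunction Ring.mulFunc).apply₂ (Language.var 1) (Language.var 2)),
    fun v => by simp [Language.Formula.realize_equal],
    fun v => by simp [Language.Formula.realize_equal]⟩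
  one := ⟨Language.Term.equal (Language.var 0)
      (Language.Term.func (ι.onFunction Ring.oneFunc) ![]),
    fun v => by simp [Language.Formula.realize_equal],
    fun v => by simp [Language.Formula.realize_equal]⟩

variable [UniformRing L K K']

variable {f g : (α → K) → K} {f' g' : (α → K') → K'}

lemma UFun.add (hf : UFun L f f') (hg : UFun L g g') :
    UFun L (fun v => f v + g v) (fun v => f' v + g' v) := by
  refine UFun.of_graph ((UniformRing.add (L := L) (K := K) (K' := K')).subst
    (f := fun w : α ⊕ Unit → K => ![w (Sum.inr ()), f (w ∘ Sum.inl), g (w ∘ Sum.inl)])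
    (f' := fun w : α ⊕ Unit → K' => ![w (Sum.inr ()), f' (w ∘ Sum.inl), g' (w ∘ Sum.inl)]) ?_)
    (fun w => by simp) (fun w => by simp)
  intro b
  fin_cases b
  · exact UFun.var _
  · exact hf.relabel Sum.inl
  · exact hg.relabel Sum.inl

lemma UFun.mul (hf : UFun L f f') (hg : UFun L g g') :
    UFun L (fun v => f v * g v) (fun v => f' v * g' v) := by
  refine UFun.of_graph ((UniformRing.mul (L := L) (K := K) (K' := K')).subst
    (f := fun w : α ⊕ Unit → K => ![w (Sum.inr ()), f (w ∘ Sum.inl), g (w ∘ Sum.inl)])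
    (f' := fun w : α ⊕ Unit → K' => ![w (Sum.inr ()), f' (w ∘ Sum.inl), g' (w ∘ Sum.inl)]) ?_)
    (fun w => by simp) (fun w => by simp)
  intro b
  fin_cases b
  · exact UFun.var _
  · exact hf.relabel Sum.inl
  · exact hg.relabel Sum.inl

lemma UFun.one : UFun L (fun _ : α → K => 1) (fun _ : α → K' => 1) :=
  UFun.of_graph ((UniformRing.one (L := L) (K := K) (K' := K')).subst
    (f := fun w : α ⊕ Unit → K => ![w (Sum.inr ())]) (f' := fun w : α ⊕ Unit → K' => ![w (Sum.inr ())])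
    fun b => by fin_cases b; exact UFun.var _) (fun w => by simp) (fun w => by simp)

lemma UFun.zero : UFun L (fun _ : α → K => 0) (fun _ : α → K' => 0) :=
  UFun.of_graph (((UFun.var (L := L) (Sum.inr ())).add (UFun.var (Sum.inr ()))).eq
    (UFun.var (Sum.inr ()))) (fun w => by simp) (fun w => by simp)

lemma UFun.sub (hf : UFun L f f') (hg : UFun L g g') :
    UFun L (fun v => f v - g v) (fun v => f' v - g' v) :=
  UFun.of_graph (((UFun.var (L := L) (Sum.inr ())).add (hg.relabel Sum.inl)).eq (hf.relabel Sum.inl))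
    (fun w => eq_sub_iff_add_eq.symm) (fun w => eq_sub_iff_add_eq.symm)

lemma UFun.le (hf : UFun L f f') (hg : UFun L g g') :
    UDef L (fun v => f v ≤ g v) (fun v => f' v ≤ g' v) := by
  refine UDef.congr (UDef.ex₁ (G := fun v z => g v = f v + z * z) (G' := fun v z => g' v = f' v + z * z)
    ?_) (fun v => exists_eq_add_mul_self_iff _ _) (fun v => exists_eq_add_mul_self_iff _ _)
  exact (hg.relabel Sum.inl).eq ((hf.relabel Sum.inl).add ((UFun.var _).mul (UFun.var _)))

lemma UFun.lt (hf : UFun L f f') (hg : UFun L g g') :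
    UDef L (fun v => f v < g v) (fun v => f' v < g' v) :=
  (hg.le hf).not.congr (fun _ => not_le) (fun _ => not_le)

lemma UFun.sum {κ : Type*} (s : Finset κ) {f : κ → (α → K) → K} {f' : κ → (α → K') → K'}
    (h : ∀ k, UFun L (f k) (f' k)) : UFun L (fun v => ∑ k ∈ s, f k v) (fun v => ∑ k ∈ s, f' k v) := by
  classical
  induction s using Finset.induction_on with
  | empty => simpa using UFun.zero
  | insert k s hk ih => simpa only [Finset.sum_insert hk] using (h k).add ih

lemma UFun.div (hf : UFun L f f') (hg : UFun L g g') :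
    UFun L (fun v => f v / g v) (fun v => f' v / g' v) := by
  have hz := UFun.var (L := L) (K := K) (K' := K') (Sum.inr () : α ⊕ Unit)
  have hy := hg.relabel (Sum.inl : α → α ⊕ Unit)
  exact UFun.of_graph (((hy.eq UFun.zero).and (hz.eq UFun.zero)).or
    ((hy.eq UFun.zero).not.and ((hz.mul hy).eq (hf.relabel Sum.inl))))
    (fun w => div_graph_iff _ _ _) (fun w => div_graph_iff _ _ _)

/-! ### Vectors, matrices, norms -/

variable {n d N : ℕ}

variable (L) in
/-- Uniformly definable vectors. -/
def UVec (x : (α → K) → Fin n → K) (x' : (α → K') → Fin n → K') : Prop :=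
  ∀ i, UFun L (fun v => x v i) (fun v => x' v i)

variable (L) in
/-- Uniformly definable matrices. -/
def UMat (M : (α → K) → Matrix (Fin n) (Fin n) K) (M' : (α → K') → Matrix (Fin n) (Fin n) K') : Prop :=
  ∀ i j, UFun L (fun v => M v i j) (fun v => M' v i j)

variable {x y : (α → K) → Fin n → K} {x' y' : (α → K') → Fin n → K'}
  {M M₁ : (α → K) → Matrix (Fin n) (Fin n) K} {M' M₁' : (α → K') → Matrix (Fin n) (Fin n) K'}

lemma UVec.relabel (h : UVec L x x') (g : α → β) :
    UVec L (fun v : β → K => x (v ∘ g)) (fun v : β → K' => x' (v ∘ g)) := fun i => (h i).relabel g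

lemma UMat.relabel (h : UMat L M M') (g : α → β) :
    UMat L (fun v : β → K => M (v ∘ g)) (fun v : β → K' => M' (v ∘ g)) := fun i j => (h i j).relabel g

lemma UVec.var (g : Fin n → α) : UVec L (fun v : α → K => v ∘ g) (fun v : α → K' => v ∘ g) :=
  fun i => UFun.var (g i)

lemma UVec.sub (hx : UVec L x x') (hy : UVec L y y') :
    UVec L (fun v => x v - y v) (fun v => x' v - y' v) := fun i => (hx i).sub (hy i)

lemma UVec.smul (hf : UFun L f f') (hx : UVec L x x') :
    UVec L (fun v => f v • x v) (fun v => f' v • x' v) := fun i => hf.mul (hx i)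

lemma UVec.vnorm (hx : UVec L x x') : UFun L (fun v => vnorm (x v)) (fun v => vnorm (x' v)) := by
  have hz := UFun.var (L := L) (K := K) (K' := K') (Sum.inr () : α ⊕ Unit)
  have hx' := hx.relabel (Sum.inl : α → α ⊕ Unit)
  refine UFun.of_graph ((UFun.zero.le hz).and ((hz.mul hz).eq
    (UFun.sum Finset.univ fun i => (hx' i).mul (hx' i)))) (fun w => ?_) (fun w => ?_)
  · rw [eq_vnorm_iff]; simp only [sq]
  · rw [eq_vnorm_iff]; simp only [sq]

lemma UVec.dotProduct (hx : UVec L x x') (hy : UVec L y y') :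
    UFun L (fun v => x v ⬝ᵥ y v) (fun v => x' v ⬝ᵥ y' v) :=
  UFun.sum Finset.univ fun i => (hx i).mul (hy i)

lemma UMat.mulVec (hM : UMat L M M') (hx : UVec L x x') :
    UVec L (fun v => (M v).mulVec (x v)) (fun v => (M' v).mulVec (x' v)) := fun i =>
  UFun.sum Finset.univ fun j => (hM i j).mul (hx j)

lemma UMat.mul (hM : UMat L M M') (hM₁ : UMat L M₁ M₁') :
    UMat L (fun v => M v * M₁ v) (fun v => M' v * M₁' v) := fun i j => by
  simp only [Matrix.mul_apply]
  exact UFun.sum Finset.univ fun k => (hM i k).mul (hM₁ k j)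

lemma UMat.sub (hM : UMat L M M') (hM₁ : UMat L M₁ M₁') :
    UMat L (fun v => M v - M₁ v) (fun v => M' v - M₁' v) := fun i j => (hM i j).sub (hM₁ i j)

lemma UMat.one : UMat L (fun _ : α → K => (1 : Matrix (Fin n) (Fin n) K))
    (fun _ : α → K' => (1 : Matrix (Fin n) (Fin n) K')) := fun i j => by
  simp only [Matrix.one_apply]
  split_ifs
  · exact UFun.one
  · exact UFun.zero

lemma UMat.prod_ofFn {m : ℕ} {M : Fin m → (α → K) → Matrix (Fin n) (Fin n) K}
    {M' : Fin m → (α → K') → Matrix (Fin n) (Fin n) K'} (h : ∀ l, UMat L (M l) (M' l)) :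
    UMat L (fun v => (List.ofFn fun l => M l v).prod) (fun v => (List.ofFn fun l => M' l v).prod) := by
  induction m with
  | zero => simpa using UMat.one
  | succ m ih =>
    simp only [List.ofFn_succ, List.prod_cons]
    exact (h 0).mul (ih fun l => h l.succ)

lemma UMat.isLUB (hM : UMat L M M') : UDef L
      (fun w : α ⊕ Unit → K => IsLUB {r | ∃ x : Fin n → K, LipStrat.vnorm x = 1 ∧
        r = LipStrat.vnorm ((M (w ∘ Sum.inl)).mulVec x)} (w (Sum.inr ())))
      (fun w : α ⊕ Unit → K' => IsLUB {r | ∃ x : Fin n → K', LipStrat.vnorm x = 1 ∧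
        r = LipStrat.vnorm ((M' (w ∘ Sum.inl)).mulVec x)} (w (Sum.inr ()))) := by
    have hub : UDef L
      (fun w : α ⊕ Unit → K => ∀ x : Fin n → K, LipStrat.vnorm x = 1 →
        LipStrat.vnorm ((M (w ∘ Sum.inl)).mulVec x) ≤ w (Sum.inr ()))
      (fun w : α ⊕ Unit → K' => ∀ x : Fin n → K', LipStrat.vnorm x = 1 →
        LipStrat.vnorm ((M' (w ∘ Sum.inl)).mulVec x) ≤ w (Sum.inr ())) := by
      refine UDef.all (((UVec.var _).vnorm.eq UFun.one).imp ?_)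
      exact UFun.le (((hM.relabel Sum.inl).relabel Sum.inl).mulVec (UVec.var _)).vnorm (UFun.var _)
    have : UDef L
      (fun w : α ⊕ Unit → K => (∀ x : Fin n → K, LipStrat.vnorm x = 1 →
        LipStrat.vnorm ((M (w ∘ Sum.inl)).mulVec x) ≤ w (Sum.inr ())) ∧
        ∀ t, (∀ x : Fin n → K, LipStrat.vnorm x = 1 →
        LipStrat.vnorm ((M (w ∘ Sum.inl)).mulVec x) ≤ t) → w (Sum.inr ()) ≤ t)
      (fun w : α ⊕ Unit → K' => (∀ x : Fin n → K', LipStrat.vnorm x = 1 →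
        LipStrat.vnorm ((M' (w ∘ Sum.inl)).mulVec x) ≤ w (Sum.inr ())) ∧
        ∀ t, (∀ x : Fin n → K', LipStrat.vnorm x = 1 →
        LipStrat.vnorm ((M' (w ∘ Sum.inl)).mulVec x) ≤ t) → w (Sum.inr ()) ≤ t) := by
      refine hub.and (UDef.all₁ (UDef.imp ?_ ((UFun.var _).le (UFun.var _))))
      exact hub.relabel (Sum.map Sum.inl id)
    refine this.congr (fun w => and_congr ?_ (forall_congr' fun t => imp_congr ?_ Iff.rfl))
      (fun w => and_congr ?_ (forall_congr' fun t => imp_congr ?_ Iff.rfl))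
    all_goals
      exact ⟨fun h r => by rintro ⟨x, hx, rfl⟩; exact h x hx, fun h x hx => h ⟨x, hx, rfl⟩⟩

lemma UMat.opNorm (hM : UMat L M M') : UFun L (fun v => opNorm (M v)) (fun v => opNorm (M' v)) := by
  refine UFun.of_graph (hM.isLUB.or (UDef.and (UDef.ex₁ ?_).not ((UFun.var (Sum.inr ())).eq UFun.zero)))
    (fun w => (eq_opNorm_iff _ _).symm) (fun w => (eq_opNorm_iff _ _).symm)
  exact hM.isLUB.relabel (Sum.map Sum.inl id)

end Field

/-- In `K ^ n`, elements of a span are linear combinations of at most `n` generators. -/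
lemma mem_span_iff_exists_fin {F : Type*} [Field F] {n : ℕ} (s : Set (Fin n → F)) (x : Fin n → F) :
    x ∈ Submodule.span F s ↔ ∃ c : Fin n → F, ∃ g : Fin n → Fin n → F,
      (∀ l, ¬ c l = 0 → g l ∈ s) ∧ ∀ i, x i = ∑ l, c l * g l i := by
  constructor
  · intro hx
    obtain ⟨b, hbs, hspan, hb⟩ := exists_linearIndependent F s
    rw [← hspan] at hx
    have hfin : Finite b := hb.finite
    have : Fintype b := Fintype.ofFinite b
    have hcard : Fintype.card b ≤ Fintype.card (Fin n) := by
      simpa using hb.fintype_card_le_finrank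
    obtain ⟨e⟩ := Function.Embedding.nonempty_of_card_le hcard
    rw [← Subtype.range_coe (s := b)] at hx
    obtain ⟨c, hc⟩ := (Submodule.mem_span_range_iff_exists_fun F).1 hx
    refine ⟨Function.extend e c 0, Function.extend e (fun y : b => y.1) 0, fun l hl => ?_, fun i => ?_⟩
    · by_cases h : ∃ y, e y = l
      · obtain ⟨y, rfl⟩ := h
        rw [e.injective.extend_apply]
        exact hbs y.2
      · exact absurd (Function.extend_apply' c (0 : Fin n → F) l h) hl
    · rw [← hc, Finset.sum_apply]
      refine Finset.sum_of_injOn e e.injective.injOn (fun _ _ => Finset.mem_univ _)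
        (fun l _ hl => ?_) (fun y _ => ?_)
      · rw [Function.extend_apply' c (0 : Fin n → F) l fun ⟨y, hy⟩ => hl ⟨y, by simp, hy⟩]
        simp
      · rw [e.injective.extend_apply, e.injective.extend_apply]
        rfl
  · rintro ⟨c, g, hg, hx⟩
    have : x = ∑ l, c l • g l := by
      funext i
      rw [hx, Finset.sum_apply]
      rfl
    rw [this]
    refine Submodule.sum_mem _ fun l _ => ?_
    by_cases hl : c l = 0
    · rw [hl, zero_smul]
      exact Submodule.zero_mem _
    · exact Submodule.smul_mem _ _ (Submodule.subset_span (hg l hl))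

/-! ### Uniform definability of functions with values in `K ∪ {∞}` -/

section Top

variable {L : FirstOrder.Language.{u₁, u₂}} {K : Type v₁} {K' : Type v₂}
  [Field K] [LinearOrder K] [IsStrictOrderedRing K] [HasSqrt K] [L.Structure K]
  [Field K'] [LinearOrder K'] [IsStrictOrderedRing K'] [HasSqrt K'] [L.Structure K']
  {α β : Type} [UniformRing L K K']

variable (L) in
/-- Uniformly definable functions with values in `K ∪ {∞}`. -/
structure UTop (D : (α → K) → WithTop K) (D' : (α → K') → WithTop K') : Prop where
  top : UDef L (fun v => D v = ⊤) (fun v => D' v = ⊤)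
  graph : UDef L (fun w : α ⊕ Unit → K => D (w ∘ Sum.inl) = (w (Sum.inr ()) : K))
    (fun w : α ⊕ Unit → K' => D' (w ∘ Sum.inl) = (w (Sum.inr ()) : K'))

variable {D E : (α → K) → WithTop K} {D' E' : (α → K') → WithTop K'}
  {f : (α → K) → K} {f' : (α → K') → K'}

lemma UTop.coe (hf : UFun L f f') : UTop L (fun v => (f v : WithTop K)) (fun v => (f' v : WithTop K')) :=
  ⟨(UDef.const False).congr (fun v => by simp) (fun v => by simp),
    UDef.congr hf (fun w => by rw [WithTop.coe_inj, eq_comm]) (fun w => by rw [WithTop.coe_inj, eq_comm])⟩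

lemma coe_lt_iff_exists {F : Type*} [LinearOrder F] (x y : WithTop F) :
    (∃ r : F, x = r ∧ (y = ⊤ ∨ ∃ s : F, y = s ∧ r < s)) ↔ x < y := by
  constructor
  · rintro ⟨r, rfl, rfl | ⟨s, rfl, h⟩⟩
    · exact WithTop.coe_lt_top r
    · exact WithTop.coe_lt_coe.2 h
  · intro h
    obtain ⟨r, rfl⟩ := WithTop.ne_top_iff_exists.1 h.ne_top
    refine ⟨r, rfl, ?_⟩
    by_cases hy : y = ⊤
    · exact Or.inl hy
    · obtain ⟨s, rfl⟩ := WithTop.ne_top_iff_exists.1 hy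
      exact Or.inr ⟨s, rfl, WithTop.coe_lt_coe.1 h⟩

lemma UTop.lt (hD : UTop L D D') (hE : UTop L E E') :
    UDef L (fun v => D v < E v) (fun v => D' v < E' v) := by
  refine UDef.congr (UDef.ex₁ (hD.graph.and ((hE.top.relabel Sum.inl).or (UDef.ex₁
    (UDef.and ?_ ((UFun.var (Sum.inl (Sum.inr ()))).lt (UFun.var (Sum.inr ()))))))))
    (fun v => coe_lt_iff_exists _ _) (fun v => coe_lt_iff_exists _ _)
  exact hE.graph.relabel (Sum.map Sum.inl id)

lemma UTop.le (hD : UTop L D D') (hE : UTop L E E') :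
    UDef L (fun v => D v ≤ E v) (fun v => D' v ≤ E' v) :=
  (hE.lt hD).not.congr (fun v => not_lt) (fun v => not_lt)

lemma coe_mul_eq_top_iff {F : Type*} [Field F] [LinearOrder F] (c : F) (x : WithTop F) :
    (¬ c = 0 ∧ x = ⊤) ↔ (c : WithTop F) * x = ⊤ := by
  rw [WithTop.mul_eq_top_iff]
  simp

/-- The second alternative accounts for the convention `0 * ⊤ = 0`. -/
lemma coe_mul_eq_coe_iff {F : Type*} [Field F] [LinearOrder F] (c s : F) (x : WithTop F) :
    ((∃ r : F, x = r ∧ s = c * r) ∨ (c = 0 ∧ x = ⊤ ∧ s = 0)) ↔ (c : WithTop F) * x = s := by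
  induction x using WithTop.recTopCoe with
  | top =>
    by_cases hc : c = 0
    · subst hc
      simp [eq_comm (a := s)]
    · rw [WithTop.mul_top (by simpa using hc)]
      simp [hc]
  | coe r =>
    rw [← WithTop.coe_mul, WithTop.coe_inj]
    simp [eq_comm (a := s)]

lemma UTop.mul (hf : UFun L f f') (hD : UTop L D D') :
    UTop L (fun v => (f v : WithTop K) * D v) (fun v => (f' v : WithTop K') * D' v) := by
  refine ⟨((hf.eq UFun.zero).not.and hD.top).congr (fun v => coe_mul_eq_top_iff _ _)
    (fun v => coe_mul_eq_top_iff _ _), ?_⟩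
  refine UDef.congr ?_ (fun v => coe_mul_eq_coe_iff _ _ _) (fun v => coe_mul_eq_coe_iff _ _ _)
  refine UDef.or (UDef.ex₁ (UDef.and (hD.graph.relabel (Sum.map Sum.inl id))
    ((UFun.var (Sum.inl (Sum.inr ()))).eq
      (((hf.relabel Sum.inl).relabel Sum.inl).mul (UFun.var (Sum.inr ()))))))
    (((hf.relabel Sum.inl).eq UFun.zero).and ((hD.top.relabel Sum.inl).and
      ((UFun.var (Sum.inr ())).eq UFun.zero)))

/-! ### Sets -/

variable {n d N : ℕ}

variable (L) in
/-- Uniformly definable families of subsets of `K ^ n`. -/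
def USet (Y : (α → K) → Set (Fin n → K)) (Y' : (α → K') → Set (Fin n → K')) : Prop :=
  UDef L (fun w : α ⊕ Fin n → K => w ∘ Sum.inr ∈ Y (w ∘ Sum.inl))
    (fun w : α ⊕ Fin n → K' => w ∘ Sum.inr ∈ Y' (w ∘ Sum.inl))

variable {Y Z : (α → K) → Set (Fin n → K)} {Y' Z' : (α → K') → Set (Fin n → K')}
  {x y : (α → K) → Fin n → K} {x' y' : (α → K') → Fin n → K'}
  {M M₁ : (α → K) → Matrix (Fin n) (Fin n) K} {M' M₁' : (α → K') → Matrix (Fin n) (Fin n) K'}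

lemma USet.relabel (h : USet L Y Y') (g : α → β) :
    USet L (fun v : β → K => Y (v ∘ g)) (fun v : β → K' => Y' (v ∘ g)) :=
  UDef.relabel (Sum.map g id) h

lemma USet.diff (h : USet L Y Y') (h' : USet L Z Z') :
    USet L (fun v => Y v \ Z v) (fun v => Y' v \ Z' v) :=
  UDef.and h (UDef.not h')

lemma USet.empty : USet L (fun _ : α → K => (∅ : Set (Fin n → K))) (fun _ : α → K' => ∅) :=
  (UDef.const False).congr (fun v => by simp) (fun v => by simp)

lemma UVec.eq (hx : UVec L x x') (hy : UVec L y y') :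
    UDef L (fun v => x v = y v) (fun v => x' v = y' v) :=
  (UDef.forallFinite fun i => (hx i).eq (hy i)).congr (fun v => funext_iff.symm)
    (fun v => funext_iff.symm)

lemma USet.mem (hY : USet L Y Y') (hx : UVec L x x') :
    UDef L (fun v => x v ∈ Y v) (fun v => x' v ∈ Y' v) := by
  refine UDef.congr ?_ (fun v => exists_eq_left (a' := x v) (p := fun z => z ∈ Y v))
    (fun v => exists_eq_left (a' := x' v) (p := fun z => z ∈ Y' v))
  exact UDef.ex (β := Fin n) (((UVec.var Sum.inr).eq (hx.relabel Sum.inl)).and hY)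

lemma isGLB_vnorm_iff {F : Type*} [Field F] [LinearOrder F] (a : Fin n → F) (s : Set (Fin n → F)) (r : F) :
    ((∀ z : Fin n → F, z ∈ s → r ≤ vnorm (a - z)) ∧
      ∀ t, (∀ z : Fin n → F, z ∈ s → t ≤ vnorm (a - z)) → t ≤ r) ↔
      IsGLB ((fun z => vnorm (a - z)) '' s) r := by
  refine and_congr ?_ (forall_congr' fun t => imp_congr ?_ Iff.rfl)
  all_goals
    exact ⟨fun h r => by rintro ⟨z, hz, rfl⟩; exact h z hz, fun h z hz => h ⟨z, hz, rfl⟩⟩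

lemma USet.isGLB (hY : USet L Y Y') (hx : UVec L x x') :
    UDef L (fun w : α ⊕ Unit → K => IsGLB ((fun z => vnorm (x (w ∘ Sum.inl) - z)) '' Y (w ∘ Sum.inl))
        (w (Sum.inr ())))
      (fun w : α ⊕ Unit → K' => IsGLB ((fun z => vnorm (x' (w ∘ Sum.inl) - z)) '' Y' (w ∘ Sum.inl))
        (w (Sum.inr ()))) := by
  have hlb : UDef L
      (fun w : α ⊕ Unit → K => ∀ z : Fin n → K, z ∈ Y (w ∘ Sum.inl) →
        w (Sum.inr ()) ≤ LipStrat.vnorm (x (w ∘ Sum.inl) - z))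
      (fun w : α ⊕ Unit → K' => ∀ z : Fin n → K', z ∈ Y' (w ∘ Sum.inl) →
        w (Sum.inr ()) ≤ LipStrat.vnorm (x' (w ∘ Sum.inl) - z)) :=
    UDef.all ((((hY.relabel Sum.inl).relabel Sum.inl).mem (UVec.var _)).imp
      ((UFun.var (Sum.inl (Sum.inr ()))).le
        (((hx.relabel Sum.inl).relabel Sum.inl).sub (UVec.var _)).vnorm))
  refine UDef.congr ?_ (fun w => isGLB_vnorm_iff _ _ _) (fun w => isGLB_vnorm_iff _ _ _)
  exact hlb.and (UDef.all₁ (UDef.imp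
    (hlb.relabel (Sum.map Sum.inl id : α ⊕ Unit → (α ⊕ Unit) ⊕ Unit))
    ((UFun.var (Sum.inr ())).le (UFun.var (Sum.inl (Sum.inr ()))))))

lemma setDist_eq_top_iff {F : Type*} [Field F] [LinearOrder F] (a : Fin n → F) (s : Set (Fin n → F)) :
    (¬ ∃ r, IsGLB ((fun z => vnorm (a - z)) '' s) r) ↔ setDist a s = ⊤ := by
  rw [← not_iff_not, not_not, ← ne_eq, WithTop.ne_top_iff_exists]
  exact exists_congr fun r => by rw [eq_comm, setDist_eq_coe_iff]

lemma USet.setDist (hY : USet L Y Y') (hx : UVec L x x') :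
    UTop L (fun v => setDist (x v) (Y v)) (fun v => setDist (x' v) (Y' v)) := by
  refine ⟨UDef.congr (UDef.ex₁ (hY.isGLB hx)).not (fun v => setDist_eq_top_iff _ _)
    (fun v => setDist_eq_top_iff _ _), UDef.congr (hY.isGLB hx) (fun w => ?_) (fun w => ?_)⟩
  · exact (setDist_eq_coe_iff _ _ _).symm
  · exact (setDist_eq_coe_iff _ _ _).symm

lemma USet.span (hY : USet L Y Y') :
    USet L (fun v => (Submodule.span K (Y v) : Set (Fin n → K)))
      (fun v => (Submodule.span K' (Y' v) : Set (Fin n → K'))) := by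
  refine UDef.congr ?_ (fun w => (mem_span_iff_exists_fin _ _).symm)
    (fun w => (mem_span_iff_exists_fin _ _).symm)
  exact (UDef.ex (β := Fin n) (UDef.ex₂ (β := Fin n) (γ := Fin n) (UDef.and
    (UDef.forallFinite fun l => UDef.imp (UDef.not ((UFun.var (Sum.inl (Sum.inr l))).eq UFun.zero))
      ((((hY.relabel Sum.inl).relabel Sum.inl).relabel Sum.inl).mem
        (UVec.var fun i => Sum.inr (l, i))))
    (UDef.forallFinite fun i => (UFun.var (Sum.inl (Sum.inl (Sum.inr i)))).eq
      (UFun.sum Finset.univ fun l => (UFun.var (Sum.inl (Sum.inr l))).mul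
        (UFun.var (Sum.inr (l, i))))))))

lemma USet.tangentSpace (hY : USet L Y Y') (hx : UVec L x x') :
    USet L (fun v => (tangentSpace (Y v) (x v) : Set (Fin n → K)))
      (fun v => (tangentSpace (Y' v) (x' v) : Set (Fin n → K'))) := by
  refine USet.span ?_
  refine UDef.all₁ (UDef.imp (UFun.zero.lt (UFun.var (Sum.inr ()))) (UDef.ex (β := Fin n) (UDef.and
    ((((hY.relabel Sum.inl).relabel Sum.inl).relabel Sum.inl).mem (UVec.var Sum.inr))
    (UDef.ex₁ (UDef.and (UFun.zero.lt (UFun.var (Sum.inr ()))) (UDef.and ?_ ?_))))))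
  · exact ((UVec.var fun i => Sum.inl (Sum.inr i)).sub
      ((((hx.relabel Sum.inl).relabel Sum.inl).relabel Sum.inl).relabel Sum.inl)).vnorm.lt
      (UFun.var (Sum.inl (Sum.inl (Sum.inr ()))))
  · exact ((UVec.smul (UFun.var (Sum.inr ())) ((UVec.var fun i => Sum.inl (Sum.inr i)).sub
      ((((hx.relabel Sum.inl).relabel Sum.inl).relabel Sum.inl).relabel Sum.inl))).sub
      (UVec.var fun i => Sum.inl (Sum.inl (Sum.inl (Sum.inr i))))).vnorm.lt
      (UFun.var (Sum.inl (Sum.inl (Sum.inr ()))))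

variable {T : (α → K) → Submodule K (Fin n → K)} {T' : (α → K') → Submodule K' (Fin n → K')}

lemma UMat.isOrthProj (hM : UMat L M M')
    (hT : USet L (fun v => (T v : Set (Fin n → K))) (fun v => (T' v : Set (Fin n → K')))) :
    UDef L (fun v => IsOrthProj (T v) (M v)) (fun v => IsOrthProj (T' v) (M' v)) := by
  refine UDef.all (UDef.and (USet.mem (hT.relabel Sum.inl)
    ((hM.relabel Sum.inl).mulVec (UVec.var Sum.inr)))
    (UDef.all (UDef.imp (USet.mem ((hT.relabel Sum.inl).relabel Sum.inl) (UVec.var Sum.inr))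
      (UFun.eq (UVec.dotProduct (UVec.var Sum.inr) ((UVec.var fun i => Sum.inl (Sum.inr i)).sub
        (((hM.relabel Sum.inl).relabel Sum.inl).mulVec (UVec.var fun i => Sum.inl (Sum.inr i)))))
        UFun.zero))))

lemma eq_orthProj_apply_iff {F : Type*} [Field F] [LinearOrder F] [IsStrictOrderedRing F] [HasSqrt F]
    (T : Submodule F (Fin n → F)) (i j : Fin n) (t : F) :
    (∃ P : Fin n → Fin n → F, (IsOrthProj T (P : Matrix (Fin n) (Fin n) F) ∨
      (¬ ∃ R : Fin n → Fin n → F, IsOrthProj T (R : Matrix (Fin n) (Fin n) F)) ∧ ∀ k l, P k l = 0) ∧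
      t = P i j) ↔ t = orthProj T i j := by
  have : ∀ P : Matrix (Fin n) (Fin n) F, (IsOrthProj T P ∨ (¬ ∃ R, IsOrthProj T R) ∧ ∀ k l, P k l = 0) ↔
      P = orthProj T := fun P => by
    rw [eq_orthProj_iff]
    exact or_congr Iff.rfl (and_congr Iff.rfl ⟨fun h => Matrix.ext h, fun h k l => by rw [h]; rfl⟩)
  constructor
  · rintro ⟨P, hP, rfl⟩
    rw [(this P).1 hP]
  · rintro rfl
    exact ⟨orthProj T, (this _).2 rfl, rfl⟩

lemma USet.orthProj (hT : USet L (fun v => (T v : Set (Fin n → K))) (fun v => (T' v : Set (Fin n → K')))) :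
    UMat L (fun v => orthProj (T v)) (fun v => orthProj (T' v)) := by
  intro i j
  refine UFun.of_graph ?_ (fun w => eq_orthProj_apply_iff _ _ _ _)
    (fun w => eq_orthProj_apply_iff _ _ _ _)
  exact (UDef.ex₂ (β := Fin n) (γ := Fin n) (UDef.and (UDef.or
    (UMat.isOrthProj (fun k l => UFun.var (Sum.inr (k, l))) ((hT.relabel Sum.inl).relabel Sum.inl))
    (UDef.and (UDef.not (UDef.ex₂ (β := Fin n) (γ := Fin n)
      (UMat.isOrthProj (fun k l => UFun.var (Sum.inr (k, l)))
        (((hT.relabel Sum.inl).relabel Sum.inl).relabel Sum.inl))))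
      (UDef.forallFinite fun k => UDef.forallFinite fun l =>
        UFun.eq (UFun.var (Sum.inr (k, l))) UFun.zero)))
    (UFun.eq (UFun.var (Sum.inl (Sum.inr ()))) (UFun.var (Sum.inr (i, j))))))

/-! ### Chains and the Mostowski conditions -/

variable {X : (α → K) → Fin (d + 1) → Set (Fin n → K)} {X' : (α → K') → Fin (d + 1) → Set (Fin n → K')}
  {c c₁ C₁ C₂ C₃ : (α → K) → K} {c' c₁' C₁' C₂' C₃' : (α → K') → K'}

variable (L) in
/-- Uniformly definable families of filtrations. -/
def UFilt (X : (α → K) → Fin (d + 1) → Set (Fin n → K))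
    (X' : (α → K') → Fin (d + 1) → Set (Fin n → K')) : Prop :=
  ∀ i, USet L (fun v => X v i) (fun v => X' v i)

lemma UFilt.relabel (hX : UFilt L X X') (g : α → β) :
    UFilt L (fun v : β → K => X (v ∘ g)) (fun v : β → K' => X' (v ∘ g)) :=
  fun i => (hX i).relabel g

lemma UFilt.prev (hX : UFilt L X X') (i : Fin (d + 1)) :
    USet L (fun v => prev (X v) i) (fun v => prev (X' v) i) := by
  cases i using Fin.cases with
  | zero => exact USet.empty
  | succ j => exact hX _

lemma UFilt.skel (hX : UFilt L X X') (i : Fin (d + 1)) :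
    USet L (fun v => skel (X v) i) (fun v => skel (X' v) i) :=
  (hX i).diff (hX.prev i)

lemma UFilt.proj (hX : UFilt L X X') (i : Fin (d + 1)) (hx : UVec L x x') :
    UMat L (fun v => proj (X v) i (x v)) (fun v => proj (X' v) i (x' v)) :=
  ((hX.skel i).tangentSpace hx).orthProj

lemma UFilt.tailProd (hX : UFilt L X X') {m : ℕ} (e : Fin (m + 1) → Fin (d + 1))
    {a : (α → K) → Fin (m + 1) → Fin n → K} {a' : (α → K') → Fin (m + 1) → Fin n → K'}
    (ha : ∀ l, UVec L (fun v => a v l) (fun v => a' v l)) :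
    UMat L (fun v => tailProd (X v) e (a v)) (fun v => tailProd (X' v) e (a' v)) :=
  UMat.prod_ofFn fun l => hX.proj _ (ha _)

lemma UFilt.isPlainChain (hX : UFilt L X X') {m : ℕ} (e : Fin (m + 1) → Fin (d + 1))
    {a : (α → K) → Fin (m + 1) → Fin n → K} {a' : (α → K') → Fin (m + 1) → Fin n → K'}
    (ha : ∀ l, UVec L (fun v => a v l) (fun v => a' v l)) (hc : UFun L c c') (hc₁ : UFun L c₁ c₁')
    (hC₁ : UFun L C₁ C₁') :
    UDef L (fun v => IsPlainChain (X v) (c v) (c₁ v) (C₁ v) e (a v))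
      (fun v => IsPlainChain (X' v) (c' v) (c₁' v) (C₁' v) e (a' v)) := by
  refine UDef.congr ((UDef.forallFinite fun l => (hX.skel (e l)).mem (ha l)).and
    ((UDef.const (StrictAnti e)).and ((UDef.forallFinite fun l : Fin m =>
      (UTop.coe ((ha 0).sub (ha l.succ)).vnorm).lt (UTop.mul hc ((hX (e l.succ)).setDist (ha 0)))).and
    ((UDef.forallFinite fun i => (UDef.const (e (Fin.last m) ≤ i)).imp ((UDef.const (i < e 0)).imp
      ((UDef.const (∃ l : Fin m, i = e l.succ)).imp
        ((UTop.mul hC₁ ((hX i).setDist (ha 0))).le ((hX.prev i).setDist (ha 0)))))).and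
    (UDef.forallFinite fun i => (UDef.const (e (Fin.last m) ≤ i)).imp ((UDef.const (i < e 0)).imp
      ((UDef.const (¬ ∃ l : Fin m, i = e l.succ)).imp
        (((hX.prev i).setDist (ha 0)).lt (UTop.mul hc₁ ((hX i).setDist (ha 0)))))))))))
    (fun v => ?_) (fun v => ?_)
  all_goals
    exact ⟨fun ⟨h1, h2, h3, h4, h5⟩ => ⟨h1, h2, h3, h4, h5⟩, fun ⟨h1, h2, h3, h4, h5⟩ => ⟨h1, h2, h3, h4, h5⟩⟩

lemma UMat.mostBound (hM : UMat L M M') (hC : UFun L c c') (hr : UFun L f f') (hD : UTop L D D') :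
    UDef L (fun v => MostBound (M v) (c v) (f v) (D v))
      (fun v => MostBound (M' v) (c' v) (f' v) (D' v)) :=
  (hD.top.imp (hM.opNorm.eq UFun.zero)).and (UDef.all₁ (hD.graph.imp
    (UFun.lt (hM.relabel Sum.inl).opNorm
      (((hC.relabel Sum.inl).mul (hr.relabel Sum.inl)).div (UFun.var (Sum.inr ()))))))

/-- The levels of a chain are distinct elements of `Fin (d + 1)`. This bounds the lengths that a
formula has to treat. -/
lemma IsPlainChain.le {F : Type*} [Field F] [LinearOrder F] {X : Fin (d + 1) → Set (Fin n → F)}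
    {c c' C' : F} {m : ℕ} {e : Fin (m + 1) → Fin (d + 1)} {a : Fin (m + 1) → Fin n → F}
    (h : IsPlainChain X c c' C' e a) : m ≤ d := by
  have := Fintype.card_le_of_injective e h.anti.injective
  simpa using this

lemma mostowski_iff {F : Type*} [Field F] [LinearOrder F] (X : Fin (d + 1) → Set (Fin n → F))
    (c c' C' C'' C''' : F) :
    ((∀ (m : ℕ) (e : Fin (m + 2) → Fin (d + 1)) (a : Fin (m + 2) → Fin n → F),
      IsPlainChain X c c' C' e a →
      MostBound ((1 - proj X (e 0) (a 0)) * tailProd X e a) C''' (vnorm (a 0 - a 1))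
        (setDist (a 0) (prev X (e (Fin.last (m + 1)))))) ∧
    ∀ (m : ℕ) (e : Fin (m + 1) → Fin (d + 1)) (a : Fin (m + 1) → Fin n → F) (b : Fin n → F),
      IsPlainChain X c c' C' e a → b ∈ skel X (e 0) → ¬ b = a 0 →
      (C'' : WithTop F) * ((vnorm (a 0 - b) : F) : WithTop F) ≤ setDist (a 0) (prev X (e 0)) →
      MostBound ((proj X (e 0) (a 0) - proj X (e 0) b) * tailProd X e a) C''' (vnorm (a 0 - b))
        (setDist (a 0) (prev X (e (Fin.last m))))) ↔ Mostowski X c c' C' C'' C''' :=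
  ⟨fun ⟨h1, h2⟩ => ⟨h1, h2⟩, fun ⟨h1, h2⟩ => ⟨h1, h2⟩⟩

lemma UFilt.mostowski (hX : UFilt L X X') (hc : UFun L c c') (hc₁ : UFun L c₁ c₁')
    (hC₁ : UFun L C₁ C₁') (hC₂ : UFun L C₂ C₂') (hC₃ : UFun L C₃ C₃') :
    UDef L (fun v => Mostowski (X v) (c v) (c₁ v) (C₁ v) (C₂ v) (C₃ v))
      (fun v => Mostowski (X' v) (c' v) (c₁' v) (C₁' v) (C₂' v) (C₃' v)) := by
  refine UDef.congr ?_ (fun v => mostowski_iff _ _ _ _ _ _) (fun v => mostowski_iff _ _ _ _ _ _)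
  exact (UDef.and
    (UDef.forallNat d (fun m => UDef.forallFinite fun e : Fin (m + 2) → Fin (d + 1) =>
      UDef.all₂ (β := Fin (m + 2)) (γ := Fin n)
      (UDef.imp ((hX.relabel Sum.inl).isPlainChain e (fun l => UVec.var fun i => Sum.inr (l, i))
        (hc.relabel Sum.inl) (hc₁.relabel Sum.inl) (hC₁.relabel Sum.inl))
      (UMat.mostBound ((UMat.one.sub ((hX.relabel Sum.inl).proj _ (UVec.var fun i => Sum.inr (0, i)))).mul
        ((hX.relabel Sum.inl).tailProd e (fun l => UVec.var fun i => Sum.inr (l, i))))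
        (hC₃.relabel Sum.inl) (UVec.vnorm ((UVec.var fun i => Sum.inr (0, i)).sub
          (UVec.var fun i => Sum.inr (1, i))))
        (((hX.relabel Sum.inl).prev _).setDist (UVec.var fun i => Sum.inr (0, i))))))
      (fun m hm v e a ha => absurd (IsPlainChain.le ha) (by omega)) (fun m hm v e a ha => absurd (IsPlainChain.le ha) (by omega)))
    (UDef.forallNat (d + 1) (fun m => UDef.forallFinite fun e : Fin (m + 1) → Fin (d + 1) =>
      UDef.all₂ (β := Fin (m + 1)) (γ := Fin n) (UDef.all (β := Fin n)
      (UDef.imp (((hX.relabel Sum.inl).relabel Sum.inl).isPlainChain e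
        (fun l => UVec.var fun i => Sum.inl (Sum.inr (l, i)))
        ((hc.relabel Sum.inl).relabel Sum.inl) ((hc₁.relabel Sum.inl).relabel Sum.inl)
        ((hC₁.relabel Sum.inl).relabel Sum.inl))
      (UDef.imp ((((hX.relabel Sum.inl).relabel Sum.inl).skel _).mem (UVec.var Sum.inr))
      (UDef.imp (UDef.not (UVec.eq (UVec.var Sum.inr) (UVec.var fun i => Sum.inl (Sum.inr (0, i)))))
      (UDef.imp (UTop.le (UTop.mul ((hC₂.relabel Sum.inl).relabel Sum.inl) (UTop.coe (UVec.vnorm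
        ((UVec.var fun i => Sum.inl (Sum.inr (0, i))).sub (UVec.var Sum.inr)))))
        ((((hX.relabel Sum.inl).relabel Sum.inl).prev _).setDist
          (UVec.var fun i => Sum.inl (Sum.inr (0, i)))))
      (UMat.mostBound (((((hX.relabel Sum.inl).relabel Sum.inl).proj _
          (UVec.var fun i => Sum.inl (Sum.inr (0, i)))).sub
          (((hX.relabel Sum.inl).relabel Sum.inl).proj _ (UVec.var Sum.inr))).mul
        (((hX.relabel Sum.inl).relabel Sum.inl).tailProd e
          (fun l => UVec.var fun i => Sum.inl (Sum.inr (l, i)))))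
        ((hC₃.relabel Sum.inl).relabel Sum.inl)
        (UVec.vnorm ((UVec.var fun i => Sum.inl (Sum.inr (0, i))).sub (UVec.var Sum.inr)))
        ((((hX.relabel Sum.inl).relabel Sum.inl).prev _).setDist
          (UVec.var fun i => Sum.inl (Sum.inr (0, i)))))))))))
      (fun m hm v e a b ha => absurd (IsPlainChain.le ha) (by omega)) (fun m hm v e a b ha => absurd (IsPlainChain.le ha) (by omega))))

end Top

/-! ### Families given by formulas -/

section Family

variable {L : FirstOrder.Language.{u₁, u₂}} {K : Type v₁} {K' : Type v₂}
  [Field K] [LinearOrder K] [IsStrictOrderedRing K] [HasSqrt K] [L.Structure K]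
  [Field K'] [LinearOrder K'] [IsStrictOrderedRing K'] [HasSqrt K'] [L.Structure K']
  {α : Type} [UniformRing L K K'] {N n d : ℕ} (F : Family L N n d)

variable {q : (α → K) → Fin N → K} {q' : (α → K') → Fin N → K'}
  {c c₁ C₁ C₂ C₃ : (α → K) → K} {c' c₁' C₁' C₂' C₃' : (α → K') → K'}

lemma UFun.two : UFun L (fun _ : α → K => 2) (fun _ : α → K' => 2) := by
  simpa only [one_add_one_eq_two] using (UFun.one (L := L) (K := K) (K' := K') (α := α)).add UFun.one

lemma UFun.sq (hc : UFun L c c') : UFun L (fun v => c v ^ 2) (fun v => c' v ^ 2) := by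
  simpa only [pow_two] using hc.mul hc

lemma UTop.eq_coe {D : (α → K) → WithTop K} {D' : (α → K') → WithTop K'} (hD : UTop L D D')
    (hc : UFun L c c') : UDef L (fun v => D v = (c v : K)) (fun v => D' v = (c' v : K')) :=
  ((hD.le (UTop.coe hc)).and ((UTop.coe hc).le hD)).congr (fun v => le_antisymm_iff.symm)
    (fun v => le_antisymm_iff.symm)

lemma Family.uDef_mem (hq : UVec L q q') : UDef L (fun v => q v ∈ F.Q K) (fun v => q' v ∈ F.Q K') :=
  UDef.subst (β := Fin N) ⟨F.base, fun _ => Iff.rfl, fun _ => Iff.rfl⟩ hq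

lemma Family.uFilt (hq : UVec L q q') :
    UFilt L (fun v => F.fiber K (q v)) (fun v => F.fiber K' (q' v)) := fun i =>
  UDef.subst (β := Fin n ⊕ Fin N) (P := fun w => (F.strat i).Realize w)
    (P' := fun w => (F.strat i).Realize w) ⟨F.strat i, fun _ => Iff.rfl, fun _ => Iff.rfl⟩
    (f := fun w => Sum.elim (w ∘ Sum.inr) (q (w ∘ Sum.inl)))
    (f' := fun w => Sum.elim (w ∘ Sum.inr) (q' (w ∘ Sum.inl)))
    fun b => b.casesOn (fun k => UFun.var (Sum.inr k)) fun k => (hq k).relabel Sum.inl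

lemma Family.uDef_mostowski (hc : UFun L c c') (hc₁ : UFun L c₁ c₁')
    (hC₁ : UFun L C₁ C₁') (hC₂ : UFun L C₂ C₂') (hC₃ : UFun L C₃ C₃') :
    UDef L (fun v => ∀ q ∈ F.Q K, Mostowski (F.fiber K q) (c v) (c₁ v) (C₁ v) (C₂ v) (C₃ v))
      (fun v => ∀ q ∈ F.Q K', Mostowski (F.fiber K' q) (c' v) (c₁' v) (C₁' v) (C₂' v) (C₃' v)) :=
  UDef.all (β := Fin N) ((F.uDef_mem (UVec.var Sum.inr)).imp ((F.uFilt (UVec.var Sum.inr)).mostowski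
    (hc.relabel Sum.inl) (hc₁.relabel Sum.inl) (hC₁.relabel Sum.inl) (hC₂.relabel Sum.inl)
    (hC₃.relabel Sum.inl)))

lemma Family.uDef_mostowski₁ (hc : UFun L c c') (hC₁ : UFun L C₁ C₁') :
    UDef L (fun v => 0 < C₁ v ∧ ∀ q ∈ F.Q K,
        Mostowski (F.fiber K q) (c v) (2 * c v ^ 2) (2 * c v ^ 2) (2 * c v) (C₁ v))
      (fun v => 0 < C₁' v ∧ ∀ q ∈ F.Q K',
        Mostowski (F.fiber K' q) (c' v) (2 * c' v ^ 2) (2 * c' v ^ 2) (2 * c' v) (C₁' v)) :=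
  (UFun.zero.lt hC₁).and (F.uDef_mostowski hc (UFun.two.mul hc.sq) (UFun.two.mul hc.sq)
    (UFun.two.mul hc) hC₁)

lemma Family.uDef_mostowski₂ (hc : UFun L c c') (hC₁ : UFun L C₁ C₁') :
    UDef L (fun v => 0 < C₁ v ∧ ∀ q ∈ F.Q K,
        Mostowski (F.fiber K q) (c v) (c v) (C₁ v) (C₁ v) (C₁ v))
      (fun v => 0 < C₁' v ∧ ∀ q ∈ F.Q K',
        Mostowski (F.fiber K' q) (c' v) (c' v) (C₁' v) (C₁' v) (C₁' v)) :=
  (UFun.zero.lt hC₁).and (F.uDef_mostowski hc hc hC₁ hC₁ hC₁)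

lemma Family.uDef_mostowski₃ (hc : UFun L c c') (hC₁ : UFun L C₁ C₁') :
    UDef L (fun v => 0 < C₁ v ∧ ∀ q ∈ F.Q K,
        Mostowski (F.fiber K q) (c v) (c v) 1 (1 / c v) (C₁ v))
      (fun v => 0 < C₁' v ∧ ∀ q ∈ F.Q K',
        Mostowski (F.fiber K' q) (c' v) (c' v) 1 (1 / c' v) (C₁' v)) :=
  (UFun.zero.lt hC₁).and (F.uDef_mostowski hc hc UFun.one (UFun.one.div hc) hC₁)

lemma Family.uDef_unifLip1 : UDef L (fun _ : Empty → K => UnifLip1 (F.Q K) (F.fiber K))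
    (fun _ : Empty → K' => UnifLip1 (F.Q K') (F.fiber K')) :=
  UDef.all₁ (UDef.imp (UFun.zero.lt (UFun.var (Sum.inr ())))
    (UDef.ex₁ (F.uDef_mostowski₁ (UFun.var (Sum.inl (Sum.inr ()))) (UFun.var (Sum.inr ())))))

lemma Family.uDef_unifLip2 : UDef L (fun _ : Empty → K => UnifLip2 (F.Q K) (F.fiber K))
    (fun _ : Empty → K' => UnifLip2 (F.Q K') (F.fiber K')) :=
  UDef.all₁ (UDef.imp (UFun.zero.lt (UFun.var (Sum.inr ())))
    (UDef.ex₁ (F.uDef_mostowski₂ (UFun.var (Sum.inl (Sum.inr ()))) (UFun.var (Sum.inr ())))))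

lemma Family.uDef_unifLip3 : UDef L (fun _ : Empty → K => UnifLip3 (F.Q K) (F.fiber K))
    (fun _ : Empty → K' => UnifLip3 (F.Q K') (F.fiber K')) :=
  UDef.all₁ (UDef.imp (UFun.zero.lt (UFun.var (Sum.inr ())))
    (UDef.ex₁ (F.uDef_mostowski₃ (UFun.var (Sum.inl (Sum.inr ()))) (UFun.var (Sum.inr ())))))

lemma USet.exists_isGLB {Y : (α → K) → Set (Fin n → K)} {Y' : (α → K') → Set (Fin n → K')}
    (hY : USet L Y Y') : UDef L
    (fun w : α ⊕ Fin n → K => ∃ r : K, IsGLB ((fun x => vnorm (w ∘ Sum.inr - x)) '' Y (w ∘ Sum.inl)) r)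
    (fun w : α ⊕ Fin n → K' =>
      ∃ r : K', IsGLB ((fun x => vnorm (w ∘ Sum.inr - x)) '' Y' (w ∘ Sum.inl)) r) := by
  have h : USet L (fun w : α ⊕ Fin n → K => Y (w ∘ Sum.inl))
      (fun w : α ⊕ Fin n → K' => Y' (w ∘ Sum.inl)) := hY.relabel Sum.inl
  have hg := h.isGLB (UVec.var (L := L) (K := K) (K' := K') (Sum.inr : Fin n → α ⊕ Fin n))
  exact UDef.ex₁ hg

lemma USet.nonempty {Y : (α → K) → Set (Fin n → K)} {Y' : (α → K') → Set (Fin n → K')}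
    (hY : USet L Y Y') : UDef L (fun v => (Y v).Nonempty) (fun v => (Y' v).Nonempty) :=
  UDef.ex (β := Fin n) ((hY.relabel Sum.inl).mem (UVec.var Sum.inr))

lemma USet.hasDist {Y : (α → K) → Set (Fin n → K)} {Y' : (α → K') → Set (Fin n → K')}
    (hY : USet L Y Y') : UDef L (fun v => HasDist (Y v)) (fun v => HasDist (Y' v)) :=
  UDef.all (β := Fin n) (G := fun v a => (Y v).Nonempty →
      ∃ r : K, IsGLB ((fun x => vnorm (a - x)) '' Y v) r)
    (G' := fun v a => (Y' v).Nonempty → ∃ r : K', IsGLB ((fun x => vnorm (a - x)) '' Y' v) r)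
    ((hY.relabel Sum.inl).nonempty.imp hY.exists_isGLB)

lemma tame_iff {E : Type*} [Field E] [LinearOrder E] (X : Fin (d + 1) → Set (Fin n → E)) :
    ((∀ i j, i ≤ j → ∀ x : Fin n → E, x ∈ X i → x ∈ X j) ∧ (∀ i, HasDist (X i)) ∧
      ∀ i, ∀ a : Fin n → E, a ∈ X (Fin.last d) → ¬ a ∈ X i → ¬ setDist a (X i) = (0 : E)) ↔ Tame X :=
  ⟨fun ⟨h1, h2, h3⟩ => ⟨h1, h2, h3⟩, fun ⟨h1, h2, h3⟩ => ⟨h1, h2, h3⟩⟩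

/-- The extension `K'` carries no topology here, so its metric properties are not derived afresh:
they are first-order and are transferred from `K`. -/
lemma UFilt.tame {X : (α → K) → Fin (d + 1) → Set (Fin n → K)}
    {X' : (α → K') → Fin (d + 1) → Set (Fin n → K')} (hX : UFilt L X X') :
    UDef L (fun v => Tame (X v)) (fun v => Tame (X' v)) := by
  refine UDef.congr ?_ (fun v => tame_iff _) (fun v => tame_iff _)
  refine UDef.and ?_ (UDef.and (UDef.forallFinite fun i => (hX i).hasDist) ?_)
  · refine UDef.forallFinite fun i => UDef.forallFinite fun j => (UDef.const (i ≤ j)).imp ?_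
    exact UDef.all (β := Fin n) (UDef.imp (((hX i).relabel Sum.inl).mem (UVec.var Sum.inr))
      (((hX j).relabel Sum.inl).mem (UVec.var Sum.inr)))
  · refine UDef.forallFinite fun i => UDef.all (β := Fin n) (UDef.imp ?_ (UDef.imp ?_ ?_))
    · exact ((hX _).relabel Sum.inl).mem (UVec.var Sum.inr)
    · exact (((hX i).relabel Sum.inl).mem (UVec.var Sum.inr)).not
    · exact ((((hX i).relabel Sum.inl).setDist (UVec.var Sum.inr)).eq_coe UFun.zero).not

lemma Family.uDef_tame : UDef L (fun _ : Empty → K => ∀ q ∈ F.Q K, Tame (F.fiber K q))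
    (fun _ : Empty → K' => ∀ q ∈ F.Q K', Tame (F.fiber K' q)) :=
  UDef.all (β := Fin N) ((F.uDef_mem (UVec.var Sum.inr)).imp (F.uFilt (UVec.var Sum.inr)).tame)

lemma UMat.exists_isLUB {M : (α → K) → Matrix (Fin n) (Fin n) K} {M' : (α → K') → Matrix (Fin n) (Fin n) K'}
    (hM : UMat L M M') : UDef L
      (fun v => ∃ s : K, IsLUB {r | ∃ x : Fin n → K, vnorm x = 1 ∧ r = vnorm ((M v).mulVec x)} s)
      (fun v => ∃ s : K', IsLUB {r | ∃ x : Fin n → K', vnorm x = 1 ∧ r = vnorm ((M' v).mulVec x)} s) :=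
  UDef.ex₁ hM.isLUB

lemma uDef_hasOpNorm (n : ℕ) : UDef L (fun _ : Empty → K => HasOpNorm K n)
    (fun _ : Empty → K' => HasOpNorm K' n) := by
  have h : UMat L (n := n) (fun w : Empty ⊕ Fin n × Fin n → K => Matrix.of fun i j => w (Sum.inr (i, j)))
    (fun w : Empty ⊕ Fin n × Fin n → K' => Matrix.of fun i j => w (Sum.inr (i, j))) :=
    fun i j => UFun.var (Sum.inr (i, j))
  exact UDef.all₂ (β := Fin n) (γ := Fin n)
    (G := fun _ M => 0 < n → ∃ s : K, IsLUB {r | ∃ x : Fin n → K, vnorm x = 1 ∧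
      r = vnorm ((Matrix.of M).mulVec x)} s)
    (G' := fun _ M => 0 < n → ∃ s : K', IsLUB {r | ∃ x : Fin n → K', vnorm x = 1 ∧
      r = vnorm ((Matrix.of M).mulVec x)} s)
    ((UDef.const (0 < n)).imp h.exists_isLUB)

end Family

/-! ### Elementary embeddings -/

section Embedding

variable {L : FirstOrder.Language.{u₁, u₂}} {A : Type*} {K : Type v₁} {K' : Type v₂} {α : Type}
  [L.Structure A] [L.Structure K] [L.Structure K']

lemma UDef.map_iff {P : (α → K) → Prop} {P' : (α → K') → Prop} (h : UDef L P P') (j : K ↪ₑ[L] K')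
    (v : α → K) : P v ↔ P' (j ∘ v) := by
  obtain ⟨φ, hφ, hφ'⟩ := h
  rw [← hφ, ← hφ', j.map_formula]

lemma UDef.sentence_iff {p p' : Prop} (h : UDef L (fun _ : Empty → K => p) (fun _ : Empty → K' => p'))
    (j : K ↪ₑ[L] K') : p ↔ p' :=
  h.map_iff j Empty.elim

/-- Witnesses of definable properties can be found in elementary substructures. -/
lemma UDef.exists_range {P : (α ⊕ Unit → K) → Prop} (h : UDef L P P) (j : A ↪ₑ[L] K) (v : α → A)
    {y : K} (hy : P (Sum.elim (j ∘ v) fun _ => y)) : ∃ z : A, P (Sum.elim (j ∘ v) fun _ => j z) := by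
  obtain ⟨φ, hφ, -⟩ := h
  have h1 : (φ.iExs Unit).Realize (j ∘ v) :=
    Language.Formula.realize_iExs.2 ⟨fun _ => y, (hφ _).2 hy⟩
  obtain ⟨z, hz⟩ := Language.Formula.realize_iExs.1 ((j.map_formula _ _).1 h1)
  refine ⟨z (), (hφ _).1 ?_⟩
  have h2 := (j.map_formula _ _).2 hz
  rwa [Sum.comp_elim] at h2

end Embedding

/-! ### Consequences of o-minimality -/

section OMinimal

variable {L : FirstOrder.Language.{u₁, u₂}} {K : Type v₁} [L.Structure K] {α : Type}

/-- Taking the two structures equal turns the uniform calculus into ordinary definability, with `v`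
as parameters; this is the form to which o-minimality applies. -/
lemma UDef.definable₁ {P : (α ⊕ Unit → K) → Prop} (h : UDef L P P) (v : α → K) :
    (univ : Set K).Definable₁ L {y | P (Sum.elim v fun _ => y)} := by
  obtain ⟨φ, hφ, -⟩ := h
  refine Set.definable_iff_exists_formula_sum.2
    ⟨φ.relabel (Sum.map (fun a => (⟨v a, mem_univ _⟩ : (univ : Set K))) fun _ => 0), ?_⟩
  ext x
  simp only [mem_ofPred_eq, Language.Formula.realize_relabel]
  rw [hφ]
  have : (Sum.elim (fun a : (univ : Set K) => (a : K)) x) ∘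
      Sum.map (fun a => (⟨v a, mem_univ _⟩ : (univ : Set K))) (fun _ : Unit => (0 : Fin 1)) =
      Sum.elim v fun _ => x 0 := by
    funext b
    cases b <;> rfl
  rw [← hφ, ← hφ]
  exact iff_of_eq (congrArg φ.Realize this.symm)

variable [Field K] [LinearOrder K] [IsStrictOrderedRing K]

lemma exists_isGLB_sUnion {F : Set (Set K)} (hF : F.Finite)
    (h : ∀ t ∈ F, t.Nonempty → BddBelow t → ∃ r, IsGLB t r) (hne : (⋃₀ F).Nonempty)
    (hb : BddBelow (⋃₀ F)) : ∃ r, IsGLB (⋃₀ F) r := by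
  induction F, hF using Set.Finite.induction_on with
  | empty => simp at hne
  | @insert t F ht hF ih =>
    rw [sUnion_insert] at hne hb ⊢
    have ih' := ih fun t' ht' => h t' (mem_insert_of_mem _ ht')
    rcases t.eq_empty_or_nonempty with rfl | htn
    · rw [empty_union] at hne hb ⊢
      exact ih' hne hb
    obtain ⟨r, hr⟩ := h t (mem_insert _ _) htn (hb.mono subset_union_left)
    rcases (⋃₀ F).eq_empty_or_nonempty with hF0 | hFn
    · rw [hF0, union_empty]
      exact ⟨r, hr⟩
    · obtain ⟨r', hr'⟩ := ih' hFn (hb.mono subset_union_right)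
      exact ⟨_, hr.union hr'⟩

/-- The infimum of a finite union is the least of the infima of its non-empty pieces, and points and
intervals bounded below have infima. -/
lemma OMinimal.exists_isGLB (hK : OMinimal L K) {s : Set K} (hs : (univ : Set K).Definable₁ L s)
    (hne : s.Nonempty) (hb : BddBelow s) : ∃ r, IsGLB s r := by
  obtain ⟨F, hF, rfl, hFt⟩ := hK s hs
  refine exists_isGLB_sUnion hF (fun t ht htn htb => ?_) hne hb
  rcases hFt t ht with ⟨a, rfl⟩ | ⟨a, b, rfl⟩ | ⟨a, rfl⟩ | ⟨a, rfl⟩ | rfl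
  · exact ⟨a, isGLB_singleton⟩
  · exact ⟨a, isGLB_Ioo (nonempty_Ioo.1 htn)⟩
  · exact (not_bddBelow_Iio a htb).elim
  · exact ⟨a, isGLB_Ioi⟩
  · exact (not_bddBelow_univ htb).elim

variable [HasSqrt K] [UniformRing L K K] {N n d : ℕ}

lemma OMinimal.hasDist (hK : OMinimal L K) (F : Family L N n d) (q : Fin N → K) (i : Fin (d + 1)) :
    HasDist (F.fiber K q i) := by
  intro a hne
  have hU : UDef L
      (fun w : (Fin N ⊕ Fin n) ⊕ Unit → K => ∃ z : Fin n → K,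
        z ∈ F.fiber K (fun k => w (Sum.inl (Sum.inl k))) i ∧
        vnorm ((fun k => w (Sum.inl (Sum.inr k))) - z) = w (Sum.inr ()))
      (fun w : (Fin N ⊕ Fin n) ⊕ Unit → K => ∃ z : Fin n → K,
        z ∈ F.fiber K (fun k => w (Sum.inl (Sum.inl k))) i ∧
        vnorm ((fun k => w (Sum.inl (Sum.inr k))) - z) = w (Sum.inr ())) :=
    UDef.ex (β := Fin n) (UDef.and
      ((F.uFilt (UVec.var fun k => Sum.inl (Sum.inl (Sum.inl k))) i).mem (UVec.var Sum.inr))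
      (UFun.eq (UVec.vnorm (UVec.sub (UVec.var fun k => Sum.inl (Sum.inl (Sum.inr k)))
        (UVec.var Sum.inr))) (UFun.var (Sum.inl (Sum.inr ())))))
  exact hK.exists_isGLB (s := (fun x => vnorm (a - x)) '' F.fiber K q i)
    (hU.definable₁ (Sum.elim q a)) (hne.image _) ⟨0, by rintro _ ⟨x, -, rfl⟩; exact vnorm_nonneg _⟩

lemma vnorm_mulVec_le (M : Matrix (Fin n) (Fin n) K) {x : Fin n → K} (hx : vnorm x = 1) :
    vnorm (M.mulVec x) ≤ ∑ i, ∑ j, |M i j| := by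
  refine (vnorm_le_sum_abs _).trans (Finset.sum_le_sum fun i _ => ?_)
  rw [show M.mulVec x i = ∑ j, M i j * x j from rfl]
  refine (Finset.abs_sum_le_sum_abs (fun j => M i j * x j) _).trans (Finset.sum_le_sum fun j _ => ?_)
  rw [abs_mul]
  exact mul_le_of_le_one_right (abs_nonneg _) (hx ▸ abs_le_vnorm x j)

/-- The supremum is found as the infimum of the definable set of upper bounds, which is non-empty by
the sum of the entries and bounded below by the value at a standard unit vector. -/
lemma OMinimal.hasOpNorm (hK : OMinimal L K) (n : ℕ) : HasOpNorm K n := by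
  intro M hn
  have hU : UDef L
      (fun w : (Fin n × Fin n) ⊕ Unit → K => ∀ x : Fin n → K, vnorm x = 1 →
        vnorm ((Matrix.of fun i j => w (Sum.inl (i, j))).mulVec x) ≤ w (Sum.inr ()))
      (fun w : (Fin n × Fin n) ⊕ Unit → K => ∀ x : Fin n → K, vnorm x = 1 →
        vnorm ((Matrix.of fun i j => w (Sum.inl (i, j))).mulVec x) ≤ w (Sum.inr ())) :=
    UDef.all (β := Fin n) (UDef.imp ((UVec.var Sum.inr).vnorm.eq UFun.one)
      (UFun.le (UVec.vnorm (UMat.mulVec (fun i j => UFun.var (Sum.inl (Sum.inl (i, j))))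
        (UVec.var Sum.inr))) (UFun.var (Sum.inl (Sum.inr ())))))
  have hdef := hU.definable₁ fun p => M p.1 p.2
  have heq : {y : K | ∀ x : Fin n → K, vnorm x = 1 → vnorm (M.mulVec x) ≤ y} =
      upperBounds {r | ∃ x : Fin n → K, vnorm x = 1 ∧ r = vnorm (M.mulVec x)} := by
    ext y
    exact ⟨fun h r => by rintro ⟨x, hx, rfl⟩; exact h x hx, fun h x hx => h ⟨x, hx, rfl⟩⟩
  obtain ⟨s, hs⟩ := hK.exists_isGLB
    (s := {y : K | ∀ x : Fin n → K, vnorm x = 1 → vnorm (M.mulVec x) ≤ y}) hdef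
    ⟨_, fun x hx => vnorm_mulVec_le M hx⟩
    ⟨_, fun y hy => hy _ (vnorm_single ⟨0, hn⟩)⟩
  rw [heq, isGLB_upperBounds] at hs
  exact ⟨s, hs⟩

variable [TopologicalSpace K] [OrderTopology K]

lemma mem_closure_of_setDist_eq_zero {a : Fin n → K} {Y : Set (Fin n → K)}
    (h : setDist a Y = (0 : K)) : a ∈ closure Y := by
  rw [mem_closure_iff]
  intro o ho ha
  obtain ⟨u, hu, huo⟩ := isOpen_pi_iff'.1 ho a ha
  have hball : ∀ i, ∃ ε > 0, {b : K | |b - a i| < ε} ⊆ u i := fun i =>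
    (nhds_basis_abs_sub_lt (a i)).mem_iff.1 ((hu i).1.mem_nhds (hu i).2)
  choose ε hε hεu using hball
  -- A filter argument gives one radius for all coordinates, including the case of no coordinates.
  have hev : ∀ᶠ δ in nhdsWithin (0 : K) (Ioi 0), ∀ i, δ ∈ Ioo 0 (ε i) :=
    Filter.eventually_all.2 fun i => Ioo_mem_nhdsGT (hε i)
  obtain ⟨δ, hδ, hδ0⟩ := (hev.and self_mem_nhdsWithin).exists
  obtain ⟨x, hx, hlt⟩ := exists_vnorm_lt_of_setDist h (show (0 : K) < δ from hδ0)
  refine ⟨x, huo fun i _ => hεu i ?_, hx⟩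
  rw [mem_ofPred_eq, abs_sub_comm]
  exact ((abs_le_vnorm (a - x) i).trans_lt hlt).trans (hδ i).2

/-- Distances to a level vanish only on its closure, and levels are closed in the whole stratified
set. -/
lemma OMinimal.tame (hK : OMinimal L K) {F : Family L N n d} (hF : F.IsStratFamily K) :
    ∀ q ∈ F.Q K, Tame (F.fiber K q) := fun q hq =>
  ⟨(hF q hq).mono, fun i => hK.hasDist F q i, fun i a ha hai h0 =>
    hai ((hF q hq).closed i ⟨mem_closure_of_setDist_eq_zero h0, ha⟩)⟩

end OMinimal

/-! ### Equivalences by elementary transfer -/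

section Equivalences

variable {L : FirstOrder.Language.{u₁, u₂}} {A : Type*} {K : Type v₁} {K' : Type v₂}
  [L.Structure A]
  [Field K] [LinearOrder K] [IsStrictOrderedRing K] [HasSqrt K] [L.Structure K]
  [Field K'] [LinearOrder K'] [IsStrictOrderedRing K'] [HasSqrt K'] [L.Structure K']
  {N n d : ℕ} {F : Family L N n d}

section Valuative

variable [UniformRing L K K] {S : Subring K} (j : A ↪ₑ[L] K) (hS : ∀ x, x ∈ S ↔ ∃ a, j a = x)
  (hbig : ∃ x : K, ∀ s ∈ S, s < x) (hT : ∀ q ∈ F.Q K, Tame (F.fiber K q)) (hop : HasOpNorm K n)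
include hS hT hop

/-- For `c` in the substructure, being an admissible `C` uniformly in `q` is definable over `c`.
Hence an admissible `C` lies in the substructure and serves every `q ∈ Q`, including parameters
outside it. -/
lemma UnifLip2.isValLipschitz (h : UnifLip2 (F.Q K) (F.fiber K)) :
    ∀ q ∈ F.Q K, IsValLipschitz (convexClosure S) (F.fiber K q) := by
  intro q hq
  refine isValLipschitz_of_mostowski (hT q hq) hop fun c hc hc0 => ?_
  obtain ⟨a, rfl⟩ := (hS c).1 hc
  obtain ⟨C, hC⟩ := h _ hc0
  obtain ⟨z, hz0, hz⟩ := (F.uDef_mostowski₂ (α := Unit ⊕ Unit) (UFun.var (Sum.inl ()))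
    (UFun.var (Sum.inr ()))).exists_range j (fun _ => a) (y := C) hC
  exact ⟨j z, (hS _).2 ⟨z, rfl⟩, hz0, hz q hq⟩

include hbig

/-- The value `c = 2` is used: it exceeds `1` and lies in every subring. -/
lemma UnifLip1.isWeakValLipschitz (h : UnifLip1 (F.Q K) (F.fiber K)) :
    ∀ q ∈ F.Q K, IsWeakValLipschitz (convexClosure S) (F.fiber K q) := by
  intro q hq
  obtain ⟨a, ha⟩ := (hS 2).1 (two_mem S)
  obtain ⟨C, hC⟩ := h (j a) (ha ▸ two_pos)
  obtain ⟨z, hz0, hz⟩ := (F.uDef_mostowski₁ (α := Unit ⊕ Unit) (UFun.var (Sum.inl ()))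
    (UFun.var (Sum.inr ()))).exists_range j (fun _ => a) (y := C) hC
  exact weak_of_mostowski (hT q hq) hop hbig ((hS _).2 ⟨a, rfl⟩) (ha ▸ one_lt_two)
    ((hS _).2 ⟨z, rfl⟩) (hz q hq)

/-- A `c` without admissible `C` could be found in the substructure by elementarity. For such `c`,
however, any element of `K` above `S` is an admissible `C`. -/
lemma unifLip3_of_isWeakValLipschitz
    (h : ∀ q ∈ F.Q K, IsWeakValLipschitz (convexClosure S) (F.fiber K q)) :
    UnifLip3 (F.Q K) (F.fiber K) := by
  by_contra hc
  unfold UnifLip3 at hc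
  push Not at hc
  obtain ⟨c, hc0, hc⟩ := hc
  have hU : UDef L
      (fun w : Empty ⊕ Unit → K => 0 < w (Sum.inr ()) ∧ ¬ ∃ C, 0 < C ∧ ∀ q ∈ F.Q K,
        Mostowski (F.fiber K q) (w (Sum.inr ())) (w (Sum.inr ())) 1 (1 / w (Sum.inr ())) C)
      (fun w : Empty ⊕ Unit → K => 0 < w (Sum.inr ()) ∧ ¬ ∃ C, 0 < C ∧ ∀ q ∈ F.Q K,
        Mostowski (F.fiber K q) (w (Sum.inr ())) (w (Sum.inr ())) 1 (1 / w (Sum.inr ())) C) :=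
    (UFun.zero.lt (UFun.var _)).and (UDef.ex₁ (F.uDef_mostowski₃ (UFun.var (Sum.inl (Sum.inr ())))
      (UFun.var (Sum.inr ())))).not
  obtain ⟨a, ha0, ha⟩ := hU.exists_range j Empty.elim (y := c) ⟨hc0, fun ⟨C, hC0, hC⟩ => by
    obtain ⟨q, hq, hn⟩ := hc C hC0
    exact hn (hC q hq)⟩
  obtain ⟨C, hC⟩ := hbig
  exact ha ⟨C, hC 0 S.zero_mem, fun q hq =>
    mostowski_of_weak (hT q hq) hop ((hS _).2 ⟨a, rfl⟩) ha0 hC (h q hq)⟩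

/-- The equivalence of the uniform and the valuative conditions. -/
theorem unifLip_val_tfae :
    [UnifLip1 (F.Q K) (F.fiber K), UnifLip2 (F.Q K) (F.fiber K), UnifLip3 (F.Q K) (F.fiber K),
      ∀ q ∈ F.Q K, IsValLipschitz (convexClosure S) (F.fiber K q),
      ∀ q ∈ F.Q K, IsWeakValLipschitz (convexClosure S) (F.fiber K q)].TFAE := by
  tfae_have 3 → 1 := UnifLip3.unifLip1 hT
  tfae_have 3 → 2 := UnifLip3.unifLip2 hT
  tfae_have 2 → 4 := UnifLip2.isValLipschitz j hS hT hop
  tfae_have 4 → 5 := fun h q hq => weak_of_isValLipschitz (hT q hq) hbig (h q hq)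
  tfae_have 1 → 5 := UnifLip1.isWeakValLipschitz j hS hbig hT hop
  tfae_have 5 → 3 := unifLip3_of_isWeakValLipschitz j hS hbig hT hop
  tfae_finish

end Valuative

variable [UniformRing L K K'] [UniformRing L K' K'] {S : Subring K'} (j : K ↪ₑ[L] K')
  (hS : ∀ x, x ∈ S ↔ ∃ a, j a = x) (hbig : ∃ x : K', ∀ s : K, j s < x)
  (hT : ∀ q ∈ F.Q K, Tame (F.fiber K q)) (hop : HasOpNorm K n)
include hS hbig hT hop

theorem unifLip_extension_tfae :
    [UnifLip1 (F.Q K) (F.fiber K), UnifLip2 (F.Q K) (F.fiber K), UnifLip3 (F.Q K) (F.fiber K),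
      UnifLip1 (F.Q K') (F.fiber K'), UnifLip2 (F.Q K') (F.fiber K'), UnifLip3 (F.Q K') (F.fiber K'),
      ∀ q ∈ F.Q K', IsValLipschitz (convexClosure S) (F.fiber K' q),
      ∀ q ∈ F.Q K', IsWeakValLipschitz (convexClosure S) (F.fiber K' q)].TFAE := by
  have hT' : ∀ q ∈ F.Q K', Tame (F.fiber K' q) := ((F.uDef_tame (K := K)).sentence_iff j).1 hT
  have hop' : HasOpNorm K' n := ((uDef_hasOpNorm (K := K) n).sentence_iff j).1 hop
  have hbig' : ∃ x : K', ∀ s ∈ S, s < x := hbig.imp fun x hx s hs => by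
    obtain ⟨a, rfl⟩ := (hS s).1 hs
    exact hx a
  have key := unifLip_val_tfae (F := F) j hS hbig' hT' hop'
  tfae_have 1 ↔ 4 := F.uDef_unifLip1.sentence_iff j
  tfae_have 2 ↔ 5 := F.uDef_unifLip2.sentence_iff j
  tfae_have 3 ↔ 6 := F.uDef_unifLip3.sentence_iff j
  tfae_have 4 ↔ 5 := key.out 0 1
  tfae_have 4 ↔ 6 := key.out 0 2
  tfae_have 4 ↔ 7 := key.out 0 3
  tfae_have 4 ↔ 8 := key.out 0 4
  tfae_finish

/-- A uniform version of the passage from a single constant `c > 1` to all constants. -/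
theorem unifLip3_of_mostowski {c C : K} (hc : 1 < c) (hC : 0 < C)
    (h : ∀ q ∈ F.Q K, Mostowski (F.fiber K q) c (2 * c ^ 2) (2 * c ^ 2) (2 * c) C) :
    UnifLip3 (F.Q K) (F.fiber K) := by
  have hT' : ∀ q ∈ F.Q K', Tame (F.fiber K' q) := ((F.uDef_tame (K := K)).sentence_iff j).1 hT
  have hop' : HasOpNorm K' n := ((uDef_hasOpNorm (K := K) n).sentence_iff j).1 hop
  have hbig' : ∃ x : K', ∀ s ∈ S, s < x := hbig.imp fun x hx s hs => by
    obtain ⟨a, rfl⟩ := (hS s).1 hs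
    exact hx a
  have hU : UDef L (fun v : Bool → K => 1 < v true ∧ 0 < v false ∧ ∀ q ∈ F.Q K, Mostowski (F.fiber K q)
        (v true) (2 * v true ^ 2) (2 * v true ^ 2) (2 * v true) (v false))
      (fun v : Bool → K' => 1 < v true ∧ 0 < v false ∧ ∀ q ∈ F.Q K', Mostowski (F.fiber K' q)
        (v true) (2 * v true ^ 2) (2 * v true ^ 2) (2 * v true) (v false)) :=
    (UFun.one.lt (UFun.var _)).and (F.uDef_mostowski₁ (UFun.var _) (UFun.var _))
  -- The hypothesis is transferred with `c` and `C` as parameters; their images lie in `S`, as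
  -- `weak_of_mostowski` demands.
  obtain ⟨h1, h2, h3⟩ := (hU.map_iff j fun b => bif b then c else C).1 ⟨hc, hC, h⟩
  refine (F.uDef_unifLip3.sentence_iff j).2
    (unifLip3_of_isWeakValLipschitz j hS hbig' hT' hop' fun q hq => ?_)
  exact weak_of_mostowski (hT' q hq) hop' hbig' ((hS _).2 ⟨_, rfl⟩) h1 ((hS _).2 ⟨_, rfl⟩) (h3 q hq)

end Equivalences

/-! ### Non-standard extensions -/

section Ultrapower

open Filter

variable {L : FirstOrder.Language.{u₁, u₂}} (ι : FirstOrder.Language.ring →ᴸ L) {K : Type v₁}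
  [Field K] [LinearOrder K] [IsStrictOrderedRing K]

variable (K) in
/-- An ultrapower of `K` whose ultrafilter contains all the final segments. -/
abbrev Ultrapower : Type v₁ := Germ (Ultrafilter.of (atTop : Filter K) : Filter K) K

/-- Roots are chosen coordinatewise, with a dummy value on the negligible set of negative
coordinates. -/
instance [HasSqrt K] : HasSqrt (Ultrapower K) where
  exists_sq x := Germ.inductionOn x fun f hf => by
    have h : ∀ a, ∃ y, 0 ≤ f a → 0 ≤ y ∧ y ^ 2 = f a := fun a => by
      by_cases h0 : 0 ≤ f a
      · exact (HasSqrt.exists_sq _ h0).imp fun y hy _ => hy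
      · exact ⟨0, fun h => (h0 h).elim⟩
    choose g hg using h
    have hf' : ∀ᶠ a in (Ultrafilter.of (atTop : Filter K) : Filter K), 0 ≤ f a := Germ.coe_le.1 hf
    exact ⟨(g : Ultrapower K), Germ.coe_le.2 (hf'.mono fun a ha => (hg a ha).1),
      Germ.coe_eq.2 (hf'.mono fun a ha => (hg a ha).2)⟩

instance [L.Structure K] : L.Structure (Ultrapower K) :=
  inferInstanceAs (L.Structure
    ((Ultrafilter.of (atTop : Filter K) : Filter K).Product fun _ : K => K))

lemma ultrapower_funMap [L.Structure K] {m : ℕ} (f : L.Functions m) (x : Fin m → K → K) :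
    Language.Structure.funMap f (fun i => ((x i : K → K) : Ultrapower K)) =
      ((fun a => Language.Structure.funMap f fun i => x i a : K → K) : Ultrapower K) :=
  Language.Ultraproduct.funMap_cast (M := fun _ : K => K) f x

lemma ultrapower_realize [L.Structure K] {β : Type*} (φ : L.Formula β) (x : β → K → K) :
    (φ.Realize fun i => ((x i : K → K) : Ultrapower K)) ↔
      ∀ᶠ a in (Ultrafilter.of (atTop : Filter K) : Filter K), φ.Realize fun i => x i a :=
  Language.Ultraproduct.realize_formula_cast (M := fun _ : K => K) φ x

/-- The diagonal embedding. -/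
def diagonal (L : FirstOrder.Language.{u₁, u₂}) (K : Type v₁) [Field K] [LinearOrder K]
    [IsStrictOrderedRing K] [L.Structure K] : K ↪ₑ[L] Ultrapower K where
  toFun x := ((fun _ => x : K → K) : Ultrapower K)
  map_formula' m φ x := by
    refine (ultrapower_realize φ fun i _ => x i).trans ?_
    exact eventually_const

/-- The index set is `K` itself, and the germ of the identity exceeds every constant on a final
segment. -/
lemma diagonal_lt [L.Structure K] (s : K) :
    diagonal L K s < ((fun a => a : K → K) : Ultrapower K) :=
  Germ.coe_lt.2 ((Ultrafilter.of_le (atTop : Filter K)) (Ioi_mem_atTop s))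

/-- Existence of a non-standard elementary extension. -/
theorem exists_nonstandard_extension [HasSqrt K] [FirstOrder.Ring.CompatibleRing K] [L.Structure K]
    [ι.IsExpansionOn K] :
    ∃ (K' : Type v₁) (_ : Field K') (_ : LinearOrder K') (_ : IsStrictOrderedRing K')
      (_ : HasSqrt K') (_ : FirstOrder.Ring.CompatibleRing K') (_ : L.Structure K')
      (_ : ι.IsExpansionOn K') (j : K ↪ₑ[L] K'), ∃ x : K', ∀ s : K, j s < x := by
  let _ := FirstOrder.Ring.compatibleRingOfRing (Ultrapower K)
  have hexp : ι.IsExpansionOn (Ultrapower K) := by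
    constructor
    · intro m f x
      -- On representatives the symbols act coordinatewise, both in the ultraproduct structure and
      -- in the ring of germs.
      obtain ⟨y, rfl⟩ : ∃ y : Fin m → K → K, x = fun i => ((y i : K → K) : Ultrapower K) :=
        ⟨fun i => (x i).out, funext fun i => (Quotient.out_eq (x i)).symm⟩
      rw [ultrapower_funMap]
      simp only [Language.LHom.map_onFunction]
      cases f <;> simp <;> rfl
    · intro m R
      exact R.elim
  exact ⟨Ultrapower K, inferInstance, inferInstance, inferInstance, inferInstance, inferInstance,
    inferInstance, hexp, diagonal L K, _, diagonal_lt⟩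

end Ultrapower

lemma mem_toSubring_range {L : FirstOrder.Language.{u₁, u₂}} (ι : FirstOrder.Language.ring →ᴸ L)
    {A : Type*} {K : Type v₁} [L.Structure A] [Field K] [FirstOrder.Ring.CompatibleRing K]
    [L.Structure K] [ι.IsExpansionOn K] (j : A ↪ₑ[L] K) (x : K) :
    x ∈ toSubring ι j.toEmbedding.toHom.range ↔ ∃ a, j a = x := Iff.rfl

/-! ### Single stratifications as families -/

/-- A family consisting of a single filtration. -/
def singleFamily {L : FirstOrder.Language.{u₁, u₂}} {n d : ℕ} (φ : Fin (d + 1) → L.Formula (Fin n)) :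
    Family L 0 n d where
  base := ⊤
  strat i := (φ i).relabel Sum.inl

section Single

variable {L : FirstOrder.Language.{u₁, u₂}} {K : Type v₁} [L.Structure K] {n d : ℕ}
  (φ : Fin (d + 1) → L.Formula (Fin n))

lemma singleFamily_mem (q : Fin 0 → K) : q ∈ (singleFamily φ).Q K := by
  simp [singleFamily, Family.Q]

lemma singleFamily_fiber {X : Fin (d + 1) → Set (Fin n → K)} (hφ : ∀ i, X i = Set.ofPred (φ i).Realize)
    (q : Fin 0 → K) : (singleFamily φ).fiber K q = X := by
  funext i
  ext x
  simp [singleFamily, Family.fiber, hφ]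

lemma singleFamily_forall {X : Fin (d + 1) → Set (Fin n → K)}
    (hφ : ∀ i, X i = Set.ofPred (φ i).Realize) (P : (Fin (d + 1) → Set (Fin n → K)) → Prop) :
    (∀ q ∈ (singleFamily φ).Q K, P ((singleFamily φ).fiber K q)) ↔ P X := by
  simp only [singleFamily_fiber φ hφ]
  exact ⟨fun h => h Fin.elim0 (singleFamily_mem φ _), fun h _ _ => h⟩

end Single

end LipStrat

/-! ### Assembly of the proposition -/

open LipStrat in
theorem proposition1p3
    {L : FirstOrder.Language} (ι : FirstOrder.Language.ring →ᴸ L)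
    {K : Type*} [Field K] [LinearOrder K] [IsStrictOrderedRing K] [IsRealClosed K]
    [TopologicalSpace K] [OrderTopology K]
    [FirstOrder.Ring.CompatibleRing K] [L.Structure K] [ι.IsExpansionOn K]
    (hK : OMinimal L K) (hpow : PowerBounded L K) :
    -- single stratifications, Parusiński's definition with any fixed `c₀ > 1`
    (∀ (n d : ℕ) (X : Fin (d + 1) → Set (Fin n → K)),
      (∀ i, (∅ : Set K).Definable L (X i)) → IsStratification L X →
      ∀ c₀ : K, 1 < c₀ →
        [IsLipschitz c₀ X,
          ∀ c > (0 : K), ∃ C > 0, Mostowski X c c C C C,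
          ∀ c > (0 : K), ∃ C > 0, Mostowski X c c 1 (1 / c) C].TFAE) ∧
    -- families of stratifications
    (∀ (N n d : ℕ) (F : Family L N n d), F.IsStratFamily K →
      -- the uniform conditions, in the given field
      [UnifLip1 (F.Q K) (F.fiber K), UnifLip2 (F.Q K) (F.fiber K),
        UnifLip3 (F.Q K) (F.fiber K)].TFAE ∧
      -- the valuative conditions, if the given field is itself a non-standard elementary extension
      (∀ S : L.ElementarySubstructure K, (∃ x : K, ∀ s ∈ S, s < x) →
        [UnifLip1 (F.Q K) (F.fiber K), UnifLip2 (F.Q K) (F.fiber K),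
          UnifLip3 (F.Q K) (F.fiber K),
          ∀ q ∈ F.Q K,
            IsValLipschitz (convexClosure (toSubring ι S.toSubstructure)) (F.fiber K q),
          ∀ q ∈ F.Q K,
            IsWeakValLipschitz (convexClosure (toSubring ι S.toSubstructure))
              (F.fiber K q)].TFAE) ∧
      -- the valuative conditions in a non-standard elementary extension of the given field
      (∀ (K' : Type*) [Field K'] [LinearOrder K'] [IsStrictOrderedRing K'] [IsRealClosed K']
        [FirstOrder.Ring.CompatibleRing K'] [L.Structure K'] [ι.IsExpansionOn K']
        (j : K ↪ₑ[L] K'), (∃ x : K', ∀ s : K, j s < x) →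
        [UnifLip1 (F.Q K) (F.fiber K), UnifLip2 (F.Q K) (F.fiber K),
          UnifLip3 (F.Q K) (F.fiber K),
          UnifLip1 (F.Q K') (F.fiber K'), UnifLip2 (F.Q K') (F.fiber K'),
          UnifLip3 (F.Q K') (F.fiber K'),
          ∀ q ∈ F.Q K',
            IsValLipschitz (convexClosure (toSubring ι j.toEmbedding.toHom.range))
              (F.fiber K' q),
          ∀ q ∈ F.Q K',
            IsWeakValLipschitz (convexClosure (toSubring ι j.toEmbedding.toHom.range))
              (F.fiber K' q)].TFAE)) := by
  have hR : UniformRing L K K := uniformRing ι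
  -- The conditions in `K` alone are compared by passing through this auxiliary extension and its
  -- valuation.
  obtain ⟨E, _, _, _, _, _, _, _, jE, hE⟩ := exists_nonstandard_extension ι (K := K)
  have hR' : UniformRing L K E := uniformRing ι
  have hR'' : UniformRing L E E := uniformRing ι
  have families : ∀ (N n d : ℕ) (F : Family L N n d), F.IsStratFamily K →
      [UnifLip1 (F.Q K) (F.fiber K), UnifLip2 (F.Q K) (F.fiber K),
        UnifLip3 (F.Q K) (F.fiber K)].TFAE := fun N n d F hF => by
    have key := unifLip_extension_tfae (F := F) jE (mem_toSubring_range ι jE) hE (hK.tame hF)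
      (hK.hasOpNorm n)
    tfae_have 1 ↔ 2 := key.out 0 1
    tfae_have 1 ↔ 3 := key.out 0 2
    tfae_finish
  refine ⟨fun n d X hX hS c₀ hc₀ => ?_, fun N n d F hF => ⟨families N n d F hF, fun S hS => ?_, ?_⟩⟩
  -- Definability without parameters provides formulas, which form a family over the one-point set
  -- `K ^ 0`.
  · choose φ hφ using fun i => Set.empty_definable_iff.1 (hX i)
    have hF : (singleFamily φ).IsStratFamily K := (singleFamily_forall φ hφ _).2 hS
    have h2 : UnifLip2 ((singleFamily φ).Q K) ((singleFamily φ).fiber K) ↔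
        ∀ c > (0 : K), ∃ C > 0, Mostowski X c c C C C :=
      forall₂_congr fun c _ => exists_congr fun C => and_congr Iff.rfl
        (singleFamily_forall φ hφ fun X => Mostowski X c c C C C)
    have h3 : UnifLip3 ((singleFamily φ).Q K) ((singleFamily φ).fiber K) ↔
        ∀ c > (0 : K), ∃ C > 0, Mostowski X c c 1 (1 / c) C :=
      forall₂_congr fun c _ => exists_congr fun C => and_congr Iff.rfl
        (singleFamily_forall φ hφ fun X => Mostowski X c c 1 (1 / c) C)
    rw [← h2, ← h3]
    have key := families 0 n d _ hF
    tfae_have 2 ↔ 3 := key.out 1 2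
    -- Only the one constant `c₀` is known here, so the family version does not apply. In the
    -- extension, `c₀` and `C` belong to the smaller structure, and one constant there suffices.
    tfae_have 1 → 3 := fun ⟨C, hC, h⟩ =>
      unifLip3_of_mostowski jE (mem_toSubring_range ι jE) hE (hK.tame hF) (hK.hasOpNorm n) hc₀ hC
        ((singleFamily_forall φ hφ fun X => Mostowski X c₀ (2 * c₀ ^ 2) (2 * c₀ ^ 2) (2 * c₀) C).2 h)
    tfae_have 3 → 1 := fun h => by
      have h31 : UnifLip3 ((singleFamily φ).Q K) ((singleFamily φ).fiber K) ↔
        UnifLip1 ((singleFamily φ).Q K) ((singleFamily φ).fiber K) := key.out 2 0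
      obtain ⟨C, hC, h'⟩ := h31.1 h c₀ (zero_lt_one.trans hc₀)
      exact ⟨C, hC, (singleFamily_forall φ hφ fun X =>
        Mostowski X c₀ (2 * c₀ ^ 2) (2 * c₀ ^ 2) (2 * c₀) C).1 h'⟩
    tfae_finish
  · exact unifLip_val_tfae S.subtype (fun x => ⟨fun hx => ⟨⟨x, hx⟩, rfl⟩, fun ⟨a, ha⟩ => ha ▸ a.2⟩) hS
      (hK.tame hF) (hK.hasOpNorm n)
  · intro K' _ _ _ _ _ _ _ j hj
    have hRK : UniformRing L K K' := uniformRing ι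
    have hRK' : UniformRing L K' K' := uniformRing ι
    exact unifLip_extension_tfae j (mem_toSubring_range ι j) hj (hK.tame hF) (hK.hasOpNorm n)

end
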